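/- Let $d\ge 1$ and let $X$ be a random vector with values in $\mathbb{R}^d_+=[0,\infty)^d$. Let $M_n$ be the component-wise maximum of $n$ i.i.d. copies of $X$, and suppose that there are vectors $a_n\in(0,\infty)^d$, $n\ge 1$, such that $\|a_n\|_\infty^{-1}a_n$ converges to some $\hat a\in\mathbb{R}^d_+$ and the law of the component-wise quotient $M_n/a_n$ converges weakly to a probability law on $\mathbb{R}^d$ with nondegenerate marginals. Let $\ell:\mathbb{R}\to\mathbb{R}$ be Borel measurable, nonnegative and bounded on every bounded subinterval of $[0,\infty)$, and differentiable at all $u>u_0$ for some $u_0>0$, with $\ell'(u)=c_1u^{\rho}(1+o(1))$ as $u\to\infty$ for some $c_1>0$, $\rho\ge 0$. Let $\Theta\subseteq(0,\infty)^d$ be such that $\ell(\theta^\intercal X)$ has finite variance for every $\theta\in\Theta$. For $\theta\in\mathbb{R}^d$ and $\beta\in(0,1)$ put $L(\theta)=\ell(\theta^\intercal X)$, $$v_\beta(\theta)=\inf\{u\in\mathbb{R}: P(L(\theta)\le u)\ge 1-\beta\},\qquad C_\beta(\theta)=E\big[L(\theta)\,\big|\,L(\theta)\ge v_\beta(\theta)\big].$$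 Then every component $X_k$ has a tail index $\alpha_k\in(0,\infty)$, that is, $P(X_k>ct)/P(X_k>t)\to c^{-\alpha_k}$ as $t\to\infty$ for every $c>0$. With $\xi=1/\min_{1\le k\le d}\alpha_k$, the following holds for every $\theta\in\Theta$, as $\beta\searrow 0$ and $\beta_0/\beta\to c\in(1,\infty)$: 1. $C_\beta(\theta)=(\beta_0/\beta)^{\xi(\rho+1)}\,C_{\beta_0}(\theta)\,(1+o(1))$. 2. If $X$ has a probability density, then $C_\beta$ is differentiable at $\theta$ for all sufficiently small $\beta>0$, and $$\nabla C_\beta(\theta)=(\beta_0/\beta)^{\xi(\rho+1)}\,\nabla C_{\beta_0}(\theta)\,(1+o(1))$$ in the sense that the norm of the difference of $\nabla C_\beta(\theta)$ and $(\beta_0/\beta)^{\xi(\rho+1)}\nabla C_{\beta_0}(\theta)$ is $o\big((\beta_0/\beta)^{\xi(\rho+1)}\|\nabla C_{\beta_0}(\theta)\|\big)$. Moreover the relation holds for the $k$-th partial derivative, for every $k$ with $\hat a_k>0$. -/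

import Mathlib

open MeasureTheory ProbabilityTheory Filter Topology Asymptotics

namespace TailRisk

noncomputable section

/-- The component-wise maxima `M_n` of `n` independent copies of `X`. The copies are
`ω ↦ X (ω i)`, `i : Fin n`, on the `n`-fold product of the probability space of `X`. -/
def componentMax {d : ℕ} {Ω : Type*} (X : Ω → EuclideanSpace ℝ (Fin d)) (n : ℕ)
    (ω : Fin n → Ω) : Fin d → ℝ :=
  fun k => ⨆ i, X (ω i) k

/-- Heavy tails: with positive normalising vectors `a n`, the vectors `a n / ‖a n‖_∞` converge
(to `ahat`; the norm on `Fin d → ℝ` is the sup norm) and the law of the component-wise quotient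
`M_n / a n` converges weakly to a probability law all of whose marginals are nondegenerate. -/
structure HeavyTailed {d : ℕ} {Ω : Type*} [MeasurableSpace Ω] (P : Measure Ω)
    [IsProbabilityMeasure P] (X : Ω → EuclideanSpace ℝ (Fin d))
    (a : ℕ → Fin d → ℝ) (ahat : Fin d → ℝ) : Prop where
  pos : ∀ n k, 0 < a n k
  tendsto_ratio : Tendsto (fun n => ‖a n‖⁻¹ • a n) atTop (𝓝 ahat)
  tendsto_max : ∃ (G : Measure (Fin d → ℝ)) (_ : IsProbabilityMeasure G),
    (∀ k x, G.map (fun z => z k) ≠ Measure.dirac x) ∧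
    TendstoInDistribution (fun n ω => fun k => componentMax X n ω k / a n k) atTop
      (fun z => z) (fun n => Measure.pi (fun _ : Fin n => P)) G

/-- `α > 0` is the tail index of the random variable `Y`: the tail `t ↦ P(Y > t)` is regularly
varying at infinity with index `-α`. -/
def HasTailIndex {Ω : Type*} [MeasurableSpace Ω] (P : Measure Ω) (Y : Ω → ℝ) (α : ℝ) : Prop :=
  0 < α ∧ ∀ c : ℝ, 0 < c →
    Tendsto (fun t : ℝ => P.real {ω | c * t < Y ω} / P.real {ω | t < Y ω}) atTop (𝓝 (c ^ (-α)))

/-- The assumptions on the loss function: it is Borel; on `[0, ∞)`, where `θᵀX` takes its values,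
it is nonnegative and bounded on bounded intervals; it is differentiable beyond a positive
constant, and `ℓ' u = c₁ u ^ ρ (1 + o(1))` as `u → ∞`. -/
structure LossGrowth (ℓ : ℝ → ℝ) (c₁ ρ : ℝ) : Prop where
  measurable : Measurable ℓ
  nonneg : ∀ u, 0 ≤ u → 0 ≤ ℓ u
  bddAbove : ∀ M : ℝ, BddAbove (ℓ '' Set.Icc 0 M)
  c₁_pos : 0 < c₁
  ρ_nonneg : 0 ≤ ρ
  differentiable : ∃ u₀ : ℝ, 0 < u₀ ∧ ∀ u, u₀ < u → DifferentiableAt ℝ ℓ u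
  deriv_equiv : deriv ℓ ~[atTop] fun u => c₁ * u ^ ρ

/-- The value at risk of `L` at level `1 - β`, i.e. its `(1 - β)`-quantile. -/
def VaR {Ω : Type*} [MeasurableSpace Ω] (P : Measure Ω) (L : Ω → ℝ) (β : ℝ) : ℝ :=
  sInf {u : ℝ | 1 - β ≤ P.real {ω | L ω ≤ u}}

/-- The conditional value at risk `E[L | L ≥ VaR]` of `L` at level `1 - β`. -/
def CVaR {Ω : Type*} [MeasurableSpace Ω] (P : Measure Ω) (L : Ω → ℝ) (β : ℝ) : ℝ :=
  ∫ ω, L ω ∂(P[|{ω | VaR P L β ≤ L ω}])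

/-- `C_β(θ)`: the conditional value at risk of the loss `ℓ(θᵀX)`. -/
def lossCVaR {d : ℕ} {Ω : Type*} [MeasurableSpace Ω] (P : Measure Ω)
    (X : Ω → EuclideanSpace ℝ (Fin d)) (ℓ : ℝ → ℝ) (β : ℝ) (θ : EuclideanSpace ℝ (Fin d)) : ℝ :=
  CVaR P (fun ω => ℓ (inner ℝ θ (X ω))) β

end

end TailRisk

/-! Write `S = θᵀX`. Independence gives `P(M_n ≤ a_n x) = P(X ≤ a_n x) ^ n`, so weak convergence
makes `n (1 - P(X ≤ a_n x))` converge at uncharged thresholds. For one coordinate this forces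
regular variation of the tail (`exists_isRVTail_of_tendsto_mul`). For several coordinates, with `n`
replaced by a continuous parameter, the probability that `X / t` leaves a box is asymptotically
proportional to `H t = P(X_{k₀} > t)`, where `ahat k₀ > 0` (`HeavyTailed.exists_regular_variation`).
All marginal tails are `O(H)`, so the index `α` of `H` is the smallest one. Step functions carry the
convergence from boxes to continuous functions of `X / t` that vanish near the origin. Hence `P(S >
t) ~ s H t` with `s > 0`, and `E[X_k / S; S > t] / P(S > t)` tends to some `p k`, positive when
`ahat k > 0` (`isRVTail_inner`).

For small `β` the event `ℓ(S) ≥ v_β` is `S ≥ w` for a high threshold `w` with `P(S > w) ~ β`,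
because `ℓ` is eventually strictly increasing and bounded before that. Finite variance gives `2 (ρ +
1) ≤ α`, so Karamata's theorem applies to the moment of order `ρ + 1`: `E[ℓ(S) | S ≥ w]` is
asymptotic to a positive constant times `w ^ (ρ + 1)`. Regular variation inverts to `w(β) / w(β₀) →
c ^ (1 / α)`, and the power of this ratio is the extrapolation factor (`isEquivalent_of_threshold`).

If `X` has a density, the exceedance event has probability exactly `β` for all parameters near `θ`.
It maximises the integral of the loss among events of that probability, so its variation contributes
nothing to first order (`hasFDerivAt_setIntegral_levelSet`), and `∇C_β(θ) = E[ℓ'(S) X | S ≥ w]`.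
Since `X_k ℓ'(S) = (X_k / S) (S ℓ'(S))` has a bounded first factor and `u ℓ'(u) ~ c₁ u ^ (ρ + 1)`,
Karamata's theorem with a weight makes the gradient asymptotic to `w ^ (ρ + 1)` times a vector
proportional to `p`. As `p ≠ 0`, the same extrapolation applies to the gradient, and to its `k`-th
coordinate when `p k > 0`. -/

namespace TailRisk

/-! ### Regular variation of monotone tails -/

/-- An antitone nonnegative function that is regularly varying at infinity with index `-α`,
`α > 0`. -/
structure IsRVTail (T : ℝ → ℝ) (α : ℝ) : Prop where
  anti : Antitone T
  nonneg : ∀ t, 0 ≤ T t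
  index_pos : 0 < α
  tendsto : ∀ c : ℝ, 0 < c → Tendsto (fun t => T (c * t) / T t) atTop (𝓝 (c ^ (-α)))

namespace IsRVTail

variable {T : ℝ → ℝ} {α : ℝ}

/-- A zero of `T` would persist to its right, and there the quotient, `0` by the convention `x / 0 =
0`, could not tend to `2 ^ (-α) ≠ 0`. -/
lemma pos (h : IsRVTail T α) (t : ℝ) : 0 < T t := by
  have h1 := (h.tendsto 2 two_pos).eventually_ne (by positivity : (2 : ℝ) ^ (-α) ≠ 0)
  obtain ⟨s, hs, hts⟩ := (h1.and (eventually_ge_atTop t)).exists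
  refine lt_of_lt_of_le ((h.nonneg s).lt_of_ne fun h0 => hs ?_) (h.anti hts)
  rw [← h0, div_zero]

lemma eventually_div_lt (h : IsRVTail T α) {ι : Type*} {l : Filter ι} {x y : ι → ℝ}
    (hx : Tendsto x l atTop) {s b : ℝ} (hs : 0 < s) (hb : s ^ (-α) < b)
    (hy : ∀ᶠ i in l, s * x i ≤ y i) : ∀ᶠ i in l, T (y i) / T (x i) < b := by
  filter_upwards [hy, ((h.tendsto s hs).comp hx).eventually_lt_const hb] with i h1 h2
  exact lt_of_le_of_lt (div_le_div_of_nonneg_right (h.anti h1) (h.nonneg _)) h2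

lemma eventually_lt_div (h : IsRVTail T α) {ι : Type*} {l : Filter ι} {x y : ι → ℝ}
    (hx : Tendsto x l atTop) {s b : ℝ} (hs : 0 < s) (hb : b < s ^ (-α))
    (hy : ∀ᶠ i in l, y i ≤ s * x i) : ∀ᶠ i in l, b < T (y i) / T (x i) := by
  filter_upwards [hy, ((h.tendsto s hs).comp hx).eventually_const_lt hb] with i h1 h2
  exact lt_of_lt_of_le h2 (div_le_div_of_nonneg_right (h.anti h1) (h.nonneg _))

/-- Monotonicity replaces the uniform convergence theorem: `y i` is compared with `s' * x i` for
fixed `s'` on either side of `s`, and `s ↦ s ^ (-α)` is continuous. -/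
lemma tendsto_div (h : IsRVTail T α) {ι : Type*} {l : Filter ι} {x y : ι → ℝ}
    (hx : Tendsto x l atTop) {s : ℝ} (hs : 0 < s) (hy : Tendsto (fun i => y i / x i) l (𝓝 s)) :
    Tendsto (fun i => T (y i) / T (x i)) l (𝓝 (s ^ (-α))) := by
  have hc : ContinuousAt (fun r : ℝ => r ^ (-α)) s :=
    Real.continuousAt_rpow_const _ _ (Or.inl hs.ne')
  have hx0 := hx.eventually_gt_atTop 0
  refine tendsto_order.2 ⟨fun b hb => ?_, fun b hb => ?_⟩
  · obtain ⟨s', h1, h2⟩ := (((hc.eventually_const_lt hb).filter_mono nhdsWithin_le_nhds).and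
      (self_mem_nhdsWithin : Set.Ioi s ∈ 𝓝[>] s)).exists
    refine h.eventually_lt_div hx (hs.trans h2) h1 ?_
    filter_upwards [hy.eventually_lt_const h2, hx0] with i h3 h4
    exact ((div_lt_iff₀ h4).1 h3).le
  · obtain ⟨s', ⟨h1, h3⟩, h2⟩ := ((((hc.eventually_lt_const hb).and
      (lt_mem_nhds hs)).filter_mono nhdsWithin_le_nhds).and
      (self_mem_nhdsWithin : Set.Iio s ∈ 𝓝[<] s)).exists
    refine h.eventually_div_lt hx h3 h1 ?_
    filter_upwards [hy.eventually_const_lt h2, hx0] with i h3 h4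
    exact ((lt_div_iff₀ h4).1 h3).le

lemma tendsto_div_zero (h : IsRVTail T α) {ι : Type*} {l : Filter ι} {x y : ι → ℝ}
    (hx : Tendsto x l atTop) (hy : Tendsto (fun i => y i / x i) l atTop) :
    Tendsto (fun i => T (y i) / T (x i)) l (𝓝 0) := by
  have hx0 := hx.eventually_gt_atTop 0
  refine tendsto_order.2 ⟨fun b hb => ?_, fun b hb => ?_⟩
  · exact Eventually.of_forall fun i => hb.trans_le (div_nonneg (h.nonneg _) (h.nonneg _))
  · obtain ⟨s, h1, h2⟩ := (((tendsto_rpow_neg_atTop h.index_pos).eventually_lt_const hb).and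
      (eventually_gt_atTop 0)).exists
    refine h.eventually_div_lt hx h2 h1 ?_
    filter_upwards [hy.eventually_gt_atTop s, hx0] with i h3 h4
    exact ((lt_div_iff₀ h4).1 h3).le

/-- Asymptotic inversion of `T`: were `y i / x i` to stay off the claimed limit, antitonicity would
push the quotient of tails off `r`. It yields both the time change for the norming constants and the
ratio of quantiles. -/
lemma tendsto_arg_div (h : IsRVTail T α) {ι : Type*} {l : Filter ι} {x y : ι → ℝ}
    (hx : Tendsto x l atTop) {r : ℝ} (hr : 0 < r)
    (hT : Tendsto (fun i => T (y i) / T (x i)) l (𝓝 r)) :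
    Tendsto (fun i => y i / x i) l (𝓝 (r ^ (-α⁻¹))) := by
  have hx0 := hx.eventually_gt_atTop 0
  have hα := h.index_pos
  have hr' : (r ^ (-α⁻¹)) ^ (-α) = r := by
    rw [← Real.rpow_mul hr.le]; field_simp; simp
  have hp : 0 < r ^ (-α⁻¹) := by positivity
  have key : ∀ b, 0 < b → r ^ (-α⁻¹) < b → ∀ᶠ i in l, y i / x i < b := fun b hb0 hb => by
    have h1 : b ^ (-α) < r := by
      rw [← hr']; exact Real.rpow_lt_rpow_of_neg hp hb (by linarith)
    obtain ⟨m, hm1, hm2⟩ := exists_between h1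
    filter_upwards [((h.tendsto b hb0).comp hx).eventually_lt_const hm1,
      hT.eventually_const_lt hm2, hx0] with i h2 h3 h4
    rw [div_lt_iff₀ h4]
    by_contra! hcon
    have := div_le_div_of_nonneg_right (h.anti hcon) (h.nonneg (x i))
    simp only [Function.comp] at h2
    linarith
  refine tendsto_order.2 ⟨fun b hb => ?_, fun b hb => key b (hp.trans hb) hb⟩
  obtain ⟨b', hb1, hb2⟩ := exists_between (max_lt hb hp)
  have hb0 : 0 < b' := (le_max_right _ _).trans_lt hb1
  have h1 : r < b' ^ (-α) := by
    rw [← hr']; exact Real.rpow_lt_rpow_of_neg hb0 hb2 (by linarith)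
  obtain ⟨m, hm1, hm2⟩ := exists_between h1
  filter_upwards [((h.tendsto b' hb0).comp hx).eventually_const_lt hm2,
    hT.eventually_lt_const hm1, hx0] with i h2 h3 h4
  refine ((le_max_left b 0).trans_lt hb1).trans ?_
  rw [lt_div_iff₀ h4]
  by_contra! hcon
  have := div_le_div_of_nonneg_right (h.anti hcon) (h.nonneg (x i))
  simp only [Function.comp] at h2
  linarith

lemma tendsto_comp_mul (h : IsRVTail T α) {φ : ℝ → ℝ} {L : ℝ}
    (hφ : Tendsto (fun t => φ t / T t) atTop (𝓝 L)) {c : ℝ} (hc : 0 < c) :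
    Tendsto (fun t => φ (c * t) / T t) atTop (𝓝 (L * c ^ (-α))) := by
  refine ((hφ.comp (tendsto_id.const_mul_atTop hc)).mul (h.tendsto c hc)).congr fun t => ?_
  exact div_mul_div_cancel₀ (h.pos _).ne'

/-- A Potter type bound. -/
lemma exists_potter (h : IsRVTail T α) {q : ℝ} (hq0 : 0 < q) (hq : q < α) :
    ∃ A w₀ : ℝ, 0 < A ∧ 0 < w₀ ∧ ∀ w, w₀ ≤ w → ∀ y, 1 ≤ y → T (w * y) ≤ A * y ^ (-q) * T w := by
  have h1 : (2 : ℝ) ^ (-α) < 2 ^ (-q) :=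
    Real.rpow_lt_rpow_of_exponent_lt one_lt_two (by linarith)
  obtain ⟨w₀, hw₀⟩ := eventually_atTop.1 ((h.tendsto 2 two_pos).eventually_lt_const h1)
  -- The factor `2 ^ q` pays for rounding `y` down to a power of two; between powers of two each
  -- doubling gains `2 ^ (-q)`.
  refine ⟨2 ^ q, max w₀ 1, by positivity, by positivity, fun w hw y hy => ?_⟩
  have hw1 : w₀ ≤ w := (le_max_left _ _).trans hw
  have hw0 : 0 < w := lt_of_lt_of_le (by positivity) hw
  have hj : ∀ j : ℕ, T (2 ^ j * w) ≤ ((2 : ℝ) ^ (-q)) ^ j * T w := by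
    intro j
    induction j with
    | zero => simp
    | succ j ih =>
      have h2 : w₀ ≤ 2 ^ j * w := hw1.trans (le_mul_of_one_le_left hw0.le (one_le_pow₀ one_le_two))
      have h3 := (div_lt_iff₀ (h.pos _)).1 (hw₀ _ h2)
      calc T (2 ^ (j + 1) * w) = T (2 * (2 ^ j * w)) := by ring_nf
        _ ≤ 2 ^ (-q) * T (2 ^ j * w) := h3.le
        _ ≤ 2 ^ (-q) * (((2 : ℝ) ^ (-q)) ^ j * T w) := by gcongr
        _ = _ := by ring
  obtain ⟨j, hj1, hj2⟩ := exists_nat_pow_near hy one_lt_two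
  calc T (w * y) ≤ T (2 ^ j * w) := h.anti (by nlinarith)
    _ ≤ ((2 : ℝ) ^ (-q)) ^ j * T w := hj j
    _ ≤ 2 ^ q * y ^ (-q) * T w := by
      refine mul_le_mul_of_nonneg_right ?_ (h.nonneg _)
      have : ((2 : ℝ) ^ (j + 1)) ^ (-q) ≤ y ^ (-q) :=
        Real.rpow_le_rpow_of_nonpos (by linarith) hj2.le (by linarith)
      calc ((2 : ℝ) ^ (-q)) ^ j = 2 ^ q * ((2 : ℝ) ^ (j + 1)) ^ (-q) := by
            rw [← Real.rpow_natCast, ← Real.rpow_natCast, ← Real.rpow_mul two_pos.le,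
              ← Real.rpow_mul two_pos.le, ← Real.rpow_add two_pos]
            congr 1; push_cast; ring
        _ ≤ _ := by gcongr

end IsRVTail

/-- Along `u₀, 2 u₀, 4 u₀, …` the function grows geometrically with a ratio between `1` and `μ`.
This turns boundedness into inequalities between indices. -/
lemma not_bounded_of_doubling {r : ℝ → ℝ} {μ : ℝ} (hμ : 1 < μ) (hr : ∀ᶠ u in atTop, 0 < r u)
    (h : Tendsto (fun u => r (2 * u) / r u) atTop (𝓝 μ)) (M : ℝ) :
    ¬ ∀ᶠ u in atTop, r u ≤ M := by
  intro hM
  obtain ⟨lam, h1, h2⟩ := exists_between hμ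
  obtain ⟨u₀, hu₀⟩ := eventually_atTop.1
    ((hr.and (h.eventually_const_lt h2)).and (hM.and (eventually_gt_atTop 0)))
  have hu0 : 0 < u₀ := (hu₀ u₀ le_rfl).2.2
  have hge : ∀ j : ℕ, u₀ ≤ 2 ^ j * u₀ := fun j =>
    le_mul_of_one_le_left hu0.le (one_le_pow₀ one_le_two)
  have hj : ∀ j : ℕ, lam ^ j * r u₀ ≤ r (2 ^ j * u₀) := by
    intro j
    induction j with
    | zero => simp
    | succ j ih =>
      have h3 := hu₀ _ (hge j)
      have h4 := (lt_div_iff₀ h3.1.1).1 h3.1.2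
      calc lam ^ (j + 1) * r u₀ = lam * (lam ^ j * r u₀) := by ring
        _ ≤ lam * r (2 ^ j * u₀) := by gcongr
        _ ≤ r (2 * (2 ^ j * u₀)) := h4.le
        _ = _ := by ring_nf
  have hr0 := (hu₀ u₀ le_rfl).1.1
  obtain ⟨j, hjj⟩ := pow_unbounded_of_one_lt (M / r u₀) h1
  have := (div_lt_iff₀ hr0).1 hjj
  linarith [hj j, (hu₀ _ (hge j)).2.1]

/-- If `u ^ p * T u` is bounded then `p` is at most the index. -/
lemma IsRVTail.le_of_moment {T : ℝ → ℝ} {α : ℝ} (h : IsRVTail T α) {p M : ℝ}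
    (hM : ∀ᶠ u in atTop, u ^ p * T u ≤ M) : p ≤ α := by
  by_contra! hlt
  refine not_bounded_of_doubling (r := fun u => u ^ p * T u) (μ := 2 ^ (p - α))
    (Real.one_lt_rpow one_lt_two (by linarith)) ?_ ?_ M hM
  · filter_upwards [eventually_gt_atTop 0] with u hu
    have := h.pos u
    positivity
  · have := ((h.tendsto 2 two_pos).const_mul ((2 : ℝ) ^ p))
    rw [← Real.rpow_add two_pos, ← sub_eq_add_neg] at this
    refine this.congr' ?_
    filter_upwards [eventually_gt_atTop 0] with u hu
    have := h.pos u
    rw [Real.mul_rpow two_pos.le hu.le]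
    have : u ^ p ≠ 0 := by positivity
    field_simp

/-- The doubling ratio of `T / H` tends to `2 ^ (α₀ - α)`, which must not exceed `1`. This is how
the smallest marginal index is identified. -/
lemma IsRVTail.index_le_of_bounded {T H : ℝ → ℝ} {α α₀ : ℝ} (h : IsRVTail T α)
    (h₀ : IsRVTail H α₀) {M : ℝ} (hM : ∀ᶠ u in atTop, T u / H u ≤ M) : α₀ ≤ α := by
  by_contra! hlt
  refine not_bounded_of_doubling (r := fun u => T u / H u) (μ := 2 ^ (α₀ - α))
    (Real.one_lt_rpow one_lt_two (by linarith))
    (Eventually.of_forall fun u => div_pos (h.pos u) (h₀.pos u)) ?_ M hM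
  have := (h.tendsto 2 two_pos).div (h₀.tendsto 2 two_pos) (by positivity)
  rw [← Real.rpow_sub two_pos, show -α - -α₀ = α₀ - α by ring] at this
  refine this.congr fun u => ?_
  simp only [Pi.div_apply]
  have := h.pos u
  have := h₀.pos u
  have := h₀.pos (2 * u)
  field_simp

/-- A function asymptotically proportional to a regularly varying tail is one, of the same
index. -/
lemma IsRVTail.of_tendsto_div {T H : ℝ → ℝ} {α p : ℝ} (h : IsRVTail H α) (hT : Antitone T)
    (hT0 : ∀ t, 0 ≤ T t) (hp : 0 < p) (hlim : Tendsto (fun t => T t / H t) atTop (𝓝 p)) :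
    IsRVTail T α where
  anti := hT
  nonneg := hT0
  index_pos := h.index_pos
  tendsto c hc := by
    have h1 : Tendsto (fun t => T (c * t) / H (c * t)) atTop (𝓝 p) :=
      hlim.comp (tendsto_id.const_mul_atTop hc)
    have h2 := (h1.mul (h.tendsto c hc)).div hlim hp.ne'
    rw [mul_div_assoc, mul_div_cancel₀ _ hp.ne'] at h2
    · refine h2.congr fun t => ?_
      have := (h.pos t).ne'
      have := (h.pos (c * t)).ne'
      simp only [Pi.div_apply]
      field_simp

end TailRisk

/-! ### From convergence along a sequence of scales to regular variation -/

namespace TailRisk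

/-- A function whose quotients `T (c * t) / T t` all have positive limits is regularly varying. -/
lemma exists_rpow_of_tendsto_ratio {T : ℝ → ℝ} (hT : Antitone T) (hpos : ∀ t, 0 < T t)
    (h : ∀ c : ℝ, 0 < c → ∃ p : ℝ, 0 < p ∧ Tendsto (fun t => T (c * t) / T t) atTop (𝓝 p)) :
    ∃ α : ℝ, 0 ≤ α ∧
      ∀ c : ℝ, 0 < c → Tendsto (fun t => T (c * t) / T t) atTop (𝓝 (c ^ (-α))) := by
  choose! ψ hψ0 hψ using h
  have hmul : ∀ c e : ℝ, 0 < c → 0 < e → ψ (c * e) = ψ c * ψ e := by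
    intro c e hc he
    refine tendsto_nhds_unique (hψ _ (mul_pos hc he)) ?_
    have h1 := ((hψ c hc).comp (tendsto_id.const_mul_atTop he)).mul (hψ e he)
    refine h1.congr fun t => ?_
    have := (hpos t).ne'
    have := (hpos (e * t)).ne'
    simp only [Function.comp, id]
    rw [mul_assoc]
    field_simp
  have hanti : ∀ c e : ℝ, 0 < c → c ≤ e → ψ e ≤ ψ c := by
    intro c e hc hce
    refine le_of_tendsto_of_tendsto (hψ e (hc.trans_le hce)) (hψ c hc) ?_
    filter_upwards [eventually_ge_atTop 0] with t ht
    exact div_le_div_of_nonneg_right (hT (by gcongr)) (hpos t).le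
  have hone : ψ 1 = 1 := by
    have := hmul 1 1 one_pos one_pos
    have h1 := hψ0 1 one_pos
    rw [one_mul] at this
    nlinarith
  -- Cauchy's functional equation: `log ∘ ψ ∘ exp` is additive, and antitone, hence measurable,
  -- hence continuous and linear.
  let L : ℝ →+ ℝ :=
    { toFun := fun s => Real.log (ψ (Real.exp s))
      map_zero' := by simp [hone]
      map_add' := fun s t => by
        rw [Real.exp_add, hmul _ _ (Real.exp_pos s) (Real.exp_pos t),
          Real.log_mul (hψ0 _ (Real.exp_pos s)).ne' (hψ0 _ (Real.exp_pos t)).ne'] }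
  have hL : Antitone L := fun s t hst =>
    Real.log_le_log (hψ0 _ (Real.exp_pos t))
      (hanti _ _ (Real.exp_pos s) (Real.exp_le_exp.2 hst))
  have hcont : Continuous L := Measure.AddMonoidHom.continuous_of_measurable L hL.measurable
  have hlin : ∀ s, L s = s * L 1 := fun s => by
    have := map_real_smul L hcont s 1
    simpa using this
  refine ⟨-L 1, ?_, fun c hc => ?_⟩
  · have := hL (zero_le_one' ℝ)
    rw [map_zero] at this
    linarith
  · convert hψ c hc using 2
    rw [Real.rpow_def_of_pos hc, neg_neg, ← hlin]
    change Real.exp (Real.log (ψ (Real.exp (Real.log c)))) = ψ c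
    rw [Real.exp_log hc, Real.exp_log (hψ0 c hc)]

/-- A set of positive reals closed under products and inverses that contains all but countably
many points of an interval to the right of `1` is everything. -/
lemma pos_mem_of_countable_compl {S : Set ℝ} (hmul : ∀ x ∈ S, ∀ y ∈ S, x * y ∈ S)
    (hinv : ∀ x ∈ S, x⁻¹ ∈ S) {r : ℝ} (hr : 1 < r) (hS : (Set.Ioo 1 r \ S).Countable)
    {c : ℝ} (hc : 0 < c) : c ∈ S := by
  have h1 : ∀ c, 1 < c → c < r → c ∈ S := by
    intro c h1c hcr
    -- Some `s` in the uncountable interval `Ioo 1 c` is such that neither `s` nor `c / s` is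
    -- exceptional; then `c = s * (c / s)`.
    have hcount : ((Set.Ioo 1 r \ S) ∪ (fun x => c / x) '' (Set.Ioo 1 r \ S)).Countable :=
      hS.union (hS.image _)
    have hne : ¬ (Set.Ioo 1 c) ⊆ ((Set.Ioo 1 r \ S) ∪ (fun x => c / x) '' (Set.Ioo 1 r \ S)) := by
      intro hsub
      have := hcount.mono hsub
      rw [← Cardinal.le_aleph0_iff_set_countable, Cardinal.mk_Ioo_real h1c] at this
      exact absurd Cardinal.aleph0_lt_continuum (not_lt.2 this)
    obtain ⟨s, hs, hs2⟩ := Set.not_subset.1 hne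
    have hs0 : 0 < s := by linarith [hs.1]
    rw [Set.mem_union, not_or] at hs2
    have hsS : s ∈ S := by
      by_contra hcon
      exact hs2.1 ⟨⟨hs.1, hs.2.trans hcr⟩, hcon⟩
    have hcs : c / s ∈ S := by
      by_contra hcon
      refine hs2.2 ⟨c / s, ⟨⟨(one_lt_div hs0).2 hs.2, ?_⟩, hcon⟩, by field_simp⟩
      exact (div_lt_self (by linarith) hs.1).trans hcr
    have := hmul _ hsS _ hcs
    rwa [mul_div_cancel₀ _ hs0.ne'] at this
  have hone : (1 : ℝ) ∈ S := by
    obtain ⟨s, hs1, hs2⟩ := exists_between hr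
    have := hmul _ (h1 s hs1 hs2) _ (hinv _ (h1 s hs1 hs2))
    rwa [mul_inv_cancel₀ (by positivity)] at this
  have hpow : ∀ x ∈ S, ∀ n : ℕ, x ^ n ∈ S := fun x hx n => by
    induction n with
    | zero => simpa using hone
    | succ n ih => rw [pow_succ]; exact hmul _ ih _ hx
  have h2 : ∀ c, 1 ≤ c → c ∈ S := by
    intro c hc1
    rcases hc1.eq_or_lt with rfl | hc1
    · exact hone
    obtain ⟨n, hn⟩ := pow_unbounded_of_one_lt c hr
    have hn0 : n ≠ 0 := by rintro rfl; simp at hn; linarith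
    have hroot : (c ^ ((n : ℝ)⁻¹)) ^ n = c :=
      Real.rpow_inv_natCast_pow (by linarith) hn0
    rw [← hroot]
    refine hpow _ (h1 _ (Real.one_lt_rpow hc1 (by positivity)) ?_) n
    by_contra! hcon
    have := pow_le_pow_left₀ (by linarith) hcon n
    rw [hroot] at this
    linarith
  rcases le_total 1 c with h | h
  · exact h2 c h
  · simpa using hinv _ (h2 c⁻¹ ((one_le_inv₀ hc).2 h))

section Feller

variable {T : ℝ → ℝ} {a : ℕ → ℝ} {g : ℝ → ℝ} {D : Set ℝ} {x₀ x₁ : ℝ}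

lemma tendsto_zero_of_mul_nat {u : ℕ → ℝ} {b : ℝ}
    (h : Tendsto (fun n : ℕ => (n : ℝ) * u n) atTop (𝓝 b)) : Tendsto u atTop (𝓝 0) := by
  have h1 := h.mul (tendsto_inv_atTop_nhds_zero_nat (𝕜 := ℝ))
  rw [mul_zero] at h1
  refine h1.congr' ?_
  filter_upwards [eventually_ne_atTop 0] with n hn
  have : (n : ℝ) ≠ 0 := by exact_mod_cast hn
  field_simp

/-- Since `a n` is not yet known to be unbounded, positivity spreads by a fixed factor. If `T t >
0`, then `T (a n * x₀) → 0` forces `t ≤ a n * x₀` for large `n`, and `T (a n * x₁) > 0` gives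
positivity at `x₁ / x₀ * t`. -/
lemma pos_of_tendsto_mul (hT : Antitone T) (hT0 : ∀ t, 0 ≤ T t) (ha : ∀ n, 0 < a n)
    (hx₀ : 0 < x₀) (hx : x₀ < x₁)
    (h0 : Tendsto (fun n : ℕ => (n : ℝ) * T (a n * x₀)) atTop (𝓝 (g x₀)))
    (h1 : Tendsto (fun n : ℕ => (n : ℝ) * T (a n * x₁)) atTop (𝓝 (g x₁)))
    (hg : 0 < g x₁) (t : ℝ) : 0 < T t := by
  have hev : ∀ᶠ n in atTop, 0 < T (a n * x₁) := by
    filter_upwards [h1.eventually_const_lt hg] with n hn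
    refine (hT0 _).lt_of_ne fun h => ?_
    rw [← h, mul_zero] at hn
    exact lt_irrefl _ hn
  have hstep : ∀ t, 0 < t → 0 < T t → 0 < T (x₁ / x₀ * t) := by
    intro t ht0 ht
    obtain ⟨n, hn1, hn2⟩ :=
      (((tendsto_zero_of_mul_nat h0).eventually_lt_const ht).and hev).exists
    refine hn2.trans_le (hT ?_)
    have : t ≤ a n * x₀ := by
      by_contra! hcon
      linarith [hT hcon.le]
    have hx1 : 0 < x₁ := hx₀.trans hx
    calc x₁ / x₀ * t ≤ x₁ / x₀ * (a n * x₀) := by gcongr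
      _ = a n * x₁ := by field_simp
  obtain ⟨n, hn⟩ := hev.exists
  have hs0 : 0 < a n * x₁ := mul_pos (ha n) (hx₀.trans hx)
  have hr : 1 < x₁ / x₀ := (one_lt_div hx₀).2 hx
  have hr0 : 0 < x₁ / x₀ := by linarith
  have hj : ∀ j : ℕ, 0 < T ((x₁ / x₀) ^ j * (a n * x₁)) := by
    intro j
    induction j with
    | zero => simpa using hn
    | succ j ih =>
      have := hstep _ (by positivity) ih
      rwa [← mul_assoc, ← pow_succ'] at this
  obtain ⟨j, hjt⟩ := pow_unbounded_of_one_lt (t / (a n * x₁)) hr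
  exact (hj j).trans_le (hT ((div_lt_iff₀ hs0).1 hjt).le)

lemma tendsto_scale_atTop (hT : Antitone T) (hpos : ∀ t, 0 < T t) (hx₀ : 0 < x₀)
    (h0 : Tendsto (fun n : ℕ => (n : ℝ) * T (a n * x₀)) atTop (𝓝 (g x₀))) :
    Tendsto a atTop atTop := by
  refine tendsto_atTop.2 fun b => ?_
  filter_upwards [(tendsto_zero_of_mul_nat h0).eventually_lt_const (hpos (b * x₀))] with n hn
  by_contra! hcon
  have := hT (mul_le_mul_of_nonneg_right hcon.le hx₀.le)
  linarith

/-- No monotonicity of `a` is needed: `N t` is the predecessor of the first index `n` with `t < a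
n`, and minimality gives the lower bound. -/
lemma exists_bracketing (ha : Tendsto a atTop atTop) :
    ∃ N : ℝ → ℕ, Tendsto N atTop atTop ∧ ∀ᶠ t in atTop, a (N t) ≤ t ∧ t < a (N t + 1) := by
  classical
  have hex : ∀ t : ℝ, ∃ n, t < a n := fun t => (ha.eventually_gt_atTop t).exists
  have hmin : ∀ t n, n < Nat.find (hex t) → a n ≤ t := fun t n hn =>
    not_lt.1 (Nat.find_min (hex t) hn)
  have hlim : Tendsto (fun t => Nat.find (hex t)) atTop atTop := by
    refine tendsto_atTop.2 fun m => ?_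
    have : ∀ᶠ t : ℝ in atTop, ∀ n ∈ Finset.range m, a n ≤ t :=
      (Finset.eventually_all _).2 fun n _ => eventually_ge_atTop _
    filter_upwards [this] with t ht
    by_contra! hcon
    exact absurd (Nat.find_spec (hex t)) (not_lt.2 (ht _ (Finset.mem_range.2 hcon)))
  refine ⟨fun t => Nat.find (hex t) - 1, (tendsto_sub_atTop_nat 1).comp hlim, ?_⟩
  filter_upwards [hlim.eventually_ge_atTop 1] with t ht
  refine ⟨hmin t _ (by omega), ?_⟩
  rw [Nat.sub_add_cancel ht]
  exact Nat.find_spec (hex t)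

/-- With `a N * x₀ ≤ t < a (N + 1) * x₀`, the quotient lies between `T (a (N + 1) * x) / T (a N *
x₀)` and `T (a N * x) / T (a (N + 1) * x₀)`. Both bounds have the stated limit because `N / (N + 1)
→ 1`. -/
lemma tendsto_ratio_of_tendsto_mul (hT : Antitone T) (hpos : ∀ t, 0 < T t) (hx₀ : 0 < x₀)
    {x : ℝ} (hx : x₀ ≤ x)
    (h0 : Tendsto (fun n : ℕ => (n : ℝ) * T (a n * x₀)) atTop (𝓝 (g x₀)))
    (h1 : Tendsto (fun n : ℕ => (n : ℝ) * T (a n * x)) atTop (𝓝 (g x)))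
    (hg : 0 < g x₀) : Tendsto (fun t => T (x / x₀ * t) / T t) atTop (𝓝 (g x / g x₀)) := by
  have hainf := tendsto_scale_atTop hT hpos hx₀ h0
  obtain ⟨N, hN, hb⟩ := exists_bracketing (hainf.atTop_mul_const hx₀)
  have hx0 : 0 < x := hx₀.trans_le hx
  have hN1 : Tendsto (fun t => N t + 1) atTop atTop := (tendsto_add_atTop_nat 1).comp hN
  have hq : Tendsto (fun t => ((N t + 1 : ℕ) : ℝ) / (N t : ℝ)) atTop (𝓝 1) := by
    have := (tendsto_natCast_div_add_atTop (𝕜 := ℝ) 1).inv₀ one_ne_zero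
    rw [inv_one] at this
    refine (this.comp hN).congr fun t => ?_
    simp
  have hq' : Tendsto (fun t => (N t : ℝ) / ((N t + 1 : ℕ) : ℝ)) atTop (𝓝 1) := by
    have := hq.inv₀ one_ne_zero
    rw [inv_one] at this
    refine this.congr fun t => by rw [inv_div]
  have hup := ((h1.comp hN).div (h0.comp hN1) hg.ne').mul hq
  have hlo := ((h1.comp hN1).div (h0.comp hN) hg.ne').mul hq'
  rw [mul_one] at hup hlo
  refine tendsto_of_tendsto_of_tendsto_of_le_of_le' hlo hup ?_ ?_
  · filter_upwards [hb, hN.eventually_ge_atTop 1] with t ht hNt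
    have hNp : (0 : ℝ) < N t := by exact_mod_cast hNt
    have e1 := hpos (a (N t) * x₀)
    calc _ = T (a (N t + 1) * x) / T (a (N t) * x₀) := by
          simp only [Function.comp, Pi.div_apply]; push_cast; field_simp
      _ ≤ T (x / x₀ * t) / T t := by
          gcongr
          · exact (hpos _).le
          · exact hpos _
          · apply hT
            calc x / x₀ * t ≤ x / x₀ * (a (N t + 1) * x₀) := by gcongr; exact ht.2.le
              _ = _ := by field_simp
          · exact hT ht.1
  · filter_upwards [hb, hN.eventually_ge_atTop 1] with t ht hNt
    have hNp : (0 : ℝ) < N t := by exact_mod_cast hNt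
    have e1 := hpos (a (N t + 1) * x₀)
    calc T (x / x₀ * t) / T t ≤ T (a (N t) * x) / T (a (N t + 1) * x₀) := by
          gcongr
          · exact (hpos _).le
          · apply hT
            calc a (N t) * x = x / x₀ * (a (N t) * x₀) := by field_simp
              _ ≤ _ := by gcongr; exact ht.1
          · exact hT ht.2.le
      _ = _ := by
          simp only [Function.comp, Pi.div_apply]; push_cast; field_simp

/-- Convergence of the rescaled tails on a set with countable complement forces regular
variation. -/
lemma exists_isRVTail_of_tendsto_mul (hT : Antitone T) (hT0 : ∀ t, 0 ≤ T t) (ha : ∀ n, 0 < a n)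
    (hx₀ : 0 < x₀) (hx : x₀ < x₁) (hx₀D : x₀ ∈ D) (hx₁D : x₁ ∈ D) (hD : (Set.Ici x₀ \ D).Countable)
    (hlim : ∀ x ∈ D, x₀ ≤ x → Tendsto (fun n : ℕ => (n : ℝ) * T (a n * x)) atTop (𝓝 (g x)))
    (hg₁ : 0 < g x₁) (hsmall : ∀ ε > 0, ∃ x ∈ D, x₀ ≤ x ∧ g x < ε) :
    ∃ α, IsRVTail T α ∧ Tendsto a atTop atTop ∧
      ∃ C, 0 < C ∧ ∀ x, 0 < x →
        Tendsto (fun n : ℕ => (n : ℝ) * T (a n * x)) atTop (𝓝 (C * x ^ (-α))) := by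
  have h0 := hlim x₀ hx₀D le_rfl
  have h1 := hlim x₁ hx₁D hx.le
  have hpos := pos_of_tendsto_mul hT hT0 ha hx₀ hx h0 h1 hg₁
  have hainf := tendsto_scale_atTop hT hpos hx₀ h0
  have hganti : ∀ x ∈ D, ∀ y ∈ D, x₀ ≤ x → x ≤ y → g y ≤ g x := by
    intro x hxD y hyD hx hxy
    refine le_of_tendsto_of_tendsto' (hlim y hyD (hx.trans hxy)) (hlim x hxD hx) fun n => ?_
    have := ha n
    exact mul_le_mul_of_nonneg_left (hT (by gcongr)) (by positivity)
  have hg₀ : 0 < g x₀ := hg₁.trans_le (hganti x₀ hx₀D x₁ hx₁D le_rfl hx.le)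
  have hrat : ∀ x ∈ D, x₀ ≤ x →
      Tendsto (fun t => T (x / x₀ * t) / T t) atTop (𝓝 (g x / g x₀)) := fun x hxD hx =>
    tendsto_ratio_of_tendsto_mul hT hpos hx₀ hx h0 (hlim x hxD hx) hg₀
  obtain ⟨α, hα0, hα⟩ := exists_rpow_of_tendsto_ratio hT hpos (fun c hc => by
    -- The ratios with a positive limit form a multiplicative group. It contains `x / x₀` for `x ∈
    -- D` between `x₀` and `x₁`, so it is all of `(0, ∞)`.
    let S : Set ℝ := {c | 0 < c ∧ ∃ p : ℝ, 0 < p ∧ Tendsto (fun t => T (c * t) / T t) atTop (𝓝 p)}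
    have hcS : c ∈ S := by
      refine pos_mem_of_countable_compl (S := S) ?_ ?_ ((one_lt_div hx₀).2 hx) ?_ hc
      · rintro c ⟨hc, p, hp, hcp⟩ e ⟨he, r, hr, her⟩
        refine ⟨mul_pos hc he, p * r, mul_pos hp hr, ?_⟩
        have h1 := (hcp.comp (tendsto_id.const_mul_atTop he)).mul her
        refine h1.congr fun t => ?_
        have := (hpos t).ne'
        have := (hpos (e * t)).ne'
        simp only [Function.comp, id]
        rw [mul_assoc]
        field_simp
      · rintro c ⟨hc, p, hp, hcp⟩
        refine ⟨inv_pos.2 hc, p⁻¹, inv_pos.2 hp, ?_⟩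
        have h1 := (hcp.comp (tendsto_id.const_mul_atTop (inv_pos.2 hc))).inv₀ hp.ne'
        refine h1.congr fun t => ?_
        simp only [Function.comp, id, inv_div]
        rw [mul_inv_cancel_left₀ hc.ne']
      · refine (hD.image (fun x => x / x₀)).mono ?_
        rintro s ⟨⟨hs1, hs2⟩, hsS⟩
        have hle : x₀ ≤ s * x₀ := le_mul_of_one_le_left hx₀.le hs1.le
        refine ⟨s * x₀, ⟨hle, fun hsD => hsS ⟨by linarith, g (s * x₀) / g x₀, ?_, ?_⟩⟩,
          by field_simp⟩
        · refine div_pos (hg₁.trans_le (hganti _ hsD _ hx₁D hle ?_)) hg₀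
          exact ((lt_div_iff₀ hx₀).1 hs2).le
        · have := hrat _ hsD hle
          rwa [mul_div_cancel_right₀ _ hx₀.ne'] at this
    exact hcS.2)
  -- With `α = 0` every ratio would tend to `1`, making `g` constant on `D` beyond `x₀`, against
  -- `hsmall`.
  have hαpos : 0 < α := by
    refine hα0.lt_of_ne fun h => ?_
    obtain ⟨x, hxD, hxx, hgx⟩ := hsmall (g x₀) hg₀
    have := tendsto_nhds_unique (hrat x hxD hxx) (hα _ (div_pos (hx₀.trans_le hxx) hx₀))
    rw [← h, neg_zero, Real.rpow_zero, div_eq_one_iff_eq hg₀.ne'] at this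
    linarith
  have hRV : IsRVTail T α := ⟨hT, hT0, hαpos, hα⟩
  refine ⟨α, hRV, hainf, g x₀ * x₀ ^ α, by positivity, fun x hx => ?_⟩
  have h2 := h0.mul ((hα (x / x₀) (by positivity)).comp (hainf.atTop_mul_const hx₀))
  have e : g x₀ * (x / x₀) ^ (-α) = g x₀ * x₀ ^ α * x ^ (-α) := by
    rw [Real.div_rpow hx.le hx₀.le, Real.rpow_neg hx₀.le]
    field_simp
  rw [e] at h2
  refine h2.congr fun n => ?_
  have := (hpos (a n * x₀)).ne'
  simp only [Function.comp]
  rw [show x / x₀ * (a n * x₀) = a n * x by field_simp]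
  field_simp

end Feller

end TailRisk

/-! ### Marginal tails of a heavy-tailed vector -/

namespace TailRisk

/-- The tail function of a random variable. -/
noncomputable def tail {Ω : Type*} [MeasurableSpace Ω] (P : Measure Ω) (Y : Ω → ℝ) (t : ℝ) : ℝ :=
  P.real {ω | t < Y ω}

lemma tail_nonneg {Ω : Type*} [MeasurableSpace Ω] {P : Measure Ω} {Y : Ω → ℝ} (t : ℝ) :
    0 ≤ tail P Y t := measureReal_nonneg

section Tail

variable {Ω : Type*} [MeasurableSpace Ω] {P : Measure Ω} [IsProbabilityMeasure P] {Y : Ω → ℝ}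

lemma tail_anti : Antitone (tail P Y) := fun _ _ hst =>
  measureReal_mono fun _ hω => lt_of_le_of_lt hst hω

lemma tail_tendsto_zero (hY : AEMeasurable Y P) : Tendsto (tail P Y) atTop (𝓝 0) := by
  have h1 : Tendsto (fun x => P {ω | x < Y ω}) atTop (𝓝 (P (⋂ n : ℝ, {ω | n < Y ω}))) :=
    tendsto_measure_iInter_atTop
      (fun i => nullMeasurableSet_lt aemeasurable_const hY)
      (fun s t hst ω hω => lt_of_le_of_lt hst hω) ⟨0, measure_ne_top _ _⟩
  have h2 : (⋂ n : ℝ, {ω | n < Y ω}) = ∅ := by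
    ext ω
    simp only [Set.mem_iInter, Set.mem_ofPred_eq, Set.mem_empty_iff_false, iff_false, not_forall]
    exact ⟨Y ω, lt_irrefl _⟩
  rw [h2, measure_empty] at h1
  have := (ENNReal.tendsto_toReal ENNReal.zero_ne_top).comp h1
  exact this

end Tail

/-- Approximate limits at every precision make the image filter Cauchy. Several limits below are
only shown to exist, so that no limit measure has to be constructed. -/
lemma exists_tendsto_of_approx {ι : Type*} {l : Filter ι} {φ : ι → ℝ}
    (h : ∀ η > 0, ∃ L, ∀ᶠ i in l, |φ i - L| ≤ η) : ∃ L, Tendsto φ l (𝓝 L) := by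
  rcases l.eq_or_neBot with rfl | hl
  · exact ⟨0, tendsto_bot⟩
  refine cauchy_map_iff_exists_tendsto.1 (Metric.cauchy_iff.2 ⟨hl.map φ, fun ε hε => ?_⟩)
  obtain ⟨L, hL⟩ := h (ε / 3) (by positivity)
  refine ⟨_, image_mem_map hL, ?_⟩
  rintro _ ⟨i, hi, rfl⟩ _ ⟨j, hj, rfl⟩
  rw [Real.dist_eq]
  have h1 : |φ i - L| ≤ ε / 3 := hi
  have h2 : |φ j - L| ≤ ε / 3 := hj
  rw [abs_le] at h1 h2
  rw [abs_lt]
  constructor <;> linarith [h1.1, h1.2, h2.1, h2.2]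

/-- Taking logarithms, `n log (p n) → log γ`, so `p n → 1`; and `1 - p n` lies between `-p n log (p
n)` and `-log (p n)`. -/
lemma tendsto_mul_one_sub_of_pow {p : ℕ → ℝ} {γ : ℝ} (hp0 : ∀ n, 0 ≤ p n)
    (hγ : 0 < γ) (h : Tendsto (fun n => p n ^ n) atTop (𝓝 γ)) :
    Tendsto (fun n : ℕ => (n : ℝ) * (1 - p n)) atTop (𝓝 (-Real.log γ)) := by
  have hpos : ∀ᶠ n in atTop, 0 < p n := by
    filter_upwards [h.eventually_const_lt hγ, eventually_ne_atTop 0] with n hn hn0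
    refine (hp0 n).lt_of_ne fun h0 => ?_
    rw [← h0, zero_pow hn0] at hn
    exact lt_irrefl _ hn
  have hlog : Tendsto (fun n : ℕ => (n : ℝ) * Real.log (p n)) atTop (𝓝 (Real.log γ)) := by
    have := h.log hγ.ne'
    simpa [Real.log_pow] using this
  have hp : Tendsto p atTop (𝓝 1) := by
    have h1 := (Real.continuous_exp.tendsto 0).comp (tendsto_zero_of_mul_nat hlog)
    rw [Real.exp_zero] at h1
    refine h1.congr' ?_
    filter_upwards [hpos] with n hn
    simp [Real.exp_log hn]
  have hlo := (hp.mul hlog).neg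
  rw [one_mul] at hlo
  refine tendsto_of_tendsto_of_tendsto_of_le_of_le' hlo hlog.neg ?_ ?_
  · filter_upwards [hpos] with n hn
    have := Real.one_sub_inv_le_log_of_pos hn
    have h2 : -(p n * Real.log (p n)) ≤ 1 - p n := by
      have := mul_le_mul_of_nonneg_left this hn.le
      rw [mul_sub, mul_inv_cancel₀ hn.ne'] at this
      linarith
    have := mul_le_mul_of_nonneg_left h2 (Nat.cast_nonneg (α := ℝ) n)
    linarith
  · filter_upwards [hpos] with n hn
    have := Real.log_le_sub_one_of_pos hn
    have := mul_le_mul_of_nonneg_left this (Nat.cast_nonneg (α := ℝ) n)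
    linarith

/-- A distribution function with values `0` and `1` only jumps at the infimum of the points where it
is `1`, and right continuity makes it that of a Dirac mass. -/
lemma exists_measure_Iic_mem_Ioo (μ : Measure ℝ) [IsProbabilityMeasure μ]
    (hμ : ∀ x, μ ≠ Measure.dirac x) : ∃ x, 0 < cdf μ x ∧ cdf μ x < 1 := by
  by_contra! hcon
  have h01 : ∀ x, cdf μ x ≤ 0 ∨ 1 ≤ cdf μ x := fun x => by
    rcases le_or_gt (cdf μ x) 0 with h | h
    · exact Or.inl h
    · exact Or.inr (hcon x h)
  let S : Set ℝ := {x | 1 ≤ cdf μ x}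
  have hne : S.Nonempty := by
    obtain ⟨x, hx⟩ := ((tendsto_cdf_atTop μ).eventually_const_lt zero_lt_one).exists
    exact ⟨x, (h01 x).resolve_left (not_le.2 hx)⟩
  have hbdd : BddBelow S := by
    obtain ⟨x, hx⟩ := ((tendsto_cdf_atBot μ).eventually_lt_const zero_lt_one).exists
    refine ⟨x, fun y hy => ?_⟩
    by_contra! hlt
    have := monotone_cdf μ hlt.le
    have hy' : 1 ≤ cdf μ y := hy
    linarith
  have hgt : ∀ x, sInf S < x → 1 ≤ cdf μ x := fun x hx => by
    obtain ⟨y, hy, hyx⟩ := exists_lt_of_csInf_lt hne hx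
    exact le_trans hy (monotone_cdf μ hyx.le)
  have hc : 1 ≤ cdf μ (sInf S) := by
    have h1 : ContinuousWithinAt (cdf μ) (Set.Ioi (sInf S)) (sInf S) :=
      ((cdf μ).right_continuous (sInf S)).mono Set.Ioi_subset_Ici_self
    refine ge_of_tendsto h1 ?_
    filter_upwards [self_mem_nhdsWithin] with x hx using hgt x hx
  refine hμ (sInf S) (Measure.eq_of_cdf _ _ ?_)
  ext x
  rw [cdf_eq_real (Measure.dirac (sInf S)), measureReal_def, Measure.dirac_apply' _ measurableSet_Iic]
  rcases le_or_gt (sInf S) x with hx | hx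
  · have h1 : 1 ≤ cdf μ x := hc.trans (monotone_cdf μ hx)
    rw [Set.indicator_of_mem (by exact hx)]
    simpa using le_antisymm (cdf_le_one μ x) h1
  · rw [Set.indicator_of_notMem (by simpa using hx)]
    rcases h01 x with h | h
    · simpa using le_antisymm h (cdf_nonneg μ x)
    · exact absurd (csInf_le hbdd h) (not_le.2 hx)

section Heavy

variable {d : ℕ} {Ω : Type*} [MeasurableSpace Ω] {P : Measure Ω} [IsProbabilityMeasure P]
  {X : Ω → EuclideanSpace ℝ (Fin d)} {a : ℕ → Fin d → ℝ} {ahat : Fin d → ℝ}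

/-- The maxima lie in a box exactly when every copy does, a product event whose probability is an
`n`-th power. The box is a continuity set because its frontier lies in hyperplanes that `G` does not
charge. -/
lemma tendsto_pow_of_tendstoInDistribution (ha : ∀ n k, 0 < a n k) {G : Measure (Fin d → ℝ)}
    [IsProbabilityMeasure G]
    (h : TendstoInDistribution (fun n ω => fun k => componentMax X n ω k / a n k) atTop
      (fun z => z) (fun n => Measure.pi (fun _ : Fin n => P)) G)
    (K : Finset (Fin d)) (x : Fin d → ℝ) (hx : ∀ k ∈ K, G {z | z k = x k} = 0) :
    Tendsto (fun n => P.real {ω | ∀ k ∈ K, X ω k ≤ a n k * x k} ^ n) atTop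
      (𝓝 (G.real {z | ∀ k ∈ K, z k ≤ x k})) := by
  set B : Set (Fin d → ℝ) := {z | ∀ k ∈ K, z k ≤ x k} with hB
  have hBpi : B = (K : Set (Fin d)).pi fun k => Set.Iic (x k) := by
    ext z; simp [hB, Set.pi]
  have hBm : MeasurableSet B := by
    rw [hBpi]
    exact MeasurableSet.pi K.countable_toSet fun k _ => measurableSet_Iic
  have hfr : frontier B ⊆ ⋃ k ∈ K, {z | z k = x k} := by
    intro z hz
    rw [frontier, hBpi, closure_pi_set, interior_pi_set K.finite_toSet] at hz
    simp only [closure_Iic, interior_Iic] at hz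
    obtain ⟨h1, h2⟩ := hz
    simp only [Set.mem_pi, not_forall] at h2
    obtain ⟨k, hk, hlt⟩ := h2
    exact Set.mem_biUnion (x := k) hk (le_antisymm (h1 k hk) (not_lt.1 hlt))
  have hfr0 : G (frontier B) = 0 :=
    measure_mono_null hfr ((measure_biUnion_null_iff K.countable_toSet).2 hx)
  have h1 := ProbabilityMeasure.tendsto_measure_of_null_frontier_of_tendsto' h.tendsto
    (E := B) (by simpa using hfr0)
  simp only [ProbabilityMeasure.coe_mk, Measure.map_id'] at h1
  have h2 := (ENNReal.tendsto_toReal (measure_ne_top G B)).comp h1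
  simp only [Function.comp_def] at h2
  refine h2.congr' ?_
  -- For `n = 0` the supremum over `Fin 0` is a default value and the description of the event by
  -- the copies fails.
  filter_upwards [eventually_ge_atTop 1] with n hn
  have : Nonempty (Fin n) := ⟨⟨0, hn⟩⟩
  rw [Measure.map_apply_of_aemeasurable (h.forall_aemeasurable n) hBm]
  have hset : (fun ω => fun k => componentMax X n ω k / a n k) ⁻¹' B =
      Set.univ.pi fun _ : Fin n => {ω | ∀ k ∈ K, X ω k ≤ a n k * x k} := by
    ext ω
    simp only [hB, Set.mem_preimage, Set.mem_ofPred_eq, Set.mem_pi, Set.mem_univ, true_imp_iff,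
      componentMax]
    have : ∀ k, (⨆ i, X (ω i) k) / a n k ≤ x k ↔ ∀ i, X (ω i) k ≤ a n k * x k := fun k => by
      rw [div_le_iff₀ (ha n k), ciSup_le_iff (Set.finite_range _).bddAbove, mul_comm]
    simp only [this]
    exact ⟨fun h i k hk => h k hk i, fun h k hk i => h i k hk⟩
  rw [hset, Measure.pi_pi]
  simp [measureReal_def]

lemma tail_eq_one_sub {Y : Ω → ℝ} (hY : Measurable Y) (t : ℝ) :
    tail P Y t = 1 - P.real {ω | Y ω ≤ t} := by
  rw [tail, ← probReal_compl_eq_one_sub (measurableSet_le hY measurable_const)]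
  congr 1; ext ω; simp

/-- Every marginal of a heavy-tailed vector is regularly varying. -/
lemma exists_marginal_isRVTail (hX : Measurable X) (hXnonneg : ∀ᵐ ω ∂P, ∀ k, 0 ≤ X ω k)
    (ha : ∀ n k, 0 < a n k) {G : Measure (Fin d → ℝ)}
    [IsProbabilityMeasure G] (hG : ∀ k x, G.map (fun z => z k) ≠ Measure.dirac x)
    (h : TendstoInDistribution (fun n ω => fun k => componentMax X n ω k / a n k) atTop
      (fun z => z) (fun n => Measure.pi (fun _ : Fin n => P)) G) (k : Fin d) :
    ∃ α, IsRVTail (tail P fun ω => X ω k) α ∧ Tendsto (fun n => a n k) atTop atTop ∧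
      ∃ C, 0 < C ∧ ∀ x, 0 < x →
        Tendsto (fun n : ℕ => (n : ℝ) * tail P (fun ω => X ω k) (a n k * x)) atTop
          (𝓝 (C * x ^ (-α))) := by
  have hXk : Measurable fun ω => X ω k := by fun_prop
  have : IsProbabilityMeasure (G.map fun z => z k) :=
    Measure.isProbabilityMeasure_map (measurable_pi_apply k).aemeasurable
  set μ := G.map fun z => z k with hμ
  have hcdf : ∀ x, cdf μ x = G.real {z | z k ≤ x} := fun x => by
    rw [cdf_eq_real, hμ, measureReal_def, Measure.map_apply (measurable_pi_apply k) measurableSet_Iic]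
    rfl
  set D : Set ℝ := {x | G {z | z k = x} = 0} with hD
  have hDc : Dᶜ.Countable := by
    have := Measure.countable_meas_level_set_pos (μ := G) (g := fun z : Fin d → ℝ => z k)
      (measurable_pi_apply k)
    refine this.mono fun x hx => ?_
    exact pos_iff_ne_zero.2 hx
  have hdense : ∀ u v : ℝ, u < v → ∃ x ∈ D, u < x ∧ x < v := fun u v huv => by
    obtain ⟨x, hx, hx2⟩ := (hDc.dense_compl ℝ).exists_between huv
    exact ⟨x, by simpa using hx, hx2.1, hx2.2⟩
  have hlimD : ∀ x ∈ D, Tendsto (fun n => P.real {ω | X ω k ≤ a n k * x} ^ n) atTop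
      (𝓝 (cdf μ x)) := fun x hx => by
    have := tendsto_pow_of_tendstoInDistribution ha h {k} (fun _ => x)
      (fun j hj => by rw [Finset.mem_singleton.1 hj]; exact hx)
    simpa [hcdf] using this
  -- Nonnegativity of `X` passes to the limit law, so the point `x` found below is at least `0` and
  -- `x₀ > x` is positive.
  have hneg : ∀ x < 0, cdf μ x = 0 := fun x hx => by
    obtain ⟨y, hyD, hxy, hy0⟩ := hdense x 0 hx
    refine le_antisymm ((monotone_cdf μ hxy.le).trans_eq ?_) (cdf_nonneg μ x)
    refine tendsto_nhds_unique (hlimD y hyD) (tendsto_const_nhds.congr' ?_)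
    filter_upwards [eventually_ge_atTop 1] with n hn
    have : P.real {ω | X ω k ≤ a n k * y} = 0 := by
      rw [measureReal_eq_zero_iff]
      refine measure_mono_null (fun ω (hω : X ω k ≤ a n k * y) => ?_) (ae_iff.1 hXnonneg)
      intro hcon
      linarith [hcon k, mul_neg_of_pos_of_neg (ha n k) hy0]
    rw [this, zero_pow (by omega)]
  obtain ⟨x, hx0, hx1⟩ := exists_measure_Iic_mem_Ioo μ (hG k)
  have hxnn : 0 ≤ x := by
    by_contra! hcon
    rw [hneg x hcon] at hx0
    exact lt_irrefl _ hx0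
  -- Right continuity leaves room to the right of `x` for two uncharged points with distribution
  -- function strictly between `0` and `1`.
  have hrc : ∀ᶠ y in 𝓝[≥] x, cdf μ y < 1 := ((cdf μ).right_continuous x).eventually_lt_const hx1
  obtain ⟨x', hxx', hsub⟩ := mem_nhdsGE_iff_exists_Ico_subset.1 hrc
  obtain ⟨x₀, hx₀D, hxx₀, hx₀x'⟩ := hdense x x' hxx'
  obtain ⟨x₁, hx₁D, hx₀₁, hx₁x'⟩ := hdense x₀ x' hx₀x'
  have hcpos : ∀ y, x₀ ≤ y → 0 < cdf μ y := fun y hy =>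
    hx0.trans_le (monotone_cdf μ (hxx₀.le.trans hy))
  refine exists_isRVTail_of_tendsto_mul (T := tail P fun ω => X ω k) (a := fun n => a n k)
    (g := fun y => -Real.log (cdf μ y)) (D := D) tail_anti tail_nonneg (fun n => ha n k)
    (hxnn.trans_lt hxx₀) hx₀₁ hx₀D hx₁D (hDc.mono fun y hy => hy.2) ?_ ?_ ?_
  · intro y hyD hy
    have := tendsto_mul_one_sub_of_pow (fun n => measureReal_nonneg)
      (hcpos y hy) (hlimD y hyD)
    refine this.congr fun n => ?_
    rw [tail_eq_one_sub hXk]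
  · have h1 : cdf μ x₁ < 1 := hsub ⟨(hxx₀.trans hx₀₁).le, hx₁x'⟩
    have := Real.log_neg (hcpos x₁ hx₀₁.le) h1
    linarith
  · intro ε hε
    have h1 : Tendsto (fun y => -Real.log (cdf μ y)) atTop (𝓝 0) := by
      have := ((tendsto_cdf_atTop μ).log one_ne_zero).neg
      simpa using this
    obtain ⟨y, hy⟩ := eventually_atTop.1 (h1.eventually_lt_const hε)
    obtain ⟨z, hzD, hz1, _⟩ := hdense (max y x₀) (max y x₀ + 1) (by linarith)
    exact ⟨z, hzD, (le_max_right _ _).trans hz1.le, hy z ((le_max_left _ _).trans hz1.le)⟩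

end Heavy

end TailRisk

/-! ### Multivariate regular variation on complements of boxes -/

namespace TailRisk

section Compare

variable {Ω : Type*} [MeasurableSpace Ω] {P : Measure Ω} [IsProbabilityMeasure P]

lemma measureReal_diff_tail_le {Y : Ω → ℝ} (hY : Measurable Y) (s u : ℝ) :
    P.real ({ω | s < Y ω} \ {ω | u < Y ω}) ≤ |tail P Y s - tail P Y u| := by
  rcases le_total s u with h | h
  · have hsub : {ω | u < Y ω} ⊆ {ω | s < Y ω} := fun ω hω => lt_of_le_of_lt h hω
    rw [measureReal_sdiff hsub (measurableSet_lt measurable_const hY)]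
    exact le_abs_self _
  · have hsub : {ω | s < Y ω} ⊆ {ω | u < Y ω} := fun ω hω => lt_of_le_of_lt h hω
    rw [Set.sdiff_eq_empty.2 hsub, measureReal_empty]
    exact abs_nonneg _

lemma measureReal_biUnion_le {ι : Type*} [DecidableEq ι] (A B : ι → Set Ω) {K K' : Finset ι} :
    P.real (⋃ k ∈ K, A k) ≤ P.real (⋃ k ∈ K', B k) + (∑ k ∈ K', P.real (A k \ B k)
      + ∑ k ∈ K \ K', P.real (A k)) := by
  have hsub : (⋃ k ∈ K, A k) ⊆ (⋃ k ∈ K', B k) ∪ ((⋃ k ∈ K', A k \ B k) ∪ ⋃ k ∈ K \ K', A k) := by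
    intro ω hω
    simp only [Set.mem_iUnion, exists_prop] at hω
    obtain ⟨k, hk, hkA⟩ := hω
    by_cases hk' : k ∈ K'
    · by_cases hB : ω ∈ B k
      · exact Or.inl (Set.mem_biUnion (x := k) hk' hB)
      · exact Or.inr (Or.inl (Set.mem_biUnion (x := k) hk' ⟨hkA, hB⟩))
    · exact Or.inr (Or.inr (Set.mem_biUnion (x := k) (Finset.mem_sdiff.2 ⟨hk, hk'⟩) hkA))
  refine (measureReal_mono hsub).trans ((measureReal_union_le _ _).trans ?_)
  gcongr
  refine (measureReal_union_le _ _).trans ?_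
  gcongr
  · exact measureReal_biUnion_finset_le _ _
  · exact measureReal_biUnion_finset_le _ _

/-- For one coordinate the two exceedance events are nested, so they differ by the difference of the
tails; a dropped coordinate costs its own tail. This allows a change of thresholds and the removal
of coordinates of smaller order. -/
lemma abs_measureReal_exists_sub_le {ι : Type*} [DecidableEq ι] {Y : ι → Ω → ℝ}
    (hY : ∀ k, Measurable (Y k)) {K K' : Finset ι} (hK : K' ⊆ K) (s u : ι → ℝ) :
    |P.real {ω | ∃ k ∈ K, s k < Y k ω} - P.real {ω | ∃ k ∈ K', u k < Y k ω}| ≤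
      ∑ k ∈ K', |tail P (Y k) (s k) - tail P (Y k) (u k)| + ∑ k ∈ K \ K', tail P (Y k) (s k) := by
  have e : ∀ (L : Finset ι) (v : ι → ℝ), {ω | ∃ k ∈ L, v k < Y k ω} = ⋃ k ∈ L, {ω | v k < Y k ω} := by
    intro L v; ext ω; simp
  rw [e, e, abs_le]
  have h1 := measureReal_biUnion_le (P := P) (fun k => {ω | s k < Y k ω})
    (fun k => {ω | u k < Y k ω}) (K := K) (K' := K')
  have h3 : ∑ k ∈ K', P.real ({ω | s k < Y k ω} \ {ω | u k < Y k ω}) ≤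
      ∑ k ∈ K', |tail P (Y k) (s k) - tail P (Y k) (u k)| :=
    Finset.sum_le_sum fun k _ => measureReal_diff_tail_le (hY k) _ _
  have h5 := measureReal_biUnion_le (P := P) (fun k => {ω | u k < Y k ω})
    (fun k => {ω | s k < Y k ω}) (K := K') (K' := K')
  have h6 : ∑ k ∈ K', P.real ({ω | u k < Y k ω} \ {ω | s k < Y k ω}) ≤
      ∑ k ∈ K', |tail P (Y k) (s k) - tail P (Y k) (u k)| :=
    Finset.sum_le_sum fun k _ => by
      rw [abs_sub_comm]; exact measureReal_diff_tail_le (hY k) _ _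
  have h7 : P.real (⋃ k ∈ K', {ω | s k < Y k ω}) ≤ P.real (⋃ k ∈ K, {ω | s k < Y k ω}) :=
    measureReal_mono (Set.biUnion_subset_biUnion_left hK) (measure_ne_top _ _)
  have h8 : 0 ≤ ∑ k ∈ K \ K', tail P (Y k) (s k) := Finset.sum_nonneg fun k _ => tail_nonneg _
  rw [Finset.sdiff_self, Finset.sum_empty, add_zero] at h5
  have h9 : ∑ k ∈ K \ K', P.real {ω | s k < Y k ω} = ∑ k ∈ K \ K', tail P (Y k) (s k) := rfl
  constructor <;> linarith

end Compare

/-- Passage from the sequence of normalising constants to a continuous parameter. -/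
lemma IsRVTail.exists_time_change {H : ℝ → ℝ} {α C : ℝ} (h : IsRVTail H α)
    (h0 : Tendsto H atTop (𝓝 0)) {b : ℕ → ℝ} (hb : Tendsto b atTop atTop) (hC : 0 < C)
    (hlim : Tendsto (fun n : ℕ => (n : ℝ) * H (b n)) atTop (𝓝 C)) :
    ∃ N : ℝ → ℕ, Tendsto N atTop atTop ∧ Tendsto (fun t => (N t : ℝ) * H t) atTop (𝓝 1) ∧
      ∃ τ, 0 < τ ∧ Tendsto (fun t => t / b (N t)) atTop (𝓝 τ) := by
  have hinv : Tendsto (fun t => (H t)⁻¹) atTop atTop :=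
    (tendsto_nhdsWithin_iff.2 ⟨h0, Eventually.of_forall h.pos⟩).inv_tendsto_nhdsGT_zero
  have hN : Tendsto (fun t => ⌊(H t)⁻¹⌋₊) atTop atTop := tendsto_nat_floor_atTop.comp hinv
  have hNH : Tendsto (fun t => (⌊(H t)⁻¹⌋₊ : ℝ) * H t) atTop (𝓝 1) :=
    (tendsto_nat_floor_div_atTop.comp hinv).congr fun t => by simp
  -- Here `N t ~ 1 / H t`, while `H (b (N t)) ~ C / N t`. Thus `H t / H (b (N t)) → C⁻¹`, and
  -- inversion gives the ratio of the arguments.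
  refine ⟨fun t => ⌊(H t)⁻¹⌋₊, hN, hNH, C⁻¹ ^ (-α⁻¹), by positivity, ?_⟩
  refine h.tendsto_arg_div (hb.comp hN) (inv_pos.2 hC) ?_
  have := hNH.div (hlim.comp hN) hC.ne'
  rw [one_div] at this
  refine this.congr' ?_
  filter_upwards [hN.eventually_ge_atTop 1] with t ht
  have h1 : (0 : ℝ) < (⌊(H t)⁻¹⌋₊ : ℝ) := by exact_mod_cast ht
  simp only [Pi.div_apply, Function.comp]
  rw [mul_div_mul_left _ _ h1.ne']

section Heavy

variable {d : ℕ} {Ω : Type*} [MeasurableSpace Ω] {P : Measure Ω} [IsProbabilityMeasure P]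
  {X : Ω → EuclideanSpace ℝ (Fin d)} {a : ℕ → Fin d → ℝ} {ahat : Fin d → ℝ}

/-- The normalised vectors have sup norm `1`, so their limit is not zero. -/
lemma exists_ahat_pos (ha : ∀ n k, 0 < a n k) (hd : 0 < d)
    (h : Tendsto (fun n => ‖a n‖⁻¹ • a n) atTop (𝓝 ahat)) :
    (∀ k, 0 ≤ ahat k) ∧ ∃ k, 0 < ahat k := by
  have hk : ∀ k, Tendsto (fun n => ‖a n‖⁻¹ * a n k) atTop (𝓝 (ahat k)) := fun k =>
    (tendsto_pi_nhds.1 h) k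
  have h0 : ∀ k, 0 ≤ ahat k := fun k =>
    ge_of_tendsto' (hk k) fun n => mul_nonneg (by positivity) (ha n k).le
  refine ⟨h0, ?_⟩
  by_contra! hcon
  have hz : ahat = 0 := funext fun k => le_antisymm (hcon k) (h0 k)
  have h1 : Tendsto (fun n => ‖‖a n‖⁻¹ • a n‖) atTop (𝓝 ‖ahat‖) := h.norm
  have h2 : ∀ n, ‖‖a n‖⁻¹ • a n‖ = 1 := fun n => by
    have hne : a n ≠ 0 := fun hc => (ha n ⟨0, hd⟩).ne' (by rw [hc]; rfl)
    rw [norm_smul, norm_inv, norm_norm, inv_mul_cancel₀ (norm_ne_zero_iff.2 hne)]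
  simp only [h2, hz, norm_zero] at h1
  exact one_ne_zero (tendsto_nhds_unique tendsto_const_nhds h1)

lemma scale_ratio (ha : ∀ n k, 0 < a n k)
    (h : Tendsto (fun n => ‖a n‖⁻¹ • a n) atTop (𝓝 ahat)) {k₀ : Fin d} (hk₀ : 0 < ahat k₀)
    (k : Fin d) : (0 < ahat k → Tendsto (fun n => a n k₀ / a n k) atTop (𝓝 (ahat k₀ / ahat k))) ∧
      (ahat k = 0 → Tendsto (fun n => a n k₀ / a n k) atTop atTop) := by
  have hk : ∀ k, Tendsto (fun n => ‖a n‖⁻¹ * a n k) atTop (𝓝 (ahat k)) := fun k =>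
    (tendsto_pi_nhds.1 h) k
  have hnorm : ∀ n, 0 < ‖a n‖ := fun n => norm_pos_iff.2 fun hc => (ha n k).ne' (by rw [hc]; rfl)
  have e : ∀ n, (‖a n‖⁻¹ * a n k₀) / (‖a n‖⁻¹ * a n k) = a n k₀ / a n k := fun n =>
    mul_div_mul_left _ _ (inv_pos.2 (hnorm n)).ne'
  refine ⟨fun hpos => ?_, fun hz => ?_⟩
  · exact ((hk k₀).div (hk k) hpos.ne').congr e
  · have h1 : Tendsto (fun n => ‖a n‖⁻¹ * a n k) atTop (𝓝[>] 0) :=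
      tendsto_nhdsWithin_iff.2 ⟨hz ▸ hk k, Eventually.of_forall fun n =>
        mul_pos (inv_pos.2 (hnorm n)) (ha n k)⟩
    exact ((hk k₀).pos_mul_atTop hk₀ h1.inv_tendsto_nhdsGT_zero).congr e

lemma measureReal_exists_eq_one_sub (hX : Measurable X) (K : Finset (Fin d)) (u : Fin d → ℝ) :
    P.real {ω | ∃ k ∈ K, u k < X ω k} = 1 - P.real {ω | ∀ k ∈ K, X ω k ≤ u k} := by
  have hm : MeasurableSet {ω | ∀ k ∈ K, X ω k ≤ u k} := by
    have : {ω | ∀ k ∈ K, X ω k ≤ u k} = ⋂ k ∈ K, {ω | X ω k ≤ u k} := by ext ω; simp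
    rw [this]
    exact Finset.measurableSet_biInter _ fun k _ => measurableSet_le (by fun_prop) (by fun_prop)
  rw [← probReal_compl_eq_one_sub hm]
  congr 1; ext ω; simp

/-- Convergence of the rescaled probabilities of complements of boxes. -/
lemma tendsto_mul_exists (hX : Measurable X) (ha : ∀ n k, 0 < a n k) {G : Measure (Fin d → ℝ)}
    [IsProbabilityMeasure G]
    (h : TendstoInDistribution (fun n ω => fun k => componentMax X n ω k / a n k) atTop
      (fun z => z) (fun n => Measure.pi (fun _ : Fin n => P)) G)
    (K : Finset (Fin d)) (x : Fin d → ℝ) (hx : ∀ k ∈ K, G {z | z k = x k} = 0) {g : Fin d → ℝ}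
    (hg : ∀ k ∈ K, Tendsto (fun n : ℕ => (n : ℝ) * tail P (fun ω => X ω k) (a n k * x k)) atTop
      (𝓝 (g k))) :
    ∃ L, Tendsto (fun n : ℕ => (n : ℝ) * P.real {ω | ∃ k ∈ K, a n k * x k < X ω k}) atTop
      (𝓝 L) := by
  have h1 := tendsto_pow_of_tendstoInDistribution ha h K x hx
  have hsum : Tendsto (fun n : ℕ => (n : ℝ) * -∑ k ∈ K, tail P (fun ω => X ω k) (a n k * x k))
      atTop (𝓝 (-∑ k ∈ K, g k)) := by
    refine (tendsto_finsetSum K hg).neg.congr fun n => ?_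
    rw [mul_neg, Finset.mul_sum]
  have hexp := Real.tendsto_one_add_pow_exp_of_tendsto hsum
  -- Logarithms need a positive limit. By the union bound the probability of the box is at least one
  -- minus the sum of the tails, and the `n`-th power of that lower bound tends to `exp (-∑ g k)`.
  have hγ : 0 < G.real {z | ∀ k ∈ K, z k ≤ x k} := by
    refine (Real.exp_pos _).trans_le (le_of_tendsto_of_tendsto hexp h1 ?_)
    filter_upwards [(tendsto_zero_of_mul_nat hsum).eventually_const_lt (show (-1 : ℝ) < 0 by simp)]
      with n hn
    refine pow_le_pow_left₀ (by linarith) ?_ n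
    have h2 := measureReal_exists_eq_one_sub (P := P) hX K (fun k => a n k * x k)
    have h3 : P.real {ω | ∃ k ∈ K, a n k * x k < X ω k} ≤
        ∑ k ∈ K, tail P (fun ω => X ω k) (a n k * x k) := by
      have e : {ω | ∃ k ∈ K, a n k * x k < X ω k} = ⋃ k ∈ K, {ω | a n k * x k < X ω k} := by
        ext ω; simp
      rw [e]
      exact measureReal_biUnion_finset_le _ _
    linarith
  refine ⟨_, (tendsto_mul_one_sub_of_pow (fun n => measureReal_nonneg) hγ h1).congr fun n => ?_⟩
  rw [measureReal_exists_eq_one_sub hX K (fun k => a n k * x k)]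

/-- Multivariate regular variation, expressed through complements of boxes. -/
lemma HeavyTailed.exists_regular_variation (hheavy : HeavyTailed P X a ahat) (hd : 0 < d)
    (hX : Measurable X) (hXnonneg : ∀ᵐ ω ∂P, ∀ k, 0 ≤ X ω k) :
    ∃ α : Fin d → ℝ, (∀ k, IsRVTail (tail P fun ω => X ω k) (α k)) ∧ ∃ k₀ : Fin d,
      (∀ k, ∃ c, (0 < ahat k → 0 < c) ∧ Tendsto (fun t => tail P (fun ω => X ω k) t /
        tail P (fun ω => X ω k₀) t) atTop (𝓝 c)) ∧
      ∀ (K : Finset (Fin d)) (x : Fin d → ℝ), (∀ k ∈ K, 0 < x k) → ∃ v,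
        Tendsto (fun t => P.real {ω | ∃ k ∈ K, t * x k < X ω k} / tail P (fun ω => X ω k₀) t)
          atTop (𝓝 v) := by
  classical
  have ha := hheavy.pos
  obtain ⟨G, hGp, hGdeg, hdist⟩ := hheavy.tendsto_max
  choose α hRV hainf C hC hlim using
    fun k => exists_marginal_isRVTail hX hXnonneg ha hGdeg hdist k
  obtain ⟨hah0, k₀, hk₀⟩ := exists_ahat_pos ha hd hheavy.tendsto_ratio
  have hXk : ∀ k, Measurable fun ω => X ω k := fun k => by fun_prop
  obtain ⟨N, hN, hNH, τ, hτ, hNτ⟩ := (hRV k₀).exists_time_change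
    (tail_tendsto_zero (hXk k₀).aemeasurable) (hainf k₀) (C := C k₀) (hC k₀) (by
      have := hlim k₀ 1 one_pos
      simpa using this)
  have hNa : ∀ k, Tendsto (fun t => (N t : ℝ) * tail P (fun ω => X ω k) (a (N t) k)) atTop
      (𝓝 (C k)) := fun k => by
    have := (hlim k 1 one_pos).comp hN
    simpa [Function.comp_def] using this
  have hsplit : ∀ k t, t / a (N t) k = t / a (N t) k₀ * (a (N t) k₀ / a (N t) k) := fun k t => by
    rw [div_mul_div_cancel₀ (ha _ _).ne']
  set τk : Fin d → ℝ := fun k => τ * (ahat k₀ / ahat k) with hτk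
  have hposlim : ∀ k, 0 < ahat k → ∀ x, 0 < x →
      Tendsto (fun t => (N t : ℝ) * tail P (fun ω => X ω k) (t * x)) atTop
        (𝓝 (C k * (τk k * x) ^ (-α k))) := fun k hk x hx => by
    have h1 : Tendsto (fun t => t * x / a (N t) k) atTop (𝓝 (τk k * x)) := by
      refine ((hNτ.mul (((scale_ratio ha hheavy.tendsto_ratio hk₀ k).1 hk).comp hN)).mul_const
        x).congr fun t => ?_
      simp only [Function.comp]
      rw [← hsplit]; ring
    have h2 := (hRV k).tendsto_div ((hainf k).comp hN) (by positivity) h1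
    refine ((hNa k).mul h2).congr fun t => ?_
    have := ((hRV k).pos (a (N t) k)).ne'
    simp only [Function.comp]
    field_simp
  -- These coordinates have norming constants of smaller order than `a n k₀`, so on the scale `t`
  -- their tails are negligible.
  have hzerolim : ∀ k, ahat k = 0 → ∀ x, 0 < x →
      Tendsto (fun t => (N t : ℝ) * tail P (fun ω => X ω k) (t * x)) atTop (𝓝 0) :=
      fun k hk x hx => by
    have h1 : Tendsto (fun t => t * x / a (N t) k) atTop atTop := by
      refine ((hNτ.pos_mul_atTop hτ (((scale_ratio ha hheavy.tendsto_ratio hk₀ k).2 hk).comp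
        hN)).atTop_mul_const hx).congr fun t => ?_
      simp only [Function.comp]
      rw [← hsplit]; ring
    have h2 := (hRV k).tendsto_div_zero ((hainf k).comp hN) h1
    have h3 := (hNa k).mul h2
    rw [mul_zero] at h3
    refine h3.congr fun t => ?_
    have := ((hRV k).pos (a (N t) k)).ne'
    simp only [Function.comp]
    field_simp
  have hdivide : ∀ {φ : ℝ → ℝ} {L : ℝ}, Tendsto (fun t => (N t : ℝ) * φ t) atTop (𝓝 L) →
      Tendsto (fun t => φ t / tail P (fun ω => X ω k₀) t) atTop (𝓝 L) := fun {φ L} h => by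
    have h1 := h.div hNH one_ne_zero
    rw [div_one] at h1
    refine h1.congr' ?_
    filter_upwards [hN.eventually_ge_atTop 1] with t ht
    have h2 : (0 : ℝ) < N t := by exact_mod_cast ht
    simp only [Pi.div_apply]
    rw [mul_div_mul_left _ _ h2.ne']
  refine ⟨α, hRV, k₀, fun k => ?_, fun K x hx => ?_⟩
  · rcases (hah0 k).eq_or_lt with hk | hk
    · refine ⟨0, fun h => absurd h (by rw [← hk]; exact lt_irrefl _), hdivide ?_⟩
      simpa using hzerolim k hk.symm 1 one_pos
    · refine ⟨C k * (τk k * 1) ^ (-α k), fun _ => mul_pos (hC k) (by positivity), hdivide ?_⟩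
      simpa using hposlim k hk 1 one_pos
  · suffices h : ∃ L, Tendsto (fun t => (N t : ℝ) * P.real {ω | ∃ k ∈ K, t * x k < X ω k}) atTop
        (𝓝 L) by
      obtain ⟨L, hL⟩ := h
      exact ⟨L, hdivide hL⟩
    refine exists_tendsto_of_approx fun η hη => ?_
    set K' := K.filter fun k => 0 < ahat k with hK'
    have hmemK' : ∀ k, k ∈ K' → k ∈ K ∧ 0 < ahat k := fun k hk => Finset.mem_filter.1 hk
    set δ := η / 4 / (d + 1) with hδ
    have hδ0 : 0 < δ := by positivity
    -- The natural threshold `τk k * x k` may be charged by `G`. An uncharged `y` nearby changes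
    -- each term by less than `δ`, and there are at most `d` terms.
    have hex : ∀ k, ∃ y, k ∈ K' → 0 < y ∧ G {z | z k = y} = 0 ∧
        |C k * (τk k * x k) ^ (-α k) - C k * y ^ (-α k)| < δ := by
      intro k
      by_cases hk : k ∈ K'
      swap
      · exact ⟨0, fun h => absurd h hk⟩
      have hy0 : 0 < τk k * x k := by
        have := (hmemK' k hk).2
        have := hx k (hmemK' k hk).1
        positivity
      have hc : ContinuousAt (fun y : ℝ => |C k * (τk k * x k) ^ (-α k) - C k * y ^ (-α k)|)
          (τk k * x k) := by
        have := Real.continuousAt_rpow_const (τk k * x k) (-α k) (Or.inl hy0.ne')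
        fun_prop
      have hev : ∀ᶠ y in 𝓝 (τk k * x k), 0 < y ∧
          |C k * (τk k * x k) ^ (-α k) - C k * y ^ (-α k)| < δ :=
        (lt_mem_nhds hy0).and (hc.eventually_lt_const (by simpa using hδ0))
      have hcount := Measure.countable_meas_level_set_pos (μ := G)
        (g := fun z : Fin d → ℝ => z k) (measurable_pi_apply k)
      obtain ⟨U, hUsub, hU, hmem⟩ := mem_nhds_iff.1 hev
      obtain ⟨y, hyU, hyD⟩ := (hcount.dense_compl ℝ).inter_open_nonempty U hU ⟨_, hmem⟩
      refine ⟨y, fun _ => ⟨(hUsub hyU).1, ?_, (hUsub hyU).2⟩⟩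
      by_contra hne
      exact hyD (pos_iff_ne_zero.2 hne)
    choose y hy using hex
    obtain ⟨L, hL⟩ := tendsto_mul_exists hX ha hdist K' y (fun k hk => (hy k hk).2.1)
      (g := fun k => C k * y k ^ (-α k)) (fun k hk => hlim k _ (hy k hk).1)
    have hbound : Tendsto (fun t => ∑ k ∈ K', |(N t : ℝ) * tail P (fun ω => X ω k) (t * x k) -
          N t * tail P (fun ω => X ω k) (a (N t) k * y k)| +
        ∑ k ∈ K \ K', (N t : ℝ) * tail P (fun ω => X ω k) (t * x k)) atTop
        (𝓝 (∑ k ∈ K', |C k * (τk k * x k) ^ (-α k) - C k * y k ^ (-α k)| +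
          ∑ k ∈ K \ K', (0 : ℝ))) := by
      refine (tendsto_finsetSum _ fun k hk => ?_).add (tendsto_finsetSum _ fun k hk => ?_)
      · exact ((hposlim k (hmemK' k hk).2 _ (hx k (hmemK' k hk).1)).sub
          ((hlim k _ (hy k hk).1).comp hN)).abs
      · have hk1 := Finset.mem_sdiff.1 hk
        refine hzerolim k (le_antisymm (not_lt.1 fun h => hk1.2 ?_) (hah0 k)) _ (hx k hk1.1)
        exact Finset.mem_filter.2 ⟨hk1.1, h⟩
    have hlt : ∑ k ∈ K', |C k * (τk k * x k) ^ (-α k) - C k * y k ^ (-α k)| +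
          ∑ k ∈ K \ K', (0 : ℝ) < η / 2 := by
      rw [Finset.sum_const_zero, add_zero]
      have h1 : ∑ k ∈ K', |C k * (τk k * x k) ^ (-α k) - C k * y k ^ (-α k)| ≤ K'.card • δ :=
        Finset.sum_le_card_nsmul _ _ _ fun k hk => (hy k hk).2.2.le
      have h2 : (K'.card : ℝ) ≤ d := by
        have := Finset.card_le_univ K'
        rw [Fintype.card_fin] at this
        exact_mod_cast this
      rw [nsmul_eq_mul] at h1
      have h3 : (K'.card : ℝ) * δ ≤ d * δ := by gcongr
      have h4 : (d + 1 : ℝ) * δ = η / 4 := by rw [hδ]; field_simp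
      linarith
    refine ⟨L, ?_⟩
    filter_upwards [hbound.eventually_lt_const hlt,
      (hL.comp hN).eventually (Metric.closedBall_mem_nhds L (half_pos hη))] with t h1 h2
    simp only [Function.comp, Real.dist_eq] at h2
    have h3 := mul_le_mul_of_nonneg_left (abs_measureReal_exists_sub_le (P := P) hXk
      (Finset.filter_subset _ K : K' ⊆ K) (fun k => t * x k) (fun k => a (N t) k * y k))
      (Nat.cast_nonneg (α := ℝ) (N t))
    rw [mul_add, Finset.mul_sum, Finset.mul_sum] at h3
    have h4 : ∀ u v : ℝ, (N t : ℝ) * |u - v| = |N t * u - N t * v| := fun u v => by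
      rw [← mul_sub, abs_mul, abs_of_nonneg (Nat.cast_nonneg (α := ℝ) (N t))]
    simp only [h4] at h3
    calc _ ≤ _ := abs_sub_le _ ((N t : ℝ) * P.real {ω | ∃ k ∈ K', a (N t) k * y k < X ω k}) L
      _ ≤ η := by linarith

end Heavy

end TailRisk

/-! ### Rescaled expectations of continuous functions vanishing near the origin -/

namespace TailRisk

section Rescaled

variable {d : ℕ} {Ω : Type*} [MeasurableSpace Ω]

/-- The bounded measurable functions `f` for which `E f(X / t) / H t` converges as `t → ∞`. -/
structure RescaledLimit (P : Measure Ω) (X : Ω → EuclideanSpace ℝ (Fin d)) (H : ℝ → ℝ)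
    (f : (Fin d → ℝ) → ℝ) : Prop where
  measurable : Measurable f
  bounded : ∃ M, ∀ z, |f z| ≤ M
  exists_tendsto : ∃ L, Tendsto (fun t => (∫ ω, f (fun k => X ω k / t) ∂P) / H t) atTop (𝓝 L)

namespace RescaledLimit

variable {P : Measure Ω} {X : Ω → EuclideanSpace ℝ (Fin d)} {H : ℝ → ℝ} {f g : (Fin d → ℝ) → ℝ}

lemma zero : RescaledLimit P X H fun _ => 0 :=
  ⟨measurable_const, ⟨0, by simp⟩, 0, by simp⟩

lemma const_mul (hf : RescaledLimit P X H f) (c : ℝ) : RescaledLimit P X H fun z => c * f z := by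
  obtain ⟨M, hM⟩ := hf.bounded
  obtain ⟨L, hL⟩ := hf.exists_tendsto
  refine ⟨hf.measurable.const_mul c, ⟨|c| * M, fun z => ?_⟩, c * L, ?_⟩
  · rw [abs_mul]; exact mul_le_mul_of_nonneg_left (hM z) (abs_nonneg c)
  · refine (hL.const_mul c).congr fun t => ?_
    rw [integral_const_mul, mul_div_assoc]

variable [IsProbabilityMeasure P]

lemma integrable (hX : Measurable X) (hf : RescaledLimit P X H f) (t : ℝ) :
    Integrable (fun ω => f (fun k => X ω k / t)) P := by
  obtain ⟨M, hM⟩ := hf.bounded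
  refine Integrable.of_bound (hf.measurable.comp ?_).aestronglyMeasurable M
    (Eventually.of_forall fun ω => hM _)
  exact measurable_pi_lambda _ fun k => by fun_prop

lemma add (hX : Measurable X) (hf : RescaledLimit P X H f) (hg : RescaledLimit P X H g) :
    RescaledLimit P X H fun z => f z + g z := by
  obtain ⟨M, hM⟩ := hf.bounded
  obtain ⟨M', hM'⟩ := hg.bounded
  obtain ⟨L, hL⟩ := hf.exists_tendsto
  obtain ⟨L', hL'⟩ := hg.exists_tendsto
  refine ⟨hf.measurable.add hg.measurable,
    ⟨M + M', fun z => (abs_add_le _ _).trans (add_le_add (hM z) (hM' z))⟩, L + L', ?_⟩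
  refine (hL.add hL').congr fun t => ?_
  rw [integral_add (hf.integrable hX t) (hg.integrable hX t), add_div]

lemma sum (hX : Measurable X) {ι : Type*} (s : Finset ι) {F : ι → (Fin d → ℝ) → ℝ}
    (hF : ∀ i ∈ s, RescaledLimit P X H (F i)) :
    RescaledLimit P X H fun z => ∑ i ∈ s, F i z := by
  classical
  induction s using Finset.induction_on with
  | empty => simpa using zero
  | insert i s hi ih =>
    simp only [Finset.sum_insert hi]
    exact add hX (hF i (Finset.mem_insert_self i s))
      (ih fun j hj => hF j (Finset.mem_insert_of_mem hj))

end RescaledLimit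

/-- Points with some coordinate above `ε`. -/
def awayFromZero (d : ℕ) (ε : ℝ) : Set (Fin d → ℝ) := {z | ∃ k, ε < z k}

lemma measurableSet_awayFromZero (ε : ℝ) : MeasurableSet (awayFromZero d ε) := by
  have : awayFromZero d ε = ⋃ k, {z | ε < z k} := by ext z; simp [awayFromZero]
  rw [this]
  exact MeasurableSet.iUnion fun k => measurableSet_lt measurable_const (measurable_pi_apply k)

/-- The constant `1` and the indicators of half-lines `(-∞, x]`, `x > 0`. -/
def halfLineIndicators : Set (ℝ → ℝ) :=
  {g | g = (fun _ => 1) ∨ ∃ x, 0 < x ∧ g = fun u => if u ≤ x then 1 else 0}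

variable {P : Measure Ω} [IsProbabilityMeasure P] {X : Ω → EuclideanSpace ℝ (Fin d)} {H : ℝ → ℝ}

lemma measurableSet_exists_lt (hX : Measurable X) (K : Finset (Fin d)) (u : Fin d → ℝ) :
    MeasurableSet {ω | ∃ k ∈ K, u k < X ω k} := by
  have : {ω | ∃ k ∈ K, u k < X ω k} = ⋃ k ∈ K, {ω | u k < X ω k} := by ext ω; simp
  rw [this]
  exact Finset.measurableSet_biUnion _ fun k _ => measurableSet_lt (by fun_prop) (by fun_prop)

/-- The product is the indicator of `z` having some coordinate above `ε` and every coordinate in `K`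
at most `x k`. That event is a difference of two nested complements of boxes. -/
lemma rescaledLimit_box (hX : Measurable X)
    (hbox : ∀ (K : Finset (Fin d)) (x : Fin d → ℝ), (∀ k ∈ K, 0 < x k) → ∃ v,
      Tendsto (fun t => P.real {ω | ∃ k ∈ K, t * x k < X ω k} / H t) atTop (𝓝 v))
    {ε : ℝ} (hε : 0 < ε) (g : Fin d → ℝ → ℝ) (hg : ∀ k, g k ∈ halfLineIndicators) :
    RescaledLimit P X H fun z => (awayFromZero d ε).indicator 1 z * ∏ k, g k (z k) := by
  classical
  let K : Finset (Fin d) := Finset.univ.filter fun k => g k ≠ fun _ => 1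
  have hex : ∀ k, ∃ x, 0 < x ∧ (k ∈ K → g k = fun u => if u ≤ x then 1 else 0) := fun k => by
    rcases hg k with h | ⟨x, hx, h⟩
    · exact ⟨1, one_pos, fun hk => absurd h (Finset.mem_filter.1 hk).2⟩
    · exact ⟨x, hx, fun _ => h⟩
  choose x hx hgx using hex
  have hprod : ∀ z : Fin d → ℝ, ∏ k, g k (z k) = if ∀ k ∈ K, z k ≤ x k then 1 else 0 := by
    intro z
    split_ifs with h
    · refine Finset.prod_eq_one fun k _ => ?_
      by_cases hk : k ∈ K
      · rw [hgx k hk]; simp [h k hk]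
      · have : g k = fun _ => 1 := by simpa [K] using hk
        rw [this]
    · push Not at h
      obtain ⟨k, hk, hlt⟩ := h
      refine Finset.prod_eq_zero (Finset.mem_univ k) ?_
      rw [hgx k hk]; simp [hlt]
  have hmeas : Measurable fun z : Fin d → ℝ =>
      (awayFromZero d ε).indicator 1 z * ∏ k, g k (z k) := by
    refine (measurable_one.indicator (measurableSet_awayFromZero ε)).mul
      (Finset.measurable_prod _ fun k _ => ?_)
    rcases hg k with h | ⟨x, hx, h⟩
    · rw [h]; exact measurable_const
    · rw [h]
      exact Measurable.ite (measurableSet_le (measurable_pi_apply k) measurable_const)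
        measurable_const measurable_const
  refine ⟨hmeas, ⟨1, fun z => ?_⟩, ?_⟩
  · rw [hprod, Set.indicator_apply]
    split_ifs <;> simp
  -- Lowering the threshold to `x k` where `x k < ε` makes the events nested and adds only points
  -- with a coordinate above `x k`, which the difference removes.
  set y : Fin d → ℝ := fun k => if k ∈ K then min (x k) ε else ε with hy
  obtain ⟨v, hv⟩ := hbox Finset.univ y fun k _ => by
    simp only [hy]; split_ifs
    · exact lt_min (hx k) hε
    · exact hε
  obtain ⟨v', hv'⟩ := hbox K x fun k _ => hx k
  refine ⟨v - v', (hv.sub hv').congr' ?_⟩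
  filter_upwards [eventually_gt_atTop 0] with t ht
  rw [← sub_div]
  congr 1
  have hsub : {ω | ∃ k ∈ K, t * x k < X ω k} ⊆ {ω | ∃ k ∈ Finset.univ, t * y k < X ω k} := by
    rintro ω ⟨k, hk, hlt⟩
    refine ⟨k, Finset.mem_univ k, lt_of_le_of_lt ?_ hlt⟩
    simp only [hy, if_pos hk]
    exact mul_le_mul_of_nonneg_left (min_le_left _ _) ht.le
  rw [← measureReal_sdiff hsub (measurableSet_exists_lt hX K _), ← integral_indicator_one
    ((measurableSet_exists_lt hX _ _).diff (measurableSet_exists_lt hX K _))]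
  refine integral_congr_ae (Eventually.of_forall fun ω => ?_)
  simp only [hprod, Set.indicator_apply, awayFromZero, Set.mem_sdiff, Set.mem_ofPred_eq,
    Finset.mem_univ, true_and, Pi.one_apply, lt_div_iff₀ ht, div_le_iff₀ ht, not_exists, not_and,
    not_lt]
  have key : ((∃ k, t * y k < X ω k) ∧ ∀ k ∈ K, X ω k ≤ t * x k) ↔
      ((∃ k, ε * t < X ω k) ∧ ∀ k ∈ K, X ω k ≤ x k * t) := by
    have h1 : (∀ k ∈ K, X ω k ≤ t * x k) ↔ ∀ k ∈ K, X ω k ≤ x k * t := by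
      simp only [mul_comm]
    rw [h1]
    refine and_congr_left fun hK => ⟨?_, ?_⟩
    · rintro ⟨k, hk⟩
      refine ⟨k, ?_⟩
      by_cases hkK : k ∈ K
      · simp only [hy, if_pos hkK] at hk
        rcases min_choice (x k) ε with h | h
        · rw [h] at hk
          linarith [hK k hkK]
        · rw [h] at hk
          linarith
      · simp only [hy, if_neg hkK] at hk
        linarith
    · rintro ⟨k, hk⟩
      refine ⟨k, lt_of_le_of_lt ?_ hk⟩
      have : y k ≤ ε := by
        simp only [hy]; split_ifs
        · exact min_le_right _ _
        · exact le_rfl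
      nlinarith
  rw [if_congr key rfl rfl, ite_and]
  split_ifs <;> norm_num

/-- The expression is linear in each factor separately, so the half-line indicators are replaced by
elements of their span one coordinate at a time. -/
lemma rescaledLimit_prod (hX : Measurable X)
    (hbox : ∀ (K : Finset (Fin d)) (x : Fin d → ℝ), (∀ k ∈ K, 0 < x k) → ∃ v,
      Tendsto (fun t => P.real {ω | ∃ k ∈ K, t * x k < X ω k} / H t) atTop (𝓝 v))
    {ε : ℝ} (hε : 0 < ε) (g : Fin d → ℝ → ℝ)
    (hg : ∀ k, g k ∈ Submodule.span ℝ halfLineIndicators) :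
    RescaledLimit P X H fun z => (awayFromZero d ε).indicator 1 z * ∏ k, g k (z k) := by
  classical
  suffices h : ∀ s : Finset (Fin d), ∀ g : Fin d → ℝ → ℝ, (∀ k ∉ s, g k ∈ halfLineIndicators) →
      (∀ k ∈ s, g k ∈ Submodule.span ℝ halfLineIndicators) →
      RescaledLimit P X H fun z => (awayFromZero d ε).indicator 1 z * ∏ k, g k (z k) from
    h Finset.univ g (fun k hk => absurd (Finset.mem_univ k) hk) fun k _ => hg k
  intro s
  induction s using Finset.induction_on with
  | empty => exact fun g hg _ => rescaledLimit_box hX hbox hε g fun k => hg k (by simp)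
  | insert j s hj ih =>
    intro g hg1 hg2
    have hupd : ∀ (u : ℝ → ℝ) (z : Fin d → ℝ), ∏ k, Function.update g j u k (z k) =
        u (z j) * ∏ k ∈ Finset.univ.erase j, g k (z k) := fun u z => by
      rw [← Finset.mul_prod_erase _ _ (Finset.mem_univ j), Function.update_self]
      congr 1
      exact Finset.prod_congr rfl fun k hk => by
        rw [Function.update_of_ne (Finset.ne_of_mem_erase hk)]
    have hclaim : ∀ u ∈ Submodule.span ℝ halfLineIndicators, RescaledLimit P X H fun z =>
        (awayFromZero d ε).indicator 1 z * ∏ k, Function.update g j u k (z k) := by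
      intro u hu
      induction hu using Submodule.span_induction with
      | mem u hu =>
        refine ih _ (fun k hk => ?_) fun k hk => ?_
        · by_cases hkj : k = j
          · subst hkj; rwa [Function.update_self]
          · rw [Function.update_of_ne hkj]
            exact hg1 k (by simp [hkj, hk])
        · have hkj : k ≠ j := fun h => hj (h ▸ hk)
          rw [Function.update_of_ne hkj]
          exact hg2 k (Finset.mem_insert_of_mem hk)
      | zero => simpa [hupd] using RescaledLimit.zero
      | add u v _ _ hu hv =>
        have h2 := hu.add hX hv
        simp only [hupd] at h2 ⊢
        convert h2 using 2 with z
        simp only [Pi.add_apply]; ring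
      | smul c u _ hu =>
        have h2 := hu.const_mul c
        simp only [hupd] at h2 ⊢
        convert h2 using 2 with z
        simp only [Pi.smul_apply, smul_eq_mul]; ring
    have := hclaim (g j) (hg2 j (Finset.mem_insert_self j s))
    rwa [Function.update_eq_self] at this

/-- The index of the grid cell of mesh `δ` that contains `u`. -/
noncomputable def cellIndex (δ u : ℝ) : ℕ := ⌈u / δ⌉₊ - 1

/-- Truncated subtraction puts every `u ≤ δ`, negative ones included, into cell `0`; hence no sign
condition on `u`. -/
lemma cellIndex_le_iff {δ : ℝ} (hδ : 0 < δ) {u : ℝ} {i : ℕ} :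
    cellIndex δ u ≤ i ↔ u ≤ (i + 1) * δ := by
  rw [cellIndex, Nat.sub_le_iff_le_add, Nat.ceil_le, div_le_iff₀ hδ]
  push_cast; rfl

lemma cellIndicator_mem {δ : ℝ} (hδ : 0 < δ) (i : ℕ) :
    (fun u => if cellIndex δ u = i then (1 : ℝ) else 0) ∈ Submodule.span ℝ halfLineIndicators := by
  have hle : ∀ i : ℕ, (fun u => if cellIndex δ u ≤ i then (1 : ℝ) else 0) ∈
      Submodule.span ℝ halfLineIndicators := fun i =>
    Submodule.subset_span (Or.inr ⟨(i + 1) * δ, by positivity, by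
      ext u; simp only [cellIndex_le_iff hδ]⟩)
  cases i with
  | zero => simpa using hle 0
  | succ i =>
    have := Submodule.sub_mem _ (hle (i + 1)) (hle i)
    convert this using 1
    ext u
    simp only [Pi.sub_apply]
    split_ifs <;> first | omega | simp

lemma abs_grid_sub_le {δ : ℝ} (hδ : 0 < δ) {u : ℝ} (hu : 0 ≤ u) :
    u ≤ (cellIndex δ u + 1) * δ ∧ ((cellIndex δ u : ℝ) + 1) * δ ≤ u + δ := by
  refine ⟨(cellIndex_le_iff hδ).1 le_rfl, ?_⟩
  rcases Nat.eq_zero_or_pos (cellIndex δ u) with h | h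
  · rw [h]; simp; exact hu
  · have : ¬ cellIndex δ u ≤ cellIndex δ u - 1 := by omega
    rw [cellIndex_le_iff hδ, Nat.cast_pred h] at this
    linarith

/-- The limit of `E F(X / t) / H t` exists for continuous `F` that vanish near the origin. -/
lemma exists_tendsto_integral_rescaled (hX : Measurable X) (hXnonneg : ∀ᵐ ω ∂P, ∀ k, 0 ≤ X ω k)
    {α : ℝ} (hH : IsRVTail H α)
    (hbox : ∀ (K : Finset (Fin d)) (x : Fin d → ℝ), (∀ k ∈ K, 0 < x k) → ∃ v,
      Tendsto (fun t => P.real {ω | ∃ k ∈ K, t * x k < X ω k} / H t) atTop (𝓝 v))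
    {F : (Fin d → ℝ) → ℝ} (hF : Continuous F) {B ε : ℝ} (hε : 0 < ε)
    (hB : ∀ z, (∀ k, 0 ≤ z k) → |F z| ≤ B)
    (hF0 : ∀ z, (∀ k, 0 ≤ z k) → (∀ k, z k ≤ ε) → F z = 0) :
    ∃ L, Tendsto (fun t => (∫ ω, F (fun k => X ω k / t) ∂P) / H t) atTop (𝓝 L) := by
  classical
  have hB0 : 0 ≤ B := (abs_nonneg _).trans (hB 0 fun _ => le_rfl)
  have hmeasX : ∀ t, Measurable fun ω => (fun k => X ω k / t : Fin d → ℝ) := fun t =>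
    measurable_pi_lambda _ fun k => by fun_prop
  set V : ℝ → ℝ := fun t => P.real {ω | ∃ k ∈ (Finset.univ : Finset (Fin d)), t * 1 < X ω k} with hV
  obtain ⟨v, hv⟩ := hbox Finset.univ (fun _ => 1) fun _ _ => one_pos
  have hVs : ∀ s, 0 < s → Tendsto (fun t => V (s * t) / H t) atTop (𝓝 (v * s ^ (-α))) :=
    fun s hs => hH.tendsto_comp_mul hv hs
  refine exists_tendsto_of_approx fun η hη => ?_
  -- Points with a coordinate above `κ` contribute at most `B * (v * κ ^ (-α))` in the limit.
  -- Likewise an error `η'` on the points with a coordinate above `ε` costs `η' * (v * ε ^ (-α))`.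
  obtain ⟨κ, hκ1, hκ0⟩ : ∃ κ, B * (v * κ ^ (-α)) < η / 4 ∧ 0 < κ := by
    have h1 := ((tendsto_rpow_neg_atTop hH.index_pos).const_mul v).const_mul B
    rw [mul_zero, mul_zero] at h1
    exact ((h1.eventually_lt_const (show 0 < η / 4 by positivity)).and (eventually_gt_atTop 0)).exists
  obtain ⟨η', hη'0, hη'⟩ : ∃ η', 0 < η' ∧ η' * (v * ε ^ (-α)) < η / 4 := by
    have h1 : Tendsto (fun x : ℝ => x * (v * ε ^ (-α))) (𝓝[>] 0) (𝓝 0) := by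
      exact ((continuous_mul_const _).tendsto' 0 0 (zero_mul _)).mono_left nhdsWithin_le_nhds
    obtain ⟨x, hx1, hx2⟩ := ((h1.eventually_lt_const (show 0 < η / 4 by positivity)).and
      (self_mem_nhdsWithin : Set.Ioi (0 : ℝ) ∈ 𝓝[>] 0)).exists
    exact ⟨x, hx2, hx1⟩
  obtain ⟨δ₀, hδ₀, hunif⟩ : ∃ δ₀ > 0, ∀ z ∈ Set.Icc (0 : Fin d → ℝ) (fun _ => κ + 1),
      ∀ w ∈ Set.Icc (0 : Fin d → ℝ) (fun _ => κ + 1), dist z w < δ₀ → dist (F z) (F w) < η' :=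
    Metric.uniformContinuousOn_iff.1 (isCompact_Icc.uniformContinuousOn_of_continuous
      hF.continuousOn) η' hη'0
  -- The mesh `κ / m` is below `δ₀` for uniform continuity, below `1` so that upper cell corners
  -- stay in the cube of side `κ + 1`, and divides `κ` so that cells do not straddle the truncation.
  obtain ⟨m, hm⟩ := exists_nat_gt (max (κ / δ₀) κ)
  have hm0 : (0 : ℝ) < m := (hκ0.trans_le (le_max_right _ _)).trans hm
  set δ := κ / m with hδdef
  have hδ : 0 < δ := by positivity
  have hδ1 : δ < 1 := (div_lt_one hm0).2 ((le_max_right _ _).trans_lt hm)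
  have hδδ₀ : δ < δ₀ := by
    rw [hδdef, div_lt_iff₀ hm0, mul_comm]
    exact (div_lt_iff₀ hδ₀).1 ((le_max_left _ _).trans_lt hm)
  have hmδ : (m : ℝ) * δ = κ := by rw [hδdef]; field_simp
  have hmpos : 0 < m := by exact_mod_cast hm0
  have hidx : ∀ u, cellIndex δ u < m ↔ u ≤ κ := fun u => by
    rw [← hmδ, Nat.lt_iff_le_pred hmpos, cellIndex_le_iff hδ, Nat.cast_pred hmpos,
      sub_add_cancel]
  let J : Finset (Fin d → ℕ) := Fintype.piFinset fun _ => Finset.range m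
  -- The step function samples `F` at the upper corner of each cell and is zero outside the
  -- truncated cube and near the origin.
  let Q : (Fin d → ℝ) → ℝ := fun z => ∑ j ∈ J, F (fun k => ((j k : ℝ) + 1) * δ) *
    ((awayFromZero d ε).indicator 1 z * ∏ k, if cellIndex δ (z k) = j k then (1 : ℝ) else 0)
  have hQ : RescaledLimit P X H Q := RescaledLimit.sum hX J fun j _ =>
    (rescaledLimit_prod hX hbox hε (fun k u => if cellIndex δ u = j k then (1 : ℝ) else 0)
      fun k => cellIndicator_mem hδ (j k)).const_mul _
  have hQin : ∀ z : Fin d → ℝ, (∀ k, z k ≤ κ) → Q z =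
      F (fun k => ((cellIndex δ (z k) : ℝ) + 1) * δ) * (awayFromZero d ε).indicator 1 z := by
    intro z hz
    have hmem : (fun k => cellIndex δ (z k)) ∈ J :=
      Fintype.mem_piFinset.2 fun k => Finset.mem_range.2 ((hidx _).2 (hz k))
    refine (Finset.sum_eq_single_of_mem _ hmem fun j _ hj => ?_).trans (by simp)
    obtain ⟨k, hk⟩ := Function.ne_iff.1 hj
    rw [Finset.prod_eq_zero (Finset.mem_univ k) (if_neg fun h => hk h.symm), mul_zero, mul_zero]
  have hQout : ∀ z : Fin d → ℝ, (∃ k, κ < z k) → Q z = 0 := by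
    rintro z ⟨k, hk⟩
    refine Finset.sum_eq_zero fun j hj => ?_
    have hjk : j k < m := Finset.mem_range.1 (Fintype.mem_piFinset.1 hj k)
    have hne : cellIndex δ (z k) ≠ j k := fun h => by
      rw [← h, hidx] at hjk
      linarith
    rw [Finset.prod_eq_zero (Finset.mem_univ k) (if_neg hne), mul_zero, mul_zero]
  have hpt : ∀ z : Fin d → ℝ, (∀ k, 0 ≤ z k) → |F z - Q z| ≤
      η' * (awayFromZero d ε).indicator 1 z + B * (awayFromZero d κ).indicator 1 z := by
    intro z hz
    by_cases hout : ∃ k, κ < z k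
    · rw [hQout z hout, sub_zero, Set.indicator_of_mem (s := awayFromZero d κ) hout]
      have h1 : 0 ≤ (awayFromZero d ε).indicator (1 : (Fin d → ℝ) → ℝ) z :=
        Set.indicator_nonneg (fun _ _ => zero_le_one) z
      have := hB z hz
      simp only [Pi.one_apply, mul_one]
      nlinarith
    · rw [Set.indicator_of_notMem (s := awayFromZero d κ) hout, mul_zero, add_zero]
      push Not at hout
      rw [hQin z hout]
      by_cases haw : z ∈ awayFromZero d ε
      · rw [Set.indicator_of_mem haw]
        simp only [Pi.one_apply, mul_one]
        have hg := fun k => abs_grid_sub_le hδ (hz k)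
        refine (hunif z ⟨hz, fun k => (hout k).trans (by linarith)⟩
          _ ⟨fun k => by simp only [Pi.zero_apply]; positivity, fun k => ?_⟩ ?_).le
        · have := (hg k).2
          have := hout k
          linarith
        · refine lt_of_le_of_lt ((dist_pi_le_iff hδ.le).2 fun k => ?_) hδδ₀
          rw [Real.dist_eq, abs_le]
          constructor <;> linarith [(hg k).1, (hg k).2]
      · rw [Set.indicator_of_notMem haw]
        have : F z = 0 := hF0 z hz fun k => not_lt.1 fun h => haw ⟨k, h⟩
        rw [this]; simp
  obtain ⟨L, hL⟩ := hQ.exists_tendsto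
  have hind : ∀ s, 0 < s → ∀ t, 0 < t → ∫ ω, (awayFromZero d s).indicator (1 : (Fin d → ℝ) → ℝ)
      (fun k => X ω k / t) ∂P = V (s * t) := by
    intro s hs t ht
    simp only [hV]
    rw [← integral_indicator_one (measurableSet_exists_lt hX _ _)]
    refine integral_congr_ae (Eventually.of_forall fun ω => ?_)
    simp [Set.indicator_apply, awayFromZero, lt_div_iff₀ ht]
  have hindI : ∀ s t, Integrable (fun ω => (awayFromZero d s).indicator (1 : (Fin d → ℝ) → ℝ)
      (fun k => X ω k / t)) P := fun s t => by
    refine Integrable.of_bound (((measurable_one.indicator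
      (measurableSet_awayFromZero s)).comp (hmeasX t)).aestronglyMeasurable) 1
      (Eventually.of_forall fun ω => ?_)
    rw [Set.indicator_apply]; split_ifs <;> simp
  have herr : Tendsto (fun t => η' * (V (ε * t) / H t) + B * (V (κ * t) / H t)) atTop
      (𝓝 (η' * (v * ε ^ (-α)) + B * (v * κ ^ (-α)))) :=
    ((hVs ε hε).const_mul η').add ((hVs κ hκ0).const_mul B)
  refine ⟨L, ?_⟩
  filter_upwards [herr.eventually_lt_const (show _ < η / 2 by linarith),
    hL.eventually (Metric.closedBall_mem_nhds L (half_pos hη)), eventually_gt_atTop 0]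
    with t h1 h2 ht
  have h2' : |(∫ ω, Q (fun k => X ω k / t) ∂P) / H t - L| ≤ η / 2 := h2
  have hFI : Integrable (fun ω => F (fun k => X ω k / t)) P := by
    refine Integrable.of_bound ((hF.measurable.comp (hmeasX t)).aestronglyMeasurable) B ?_
    filter_upwards [hXnonneg] with ω hω
    exact hB _ fun k => div_nonneg (hω k) ht.le
  have h3 : |(∫ ω, F (fun k => X ω k / t) ∂P) - ∫ ω, Q (fun k => X ω k / t) ∂P| ≤
      η' * V (ε * t) + B * V (κ * t) := by
    rw [← integral_sub hFI (hQ.integrable hX t), ← hind ε hε t ht, ← hind κ hκ0 t ht,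
      ← integral_const_mul, ← integral_const_mul,
      ← integral_add ((hindI _ _).const_mul _) ((hindI _ _).const_mul _)]
    have hI : Integrable (fun ω =>
        η' * (awayFromZero d ε).indicator (1 : (Fin d → ℝ) → ℝ) (fun k => X ω k / t) +
        B * (awayFromZero d κ).indicator (1 : (Fin d → ℝ) → ℝ) (fun k => X ω k / t)) P :=
      ((hindI _ _).const_mul _).add ((hindI _ _).const_mul _)
    rw [← Real.norm_eq_abs]
    refine norm_integral_le_of_norm_le hI ?_
    filter_upwards [hXnonneg] with ω hω
    exact hpt _ fun k => div_nonneg (hω k) ht.le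
  have hHt := hH.pos t
  have h4 : |(∫ ω, F (fun k => X ω k / t) ∂P) / H t - (∫ ω, Q (fun k => X ω k / t) ∂P) / H t| ≤
      η' * (V (ε * t) / H t) + B * (V (κ * t) / H t) := by
    rw [← sub_div, abs_div, abs_of_pos hHt, div_le_iff₀ hHt]
    refine h3.trans_eq ?_
    field_simp
  calc _ ≤ _ := abs_sub_le _ ((∫ ω, Q (fun k => X ω k / t) ∂P) / H t) L
    _ ≤ η := by linarith

end Rescaled

end TailRisk

/-! ### Positive linear combinations and the contributions of the components -/

namespace TailRisk

lemma inner_eq_sum {d : ℕ} (θ x : EuclideanSpace ℝ (Fin d)) :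
    inner ℝ θ x = ∑ k, θ k * x k := by
  simp [PiLp.inner_apply, mul_comm]

lemma inner_nonneg_of_nonneg {d : ℕ} {θ x : EuclideanSpace ℝ (Fin d)} (hθ : ∀ k, 0 < θ k)
    (hx : ∀ k, 0 ≤ x k) : 0 ≤ inner ℝ θ x := by
  rw [inner_eq_sum]
  exact Finset.sum_nonneg fun k _ => mul_nonneg (hθ k).le (hx k)

lemma mul_le_inner {d : ℕ} {θ x : EuclideanSpace ℝ (Fin d)} (hθ : ∀ k, 0 < θ k)
    (hx : ∀ k, 0 ≤ x k) (k : Fin d) : θ k * x k ≤ inner ℝ θ x := by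
  rw [inner_eq_sum]
  exact Finset.single_le_sum (f := fun k => θ k * x k)
    (fun j _ => mul_nonneg (hθ j).le (hx j)) (Finset.mem_univ k)

lemma div_inner_mem {d : ℕ} {θ x : EuclideanSpace ℝ (Fin d)} (hθ : ∀ k, 0 < θ k)
    (hx : ∀ k, 0 ≤ x k) (k : Fin d) : 0 ≤ x k / inner ℝ θ x ∧ x k / inner ℝ θ x ≤ (θ k)⁻¹ := by
  refine ⟨div_nonneg (hx k) (inner_nonneg_of_nonneg hθ hx), ?_⟩
  refine div_le_of_le_mul₀ (inner_nonneg_of_nonneg hθ hx) (inv_nonneg.2 (hθ k).le) ?_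
  rw [inv_mul_eq_div, le_div_iff₀ (hθ k), mul_comm]
  exact mul_le_inner hθ hx k

/-- The tail function weighted by `U`, i.e. `t ↦ E[U; S > t]`. -/
noncomputable def weightedTail {Ω : Type*} [MeasurableSpace Ω] (P : Measure Ω) (U S : Ω → ℝ)
    (t : ℝ) : ℝ :=
  ∫ ω in {ω | t < S ω}, U ω ∂P

lemma weightedTail_nonneg {Ω : Type*} [MeasurableSpace Ω] {P : Measure Ω} {U S : Ω → ℝ}
    (hU : ∀ᵐ ω ∂P, 0 ≤ U ω) (t : ℝ) : 0 ≤ weightedTail P U S t :=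
  setIntegral_nonneg_of_ae hU

section Linear

variable {d : ℕ} {Ω : Type*} [MeasurableSpace Ω] {P : Measure Ω} [IsProbabilityMeasure P]
  {X : Ω → EuclideanSpace ℝ (Fin d)} {H : ℝ → ℝ} {θ : EuclideanSpace ℝ (Fin d)} {α : ℝ}

lemma integrable_div_inner (hX : Measurable X) (hXnonneg : ∀ᵐ ω ∂P, ∀ k, 0 ≤ X ω k)
    (hθ : ∀ k, 0 < θ k) (k : Fin d) : Integrable (fun ω => X ω k / inner ℝ θ (X ω)) P := by
  refine Integrable.of_bound (Measurable.aestronglyMeasurable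
    (Measurable.div (by fun_prop) (by fun_prop))) (θ k)⁻¹ ?_
  filter_upwards [hXnonneg] with ω hω
  have := div_inner_mem hθ hω k
  rw [Real.norm_eq_abs, abs_of_nonneg this.1]
  exact this.2

/-- A continuous cutoff with values in `[0, 1]`, `0` on `(-∞, 1]` and `1` on `[1 + δ, ∞)`. -/
noncomputable def cutoff (δ u : ℝ) : ℝ := max 0 (min 1 ((u - 1) / δ))

lemma cutoff_mem {δ : ℝ} (u : ℝ) : 0 ≤ cutoff δ u ∧ cutoff δ u ≤ 1 :=
  ⟨le_max_left _ _, max_le zero_le_one (min_le_left _ _)⟩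

lemma cutoff_of_le {δ u : ℝ} (hδ : 0 < δ) (hu : u ≤ 1) : cutoff δ u = 0 :=
  max_eq_left ((min_le_right _ _).trans (div_nonpos_of_nonpos_of_nonneg (by linarith) hδ.le))

lemma cutoff_of_ge {δ u : ℝ} (hδ : 0 < δ) (hu : 1 + δ ≤ u) : cutoff δ u = 1 := by
  rw [cutoff, min_eq_left ((one_le_div hδ).2 (by linarith)), max_eq_right zero_le_one]

/-- A continuous cutoff replaces the indicator of `σ > 1`, and `max (σ z) 1` agrees with `σ z` where
the cutoff is nonzero. The smoothed expectation then lies between the weighted tails at `(1 + δ) *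
t` and at `t`. -/
lemma exists_weightedTail_bounds (hX : Measurable X) (hXnonneg : ∀ᵐ ω ∂P, ∀ k, 0 ≤ X ω k)
    (hH : IsRVTail H α)
    (hbox : ∀ (K : Finset (Fin d)) (x : Fin d → ℝ), (∀ k ∈ K, 0 < x k) → ∃ v,
      Tendsto (fun t => P.real {ω | ∃ k ∈ K, t * x k < X ω k} / H t) atTop (𝓝 v))
    (hθ : ∀ k, 0 < θ k) (k : Fin d) {δ : ℝ} (hδ : 0 < δ) :
    ∃ (E : ℝ → ℝ) (L : ℝ), Tendsto (fun t => E t / H t) atTop (𝓝 L) ∧ ∀ t, 0 < t →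
      weightedTail P (fun ω => X ω k / inner ℝ θ (X ω)) (fun ω => inner ℝ θ (X ω)) ((1 + δ) * t)
        ≤ E t ∧
      E t ≤ weightedTail P (fun ω => X ω k / inner ℝ θ (X ω)) (fun ω => inner ℝ θ (X ω)) t := by
  set σ : (Fin d → ℝ) → ℝ := fun z => ∑ j, θ j * z j with hσ
  have hσc : Continuous σ := by fun_prop
  set F : (Fin d → ℝ) → ℝ := fun z => z k * cutoff δ (σ z) / max (σ z) 1 with hF
  have hFc : Continuous F := by
    refine Continuous.div ?_ (hσc.max continuous_const)
      fun z => (lt_of_lt_of_le one_pos (le_max_right _ _)).ne'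
    unfold cutoff
    fun_prop
  have hθsum : 0 < ∑ j, θ j :=
    Finset.sum_pos (fun j _ => hθ j) ⟨k, Finset.mem_univ k⟩
  have hσnn : ∀ z : Fin d → ℝ, (∀ j, 0 ≤ z j) → θ k * z k ≤ σ z := fun z hz =>
    Finset.single_le_sum (f := fun j => θ j * z j)
      (fun j _ => mul_nonneg (hθ j).le (hz j)) (Finset.mem_univ k)
  -- If all coordinates are at most `(∑ j, θ j)⁻¹` then `σ z ≤ 1` and `F z = 0`; the bound `(θ k)⁻¹`
  -- comes from `θ k * z k ≤ σ z`.
  obtain ⟨L, hL⟩ := exists_tendsto_integral_rescaled hX hXnonneg hH hbox hFc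
    (B := (θ k)⁻¹) (inv_pos.2 hθsum) (fun z hz => by
      have hm : 0 < max (σ z) 1 := lt_of_lt_of_le one_pos (le_max_right _ _)
      have hc := cutoff_mem (δ := δ) (σ z)
      rw [abs_of_nonneg (div_nonneg (mul_nonneg (hz k) hc.1) hm.le), div_le_iff₀ hm,
        inv_mul_eq_div, le_div_iff₀ (hθ k)]
      calc z k * cutoff δ (σ z) * θ k ≤ z k * 1 * θ k := by
            have := hz k; have := (hθ k).le; gcongr; exact hc.2
        _ = θ k * z k := by ring
        _ ≤ max (σ z) 1 := (hσnn z hz).trans (le_max_left _ _)) (fun z hz hzε => by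
      have : σ z ≤ 1 := by
        calc σ z ≤ ∑ j, θ j * (∑ i, θ i)⁻¹ :=
              Finset.sum_le_sum fun j _ => mul_le_mul_of_nonneg_left (hzε j) (hθ j).le
          _ = 1 := by rw [← Finset.sum_mul, mul_inv_cancel₀ hθsum.ne']
      simp only [hF, cutoff_of_le hδ this, mul_zero, zero_div])
  refine ⟨fun t => ∫ ω, F (fun k => X ω k / t) ∂P, L, hL, fun t ht => ?_⟩
  have hUI := integrable_div_inner (P := P) hX hXnonneg hθ k
  have hmS : ∀ s : ℝ, MeasurableSet {ω | s < inner ℝ θ (X ω)} := fun s =>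
    measurableSet_lt measurable_const (by fun_prop)
  have hσX : ∀ ω, σ (fun k => X ω k / t) = inner ℝ θ (X ω) / t := fun ω => by
    rw [inner_eq_sum, Finset.sum_div]
    exact Finset.sum_congr rfl fun j _ => by ring
  have hle : ∀ ω, inner ℝ θ (X ω) ≤ t → F (fun k => X ω k / t) = 0 := fun ω hω => by
    simp only [hF, hσX]
    rw [cutoff_of_le hδ ((div_le_one ht).2 hω), mul_zero, zero_div]
  have hgt : ∀ ω, t < inner ℝ θ (X ω) → F (fun k => X ω k / t) =
      X ω k / inner ℝ θ (X ω) * cutoff δ (inner ℝ θ (X ω) / t) := fun ω hω => by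
    simp only [hF, hσX]
    rw [max_eq_left ((one_le_div ht).2 hω.le)]
    have : inner ℝ θ (X ω) ≠ 0 := (ht.trans hω).ne'
    field_simp
  have hmF : Measurable fun ω => F (fun k => X ω k / t) :=
    hFc.measurable.comp (measurable_pi_lambda (fun ω k => X ω k / t) fun k => by fun_prop)
  have hptb : ∀ᵐ ω ∂P, Set.indicator {ω | (1 + δ) * t < inner ℝ θ (X ω)}
        (fun ω => X ω k / inner ℝ θ (X ω)) ω ≤ F (fun k => X ω k / t) ∧
      F (fun k => X ω k / t) ≤ Set.indicator {ω | t < inner ℝ θ (X ω)}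
        (fun ω => X ω k / inner ℝ θ (X ω)) ω := by
    filter_upwards [hXnonneg] with ω hω
    have hU := (div_inner_mem hθ hω k).1
    have hc := cutoff_mem (δ := δ) (inner ℝ θ (X ω) / t)
    rcases le_or_gt (inner ℝ θ (X ω)) t with h | h
    · have h' : ¬ (1 + δ) * t < inner ℝ θ (X ω) := by nlinarith
      rw [hle ω h, Set.indicator_of_notMem (by exact h'), Set.indicator_of_notMem (by simpa using h)]
      simp
    · rw [hgt ω h, Set.indicator_of_mem (s := {ω | t < inner ℝ θ (X ω)}) h]
      refine ⟨?_, mul_le_of_le_one_right hU hc.2⟩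
      rw [Set.indicator_apply]
      split_ifs with h2
      · rw [cutoff_of_ge hδ ((le_div_iff₀ ht).2 (le_of_lt h2)), mul_one]
      · exact mul_nonneg hU hc.1
  have hFI : Integrable (fun ω => F (fun k => X ω k / t)) P := by
    refine Integrable.mono' (hUI.indicator (hmS t)) hmF.aestronglyMeasurable ?_
    filter_upwards [hptb, hXnonneg] with ω hω h0
    have h1 : 0 ≤ Set.indicator {ω | (1 + δ) * t < inner ℝ θ (X ω)}
        (fun ω => X ω k / inner ℝ θ (X ω)) ω := by
      rw [Set.indicator_apply]; split_ifs
      · exact (div_inner_mem hθ h0 k).1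
      · exact le_rfl
    rw [Real.norm_eq_abs, abs_of_nonneg (h1.trans hω.1)]
    exact hω.2
  constructor
  · rw [weightedTail, ← integral_indicator (hmS _)]
    exact integral_mono_ae (hUI.indicator (hmS _)) hFI (hptb.mono fun ω h => h.1)
  · rw [weightedTail, ← integral_indicator (hmS _)]
    exact integral_mono_ae hFI (hUI.indicator (hmS _)) (hptb.mono fun ω h => h.2)

/-- The weighted tail lies between `E t` and `E (t / (1 + δ))`, whose limits after division by `H t`
are `L` and `L * (1 + δ) ^ α`. The bound `M`, taken from `δ = 1`, controls `L` uniformly in `δ`, so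
the gap closes as `δ → 0`. -/
lemma exists_tendsto_weightedTail (hX : Measurable X) (hXnonneg : ∀ᵐ ω ∂P, ∀ k, 0 ≤ X ω k)
    (hH : IsRVTail H α)
    (hbox : ∀ (K : Finset (Fin d)) (x : Fin d → ℝ), (∀ k ∈ K, 0 < x k) → ∃ v,
      Tendsto (fun t => P.real {ω | ∃ k ∈ K, t * x k < X ω k} / H t) atTop (𝓝 v))
    (hθ : ∀ k, 0 < θ k) (k : Fin d) :
    ∃ p, Tendsto (fun t => weightedTail P (fun ω => X ω k / inner ℝ θ (X ω))
      (fun ω => inner ℝ θ (X ω)) t / H t) atTop (𝓝 p) := by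
  set R := weightedTail P (fun ω => X ω k / inner ℝ θ (X ω)) (fun ω => inner ℝ θ (X ω))
  have hshrink : ∀ {E : ℝ → ℝ} {L δ : ℝ}, 0 < δ → Tendsto (fun t => E t / H t) atTop (𝓝 L) →
      Tendsto (fun t => E ((1 + δ)⁻¹ * t) / H t) atTop (𝓝 (L * (1 + δ) ^ α)) :=
      fun {E L δ} hδ hE => by
    have hs : 0 < (1 + δ)⁻¹ := by positivity
    have := hH.tendsto_comp_mul hE hs
    rwa [Real.inv_rpow (by positivity), Real.rpow_neg (by positivity), inv_inv] at this
  have hupper : ∀ {E : ℝ → ℝ} {δ t : ℝ}, 0 < δ → 0 < t → (∀ t, 0 < t → R ((1 + δ) * t) ≤ E t) →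
      R t / H t ≤ E ((1 + δ)⁻¹ * t) / H t := fun {E δ t} hδ ht h => by
    refine div_le_div_of_nonneg_right ?_ (hH.nonneg t)
    have := h ((1 + δ)⁻¹ * t) (by positivity)
    rwa [mul_inv_cancel_left₀ (by positivity)] at this
  obtain ⟨E₁, L₁, hE₁, hb₁⟩ :=
    exists_weightedTail_bounds (P := P) hX hXnonneg hH hbox hθ k one_pos
  set M := L₁ * (1 + 1) ^ α with hM
  have hLM : ∀ {E : ℝ → ℝ} {L : ℝ}, Tendsto (fun t => E t / H t) atTop (𝓝 L) →
      (∀ t, 0 < t → E t ≤ R t) → L ≤ M := fun {E L} hE h => by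
    refine le_of_tendsto_of_tendsto hE (hshrink one_pos hE₁) ?_
    filter_upwards [eventually_gt_atTop 0] with t ht
    exact (div_le_div_of_nonneg_right (h t ht) (hH.nonneg t)).trans
      (hupper one_pos ht fun t ht => (hb₁ t ht).1)
  refine exists_tendsto_of_approx fun η hη => ?_
  obtain ⟨δ, hδM, hδ⟩ : ∃ δ, M * ((1 + δ) ^ α - 1) < η / 2 ∧ 0 < δ := by
    have hc : ContinuousAt (fun δ : ℝ => M * ((1 + δ) ^ α - 1)) 0 := by
      have : ContinuousAt (fun δ : ℝ => (1 + δ) ^ α) 0 :=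
        (by fun_prop : ContinuousAt (fun δ : ℝ => 1 + δ) 0).rpow_const (Or.inl (by simp))
      fun_prop
    exact (((hc.eventually_lt_const (by simpa using half_pos hη)).filter_mono
      nhdsWithin_le_nhds).and (self_mem_nhdsWithin : Set.Ioi (0 : ℝ) ∈ 𝓝[>] 0)).exists
  obtain ⟨E, L, hE, hb⟩ := exists_weightedTail_bounds (P := P) hX hXnonneg hH hbox hθ k hδ
  have hL := hLM hE fun t ht => (hb t ht).2
  have hgrow : 0 ≤ (1 + δ) ^ α - 1 :=
    sub_nonneg.2 (Real.one_le_rpow (by linarith) hH.index_pos.le)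
  refine ⟨L, ?_⟩
  filter_upwards [eventually_gt_atTop 0, hE.eventually_const_lt (sub_lt_self L hη),
    (hshrink hδ hE).eventually_lt_const
      (lt_add_of_pos_right _ (half_pos hη))] with t ht h1 h2
  have h3 := hupper hδ ht fun t ht => (hb t ht).1
  have h4 := div_le_div_of_nonneg_right (hb t ht).2 (hH.nonneg t)
  have h5 : L * ((1 + δ) ^ α - 1) ≤ M * ((1 + δ) ^ α - 1) := by gcongr
  rw [abs_le]
  constructor <;> linarith

/-- Regular variation of a positive linear combination of the components, and convergence of the
contributions of the components. -/
lemma isRVTail_inner (hX : Measurable X) (hXnonneg : ∀ᵐ ω ∂P, ∀ k, 0 ≤ X ω k)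
    (hH : IsRVTail H α) {ahat : Fin d → ℝ} {k₀ : Fin d} (hk₀ : H = tail P fun ω => X ω k₀)
    (hmarg : ∀ k, ∃ c, (0 < ahat k → 0 < c) ∧
      Tendsto (fun t => tail P (fun ω => X ω k) t / H t) atTop (𝓝 c))
    (hbox : ∀ (K : Finset (Fin d)) (x : Fin d → ℝ), (∀ k ∈ K, 0 < x k) → ∃ v,
      Tendsto (fun t => P.real {ω | ∃ k ∈ K, t * x k < X ω k} / H t) atTop (𝓝 v))
    (hθ : ∀ k, 0 < θ k) :
    IsRVTail (tail P fun ω => inner ℝ θ (X ω)) α ∧ ∃ p : Fin d → ℝ, (∀ k, 0 < ahat k → 0 < p k) ∧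
      p ≠ 0 ∧
      ∀ k, Tendsto (fun t => weightedTail P (fun ω => X ω k / inner ℝ θ (X ω))
        (fun ω => inner ℝ θ (X ω)) t / tail P (fun ω => inner ℝ θ (X ω)) t) atTop (𝓝 (p k)) := by
  choose p hp using fun k => exists_tendsto_weightedTail (P := P) hX hXnonneg hH hbox hθ k
  have hUI := fun k => integrable_div_inner (P := P) hX hXnonneg hθ k
  have hU0 : ∀ k, ∀ᵐ ω ∂P, 0 ≤ X ω k / inner ℝ θ (X ω) := fun k => by
    filter_upwards [hXnonneg] with ω hω using (div_inner_mem hθ hω k).1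
  have hmS : ∀ s : ℝ, MeasurableSet {ω | s < inner ℝ θ (X ω)} := fun s =>
    measurableSet_lt measurable_const (by fun_prop)
  -- On `S > t ≥ 0` the weighted shares `θ k * X_k / S` add up to `1`.
  have hsum : ∀ t, 0 ≤ t → tail P (fun ω => inner ℝ θ (X ω)) t =
      ∑ k, θ k * weightedTail P (fun ω => X ω k / inner ℝ θ (X ω))
        (fun ω => inner ℝ θ (X ω)) t := by
    intro t ht
    simp only [weightedTail, ← integral_const_mul]
    rw [← integral_finsetSum _ fun k _ => ((hUI k).const_mul _).integrableOn]
    rw [setIntegral_congr_fun (g := fun _ => (1 : ℝ)) (hmS t)]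
    · simp [tail]
    · intro ω hω
      have h0 : inner ℝ θ (X ω) ≠ 0 := (lt_of_le_of_lt ht hω).ne'
      simp only [← mul_div_assoc]
      rw [← Finset.sum_div, ← inner_eq_sum, div_self h0]
  have hlimS : Tendsto (fun t => tail P (fun ω => inner ℝ θ (X ω)) t / H t) atTop
      (𝓝 (∑ k, θ k * p k)) := by
    refine (tendsto_finsetSum Finset.univ fun k _ => (hp k).const_mul (θ k)).congr' ?_
    filter_upwards [eventually_ge_atTop 0] with t ht
    rw [hsum t ht, Finset.sum_div]
    exact Finset.sum_congr rfl fun k _ => by ring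
  set s := ∑ k, θ k * p k with hs
  have hp0 : ∀ k, 0 ≤ p k := fun k =>
    ge_of_tendsto' (hp k) fun t => div_nonneg (weightedTail_nonneg (hU0 k) t) (hH.nonneg t)
  have hs0 : 0 ≤ s := Finset.sum_nonneg fun k _ => mul_nonneg (hθ k).le (hp0 k)
  -- On the event `X_k > t / θ k`, `S ≤ κ * t` one has `S > t` and `X_k / S ≥ 1 / (θ k * κ)`. For
  -- large `κ` the probability of this event is still of order `H t`.
  have hpos : ∀ k c, 0 < c → Tendsto (fun t => tail P (fun ω => X ω k) t / H t) atTop (𝓝 c) →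
      0 < p k := by
    intro k c hc hck
    have hθk := hθ k
    obtain ⟨κ, hκ1, hκ0⟩ : ∃ κ, s * κ ^ (-α) < c * (θ k)⁻¹ ^ (-α) ∧ 0 < κ := by
      have h1 := (tendsto_rpow_neg_atTop hH.index_pos).const_mul s
      rw [mul_zero] at h1
      exact ((h1.eventually_lt_const (by positivity)).and (eventually_gt_atTop 0)).exists
    have h1 : Tendsto (fun t => tail P (fun ω => X ω k) ((θ k)⁻¹ * t) / H t) atTop
        (𝓝 (c * (θ k)⁻¹ ^ (-α))) := hH.tendsto_comp_mul hck (inv_pos.2 hθk)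
    have h2 : Tendsto (fun t => tail P (fun ω => inner ℝ θ (X ω)) (κ * t) / H t) atTop
        (𝓝 (s * κ ^ (-α))) := hH.tendsto_comp_mul hlimS hκ0
    have h3 := (h1.sub h2).const_mul ((θ k)⁻¹ * κ⁻¹)
    refine lt_of_lt_of_le (mul_pos (by positivity) (sub_pos.2 hκ1))
      (le_of_tendsto_of_tendsto h3 (hp k) ?_)
    filter_upwards [eventually_gt_atTop 0] with t ht
    rw [← sub_div, ← mul_div_assoc]
    refine div_le_div_of_nonneg_right ?_ (hH.nonneg t)
    have hmX : ∀ u : ℝ, MeasurableSet {ω | u < X ω k} := fun u =>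
      measurableSet_lt measurable_const (by fun_prop)
    set A := {ω | (θ k)⁻¹ * t < X ω k} \ {ω | κ * t < inner ℝ θ (X ω)} with hA
    have hAm : MeasurableSet A := (hmX _).diff (hmS _)
    have h5 : tail P (fun ω => X ω k) ((θ k)⁻¹ * t) - tail P (fun ω => inner ℝ θ (X ω)) (κ * t) ≤
        P.real A := le_measureReal_sdiff
    have h6 : ∫ ω, A.indicator (fun _ => (θ k)⁻¹ * κ⁻¹) ω ∂P ≤
        ∫ ω, {ω | t < inner ℝ θ (X ω)}.indicator (fun ω => X ω k / inner ℝ θ (X ω)) ω ∂P := by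
      refine integral_mono_ae ((integrable_const _).indicator hAm) ((hUI k).indicator (hmS t)) ?_
      filter_upwards [hXnonneg] with ω hω
      by_cases hωA : ω ∈ A
      · obtain ⟨g1, g2⟩ := id hωA
        have g1' : (θ k)⁻¹ * t < X ω k := g1
        have g2' : inner ℝ θ (X ω) ≤ κ * t := not_lt.1 g2
        have g3 : t < θ k * X ω k := by
          have := mul_lt_mul_of_pos_left g1' hθk
          rwa [mul_inv_cancel_left₀ hθk.ne'] at this
        have g4 : t < inner ℝ θ (X ω) := g3.trans_le (mul_le_inner hθ hω k)
        rw [Set.indicator_of_mem hωA, Set.indicator_of_mem (s := {ω | t < inner ℝ θ (X ω)}) g4,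
          le_div_iff₀ (ht.trans g4)]
        calc (θ k)⁻¹ * κ⁻¹ * inner ℝ θ (X ω) ≤ (θ k)⁻¹ * κ⁻¹ * (κ * t) := by gcongr
          _ = (θ k)⁻¹ * t := by field_simp
          _ ≤ X ω k := g1'.le
      · rw [Set.indicator_of_notMem hωA, Set.indicator_apply]
        split_ifs
        · exact (div_inner_mem hθ hω k).1
        · exact le_rfl
    rw [integral_indicator hAm, integral_indicator (hmS t), setIntegral_const, smul_eq_mul] at h6
    calc _ ≤ (θ k)⁻¹ * κ⁻¹ * P.real A := by gcongr
      _ = P.real A * ((θ k)⁻¹ * κ⁻¹) := mul_comm _ _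
      _ ≤ _ := h6
  have hpk₀ : 0 < p k₀ := by
    refine hpos k₀ 1 one_pos (tendsto_const_nhds.congr fun t => ?_)
    rw [← hk₀, div_self (hH.pos t).ne']
  have hspos : 0 < s := lt_of_lt_of_le (mul_pos (hθ k₀) hpk₀)
    (Finset.single_le_sum (f := fun k => θ k * p k) (fun j _ => mul_nonneg (hθ j).le (hp0 j))
      (Finset.mem_univ k₀))
  have hS : IsRVTail (tail P fun ω => inner ℝ θ (X ω)) α :=
    hH.of_tendsto_div tail_anti tail_nonneg hspos hlimS
  refine ⟨hS, fun k => p k / s, fun k hk => ?_, fun h => ?_, fun k => ?_⟩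
  · obtain ⟨c, hc, hlim⟩ := hmarg k
    exact div_pos (hpos k c (hc hk) hlim) hspos
  · exact (div_pos hpk₀ hspos).ne' (congrFun h k₀)
  · refine ((hp k).div hlimS hspos.ne').congr fun t => ?_
    have := (hH.pos t).ne'
    have := (hS.pos t).ne'
    simp only [Pi.div_apply]
    field_simp

end Linear

end TailRisk

/-! ### Karamata's theorem with a bounded weight -/

namespace TailRisk

section Karamata

variable {Ω : Type*} [MeasurableSpace Ω] {P : Measure Ω}
  {S U : Ω → ℝ} {α q M p : ℝ}

/-- Layer-cake formula for `S / w` under the measure with density `U` on `w < S`; there `S / w > y`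
means `S > w * max y 1`. -/
lemma integral_mul_rpow_eq (hS : Measurable S) (hU : Measurable U) (hU0 : ∀ᵐ ω ∂P, 0 ≤ U ω)
    (hUI : Integrable U P) (hq : 0 < q) {w : ℝ} (hw : 0 < w) :
    ∫ ω in {ω | w < S ω}, U ω * (S ω / w) ^ q ∂P =
      q * ∫ y in Set.Ioi (0 : ℝ), y ^ (q - 1) * weightedTail P U S (w * max y 1) := by
  have hmS : ∀ s : ℝ, MeasurableSet {ω | s < S ω} := fun s =>
    measurableSet_lt measurable_const hS
  set ν := (P.restrict {ω | w < S ω}).withDensity fun ω => ENNReal.ofReal (U ω) with hν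
  have hac : ν ≪ P.restrict {ω | w < S ω} := withDensity_absolutelyContinuous _ _
  have hSw : ∀ᵐ ω ∂(P.restrict {ω | w < S ω}), 0 ≤ S ω / w := by
    filter_upwards [ae_restrict_mem (hmS w)] with ω hω
    exact div_nonneg (hw.trans hω).le hw.le
  have hlay := lintegral_rpow_eq_lintegral_meas_lt_mul ν (f := fun ω => S ω / w)
    (hac.ae_le hSw) (hS.div_const w).aemeasurable hq
  have hmeas : ∀ y, ν {ω | y < S ω / w} = ENNReal.ofReal (weightedTail P U S (w * max y 1)) := by
    intro y
    have hset : {ω | y < S ω / w} ∩ {ω | w < S ω} = {ω | w * max y 1 < S ω} := by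
      ext ω
      simp only [Set.mem_inter_iff, Set.mem_ofPred_eq, lt_div_iff₀ hw, mul_max_of_nonneg _ _ hw.le,
        max_lt_iff, mul_one, mul_comm]
    rw [hν, withDensity_apply _ (measurableSet_lt measurable_const (hS.div_const w)),
      Measure.restrict_restrict (measurableSet_lt measurable_const (hS.div_const w)), hset,
      weightedTail, ofReal_integral_eq_lintegral_ofReal hUI.integrableOn (ae_restrict_of_ae hU0)]
  have hL : ∫ ω in {ω | w < S ω}, U ω * (S ω / w) ^ q ∂P =
      (∫⁻ ω, ENNReal.ofReal ((S ω / w) ^ q) ∂ν).toReal := by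
    rw [integral_eq_lintegral_of_nonneg_ae]
    · congr 1
      rw [hν, lintegral_withDensity_eq_lintegral_mul₀ hU.ennreal_ofReal.aemeasurable
        ((hS.div_const w).pow_const q).ennreal_ofReal.aemeasurable]
      refine lintegral_congr_ae ?_
      filter_upwards [ae_restrict_of_ae hU0] with ω h1
      simp only [Pi.mul_apply]
      rw [ENNReal.ofReal_mul h1]
    · filter_upwards [ae_restrict_of_ae hU0, hSw] with ω h1 h2
      exact mul_nonneg h1 (Real.rpow_nonneg h2 _)
    · exact (hU.mul ((hS.div_const w).pow_const q)).aestronglyMeasurable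
  have hRa : Antitone (weightedTail P U S) := fun s t hst =>
    setIntegral_mono_set hUI.integrableOn (ae_restrict_of_ae hU0)
      (Eventually.of_forall fun ω (hω : t < S ω) => lt_of_le_of_lt hst hω)
  have hRm : Measurable fun y => weightedTail P U S (w * max y 1) :=
    hRa.measurable.comp (by fun_prop)
  have hR : ∫ y in Set.Ioi (0 : ℝ), y ^ (q - 1) * weightedTail P U S (w * max y 1) =
      (∫⁻ y in Set.Ioi (0 : ℝ), ν {ω | y < S ω / w} * ENNReal.ofReal (y ^ (q - 1))).toReal := by
    rw [integral_eq_lintegral_of_nonneg_ae]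
    · congr 1
      refine setLIntegral_congr_fun measurableSet_Ioi fun y hy => ?_
      simp only [hmeas]
      rw [← ENNReal.ofReal_mul (weightedTail_nonneg hU0 _), mul_comm]
    · filter_upwards [ae_restrict_mem measurableSet_Ioi] with y hy
      exact mul_nonneg (Real.rpow_nonneg (le_of_lt hy) _) (weightedTail_nonneg hU0 _)
    · exact ((measurable_id.pow_const _).mul hRm).aestronglyMeasurable
  rw [hL, hlay, hR, ENNReal.toReal_mul, ENNReal.toReal_ofReal hq.le]

lemma weightedTail_one (t : ℝ) : weightedTail P (fun _ => 1) S t = tail P S t := by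
  simp [weightedTail, tail]

/-- The constant in Karamata's theorem. -/
noncomputable def karamataConst (q α : ℝ) : ℝ :=
  q * ∫ y in Set.Ioi (0 : ℝ), y ^ (q - 1) * (max y 1) ^ (-α)

lemma integrableOn_rpow_mul_max (hq : 0 < q) {α : ℝ} (hα : q < α) :
    IntegrableOn (fun y : ℝ => y ^ (q - 1) * (max y 1) ^ (-α)) (Set.Ioi 0) := by
  rw [← Set.Ioc_union_Ioi_eq_Ioi zero_le_one]
  refine IntegrableOn.union ?_ ?_
  · have h1 : IntegrableOn (fun y : ℝ => y ^ (q - 1)) (Set.Ioc 0 1) :=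
      (intervalIntegrable_iff_integrableOn_Ioc_of_le zero_le_one).1
        (intervalIntegral.intervalIntegrable_rpow' (by linarith))
    refine h1.congr_fun (fun y hy => ?_) measurableSet_Ioc
    simp only [max_eq_right hy.2, Real.one_rpow, mul_one]
  · have h1 : IntegrableOn (fun y : ℝ => y ^ (q - 1 - α)) (Set.Ioi 1) :=
      integrableOn_Ioi_rpow_of_lt (by linarith) one_pos
    refine h1.congr_fun (fun y hy => ?_) measurableSet_Ioi
    have hy' : (1 : ℝ) < y := hy
    simp only [max_eq_left hy'.le]
    rw [← Real.rpow_add (by linarith), sub_eq_add_neg (q - 1)]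

variable [IsProbabilityMeasure P]

/-- Karamata's theorem for truncated moments with a bounded weight. -/
lemma tendsto_truncated_moment (hS : Measurable S) (hU : Measurable U)
    (hU0 : ∀ᵐ ω ∂P, 0 ≤ U ω) (hUM : ∀ᵐ ω ∂P, U ω ≤ M) (hT : IsRVTail (tail P S) α) (hq : 0 < q)
    (hqα : q < α) (hp : Tendsto (fun t => weightedTail P U S t / tail P S t) atTop (𝓝 p)) :
    Tendsto (fun w => (∫ ω in {ω | w < S ω}, U ω * S ω ^ q ∂P) / (w ^ q * tail P S w)) atTop
      (𝓝 (p * karamataConst q α)) := by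
  have hUI : Integrable U P := by
    refine Integrable.of_bound hU.aestronglyMeasurable M ?_
    filter_upwards [hU0, hUM] with ω h0 h1
    rwa [Real.norm_eq_abs, abs_of_nonneg h0]
  have hM0 : 0 ≤ M := by
    obtain ⟨ω, h0, h1⟩ := (hU0.and hUM).exists
    exact h0.trans h1
  have hRM : ∀ t, weightedTail P U S t ≤ M * tail P S t := fun t => by
    have h1 : weightedTail P U S t ≤ ∫ ω in {ω | t < S ω}, M ∂P :=
      setIntegral_mono_ae hUI.integrableOn (integrable_const M).integrableOn hUM
    rw [setIntegral_const, smul_eq_mul, mul_comm] at h1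
    exact h1
  have hRa : Antitone (weightedTail P U S) := fun s t hst =>
    setIntegral_mono_set hUI.integrableOn (ae_restrict_of_ae hU0)
      (Eventually.of_forall fun ω (hω : t < S ω) => lt_of_le_of_lt hst hω)
  -- The Potter bound with an exponent `r` strictly between `q` and `α` gives a majorant that is
  -- integrable against `y ^ (q - 1)`.
  obtain ⟨r, hqr, hrα⟩ := exists_between hqα
  obtain ⟨A, w₀, hA, hw₀, hpot⟩ := hT.exists_potter (hq.trans hqr) hrα
  have hdct : Tendsto (fun w => ∫ y in Set.Ioi (0 : ℝ),
      y ^ (q - 1) * (weightedTail P U S (w * max y 1) / tail P S w)) atTop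
      (𝓝 (∫ y in Set.Ioi (0 : ℝ), y ^ (q - 1) * (p * (max y 1) ^ (-α)))) := by
    refine tendsto_integral_filter_of_dominated_convergence
      (fun y => M * A * (y ^ (q - 1) * (max y 1) ^ (-r))) ?_ ?_ ?_ ?_
    · refine Eventually.of_forall fun w => Measurable.aestronglyMeasurable ?_
      exact (measurable_id.pow_const _).mul
        ((hRa.measurable.comp (by fun_prop : Measurable fun y : ℝ => w * max y 1)).div_const _)
    · filter_upwards [eventually_ge_atTop w₀] with w hw
      filter_upwards [ae_restrict_mem measurableSet_Ioi] with y hy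
      have hy0 : (0 : ℝ) < y := hy
      have hTw := hT.pos w
      rw [Real.norm_eq_abs, abs_of_nonneg (mul_nonneg (Real.rpow_nonneg hy0.le _)
        (div_nonneg (weightedTail_nonneg hU0 _) hTw.le))]
      have h1 : weightedTail P U S (w * max y 1) / tail P S w ≤ M * (A * max y 1 ^ (-r)) := by
        rw [div_le_iff₀ hTw]
        calc _ ≤ M * tail P S (w * max y 1) := hRM _
          _ ≤ M * (A * max y 1 ^ (-r) * tail P S w) := by
            gcongr
            exact hpot w hw _ (le_max_right _ _)
          _ = _ := by ring
      calc _ ≤ y ^ (q - 1) * (M * (A * max y 1 ^ (-r))) := by gcongr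
        _ = _ := by ring
    · exact (integrableOn_rpow_mul_max hq hqr).const_mul _
    · refine Eventually.of_forall fun y => Tendsto.const_mul _ ?_
      refine (hT.tendsto_comp_mul hp (c := max y 1)
        (lt_of_lt_of_le one_pos (le_max_right _ _))).congr fun w => by rw [mul_comm]
  have hlim := hdct.const_mul q
  have e : q * ∫ y in Set.Ioi (0 : ℝ), y ^ (q - 1) * (p * (max y 1) ^ (-α)) =
      p * karamataConst q α := by
    rw [karamataConst, ← mul_assoc, mul_comm p q, mul_assoc, ← integral_const_mul p]
    congr 2; ext y; ring
  rw [e] at hlim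
  refine hlim.congr' ?_
  filter_upwards [eventually_gt_atTop 0] with w hw
  have hTw := (hT.pos w).ne'
  have hwq : w ^ q ≠ 0 := by positivity
  have h1 := integral_mul_rpow_eq (P := P) hS hU hU0 hUI hq hw
  have h2 : ∫ ω in {ω | w < S ω}, U ω * (S ω / w) ^ q ∂P =
      (∫ ω in {ω | w < S ω}, U ω * S ω ^ q ∂P) / w ^ q := by
    rw [← integral_div]
    refine setIntegral_congr_fun (measurableSet_lt measurable_const hS) fun ω hω => ?_
    have hω' : w < S ω := hω
    rw [Real.div_rpow (hw.trans hω').le hw.le, mul_div_assoc]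
  rw [← div_div, ← h2, h1, mul_div_assoc, ← integral_div]
  congr 2; ext y; ring

/-- Karamata's theorem with weight `1` exhibits the constant as a limit of quotients that are at
least `1`, because `S ^ q ≥ w ^ q` on `S > w`. Only positivity is needed later, so the integral is
not evaluated. -/
lemma one_le_karamataConst (hS : Measurable S) (hT : IsRVTail (tail P S) α) (hq : 0 < q)
    (hqα : q < α) (hI : Integrable (fun ω => S ω ^ q) P) : 1 ≤ karamataConst q α := by
  have h := tendsto_truncated_moment (P := P) (U := fun _ => 1) (M := 1) (p := 1) hS
    measurable_const (by simp) (by simp) hT hq hqα (by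
      refine tendsto_const_nhds.congr fun t => ?_
      rw [weightedTail_one, div_self (hT.pos t).ne'])
  rw [one_mul] at h
  refine ge_of_tendsto h ?_
  filter_upwards [eventually_gt_atTop 0] with w hw
  have hTw := hT.pos w
  rw [one_le_div (by positivity)]
  have hm : MeasurableSet {ω | w < S ω} := measurableSet_lt measurable_const hS
  have h1 : ∫ ω in {ω | w < S ω}, w ^ q ∂P ≤ ∫ ω in {ω | w < S ω}, 1 * S ω ^ q ∂P := by
    refine setIntegral_mono_on (integrable_const _).integrableOn
      (by simpa using hI.integrableOn) hm fun ω hω => ?_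
    have hω' : w < S ω := hω
    rw [one_mul]
    exact Real.rpow_le_rpow hw.le hω'.le hq.le
  rw [setIntegral_const, smul_eq_mul, mul_comm] at h1
  exact h1

/-- Truncated expectations of functions with power growth. -/
lemma tendsto_truncated_expectation (hS : Measurable S) (hU : Measurable U)
    (hU0 : ∀ᵐ ω ∂P, 0 ≤ U ω) (hUM : ∀ᵐ ω ∂P, U ω ≤ M) (hT : IsRVTail (tail P S) α) (hq : 0 < q)
    (hqα : q < α) (hp : Tendsto (fun t => weightedTail P U S t / tail P S t) atTop (𝓝 p))
    (hI : Integrable (fun ω => S ω ^ q) P) {φ : ℝ → ℝ} (hφ : Measurable φ) {c : ℝ}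
    (hφc : Tendsto (fun u => φ u / u ^ q) atTop (𝓝 c)) :
    Tendsto (fun w => (∫ ω in {ω | w < S ω}, U ω * φ (S ω) ∂P) / (w ^ q * tail P S w)) atTop
      (𝓝 (c * (p * karamataConst q α))) := by
  have hmain := tendsto_truncated_moment (P := P) hS hU hU0 hUM hT hq hqα hp
  set D : ℝ → ℝ := fun w => (∫ ω in {ω | w < S ω}, U ω * S ω ^ q ∂P) / (w ^ q * tail P S w)
    with hD
  have hUSI : Integrable (fun ω => U ω * S ω ^ q) P := by
    refine hI.bdd_mul (c := M) hU.aestronglyMeasurable ?_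
    filter_upwards [hU0, hUM] with ω h0 h1
    rwa [Real.norm_eq_abs, abs_of_nonneg h0]
  have hdiff : Tendsto (fun w => (∫ ω in {ω | w < S ω}, U ω * φ (S ω) ∂P) / (w ^ q * tail P S w) -
      c * D w) atTop (𝓝 0) := by
    rw [Metric.tendsto_atTop']
    intro η hη
    -- `L` eventually bounds the normalised truncated moment `D`. A relative error `η / (2 * L)` in
    -- the growth of `φ` beyond `u₀` thus costs at most `η / 2`.
    set L := |p * karamataConst q α| + 1 with hL
    have hL0 : 0 < L := by positivity
    obtain ⟨u₀, hu₀⟩ := eventually_atTop.1 (hφc.eventually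
      (Metric.closedBall_mem_nhds c (show 0 < η / (2 * L) by positivity)))
    have hDL : ∀ᶠ w in atTop, D w < L :=
      hmain.eventually_lt_const (by have := le_abs_self (p * karamataConst q α); linarith)
    obtain ⟨w₁, hw₁⟩ := eventually_atTop.1 (hDL.and (eventually_ge_atTop (max u₀ 1)))
    refine ⟨w₁, fun w hw => ?_⟩
    obtain ⟨hDw, hww⟩ := hw₁ w hw.le
    have hw0 : 0 < w := lt_of_lt_of_le one_pos ((le_max_right _ _).trans hww)
    have hm : MeasurableSet {ω | w < S ω} := measurableSet_lt measurable_const hS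
    have hTw := hT.pos w
    have hpt : ∀ᵐ ω ∂(P.restrict {ω | w < S ω}), |U ω * φ (S ω) - c * (U ω * S ω ^ q)| ≤
        η / (2 * L) * (U ω * S ω ^ q) := by
      filter_upwards [ae_restrict_mem hm, ae_restrict_of_ae hU0] with ω hω h0
      have hω' : w < S ω := hω
      have hSq : 0 < S ω ^ q := Real.rpow_pos_of_pos (hw0.trans hω') _
      have h1 : |φ (S ω) / S ω ^ q - c| ≤ η / (2 * L) :=
        hu₀ (S ω) (((le_max_left _ _).trans hww).trans hω'.le)
      have e : U ω * φ (S ω) - c * (U ω * S ω ^ q) =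
          (φ (S ω) / S ω ^ q - c) * (U ω * S ω ^ q) := by field_simp
      rw [e, abs_mul, abs_of_nonneg (mul_nonneg h0 hSq.le)]
      gcongr
    have hbI : Integrable (fun ω => η / (2 * L) * (U ω * S ω ^ q)) (P.restrict {ω | w < S ω}) :=
      hUSI.integrableOn.const_mul _
    have hdI : Integrable (fun ω => U ω * φ (S ω) - c * (U ω * S ω ^ q))
        (P.restrict {ω | w < S ω}) :=
      hbI.mono' ((hU.mul (hφ.comp hS)).sub
        ((hU.mul (hS.pow_const q)).const_mul c)).aestronglyMeasurable hpt
    have hφI : Integrable (fun ω => U ω * φ (S ω)) (P.restrict {ω | w < S ω}) := by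
      have := hdI.add (hUSI.integrableOn.const_mul c)
      refine this.congr (Eventually.of_forall fun ω => ?_)
      simp
    have h2 : |(∫ ω in {ω | w < S ω}, U ω * φ (S ω) ∂P) -
        c * ∫ ω in {ω | w < S ω}, U ω * S ω ^ q ∂P| ≤
        η / (2 * L) * ∫ ω in {ω | w < S ω}, U ω * S ω ^ q ∂P := by
      rw [← integral_const_mul, ← integral_const_mul,
        ← integral_sub hφI (hUSI.integrableOn.const_mul c), ← Real.norm_eq_abs]
      exact norm_integral_le_of_norm_le hbI hpt
    rw [Real.dist_eq, sub_zero]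
    have hden : 0 < w ^ q * tail P S w := by positivity
    calc _ = |(∫ ω in {ω | w < S ω}, U ω * φ (S ω) ∂P) -
          c * ∫ ω in {ω | w < S ω}, U ω * S ω ^ q ∂P| / (w ^ q * tail P S w) := by
          simp only [hD]
          rw [← mul_div_assoc, ← sub_div, abs_div, abs_of_pos hden]
      _ ≤ (η / (2 * L) * ∫ ω in {ω | w < S ω}, U ω * S ω ^ q ∂P) / (w ^ q * tail P S w) := by
          gcongr
      _ = η / (2 * L) * D w := by simp only [hD]; ring
      _ ≤ η / (2 * L) * L := by gcongr
      _ = η / 2 := by field_simp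
      _ < η := half_lt_self hη
  have := hdiff.add (hmain.const_mul c)
  rw [zero_add] at this
  exact this.congr fun w => by ring

/-- Atoms are asymptotically negligible: for `s < 1` the closed tail at `w` is at most the open tail
at `s * w`, and `s ^ (-α)` is close to `1` for `s` near `1`. -/
lemma tendsto_closedTail_div (hT : IsRVTail (tail P S) α) :
    Tendsto (fun w => P.real {ω | w ≤ S ω} / tail P S w) atTop (𝓝 1) := by
  refine tendsto_order.2 ⟨fun b hb => Eventually.of_forall fun w => hb.trans_le ?_,
    fun b hb => ?_⟩
  · rw [one_le_div (hT.pos w)]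
    exact measureReal_mono fun ω (hω : w < S ω) => le_of_lt hω
  · have hc : ContinuousAt (fun s : ℝ => s ^ (-α)) 1 :=
      Real.continuousAt_rpow_const _ _ (Or.inl one_ne_zero)
    obtain ⟨s, ⟨h1, h2⟩, h3⟩ := ((((hc.eventually_lt_const (by simpa using hb)).and
      (lt_mem_nhds one_pos)).filter_mono nhdsWithin_le_nhds).and
      (self_mem_nhdsWithin : Set.Iio (1 : ℝ) ∈ 𝓝[<] 1)).exists
    filter_upwards [(hT.tendsto s h2).eventually_lt_const h1, eventually_gt_atTop 0] with w hw hw0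
    refine lt_of_le_of_lt (div_le_div_of_nonneg_right ?_ (hT.nonneg w)) hw
    have h3' : s < 1 := h3
    refine measureReal_mono fun ω (hω : w ≤ S ω) => lt_of_lt_of_le ?_ hω
    nlinarith

end Karamata

end TailRisk

/-! ### Growth and inversion of the loss; quantiles -/

namespace TailRisk

namespace LossGrowth

variable {ℓ : ℝ → ℝ} {c₁ ρ : ℝ}

lemma tendsto_deriv_div (h : LossGrowth ℓ c₁ ρ) :
    Tendsto (fun u => deriv ℓ u / u ^ ρ) atTop (𝓝 c₁) := by
  have hc := h.c₁_pos
  have h1 : Tendsto (deriv ℓ / fun u => c₁ * u ^ ρ) atTop (𝓝 1) :=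
    (isEquivalent_iff_tendsto_one (by
      filter_upwards [eventually_gt_atTop 0] with u hu
      positivity)).1 h.deriv_equiv
  have h2 := h1.const_mul c₁
  rw [mul_one] at h2
  refine h2.congr fun u => ?_
  simp only [Pi.div_apply]
  field_simp

lemma eventually_differentiableAt (h : LossGrowth ℓ c₁ ρ) :
    ∀ᶠ u in atTop, DifferentiableAt ℝ ℓ u := by
  obtain ⟨u₀, _, hu⟩ := h.differentiable
  filter_upwards [eventually_gt_atTop u₀] with u h using hu u h

/-- Beyond some point `ℓ` is differentiable with derivative of exact order `u ^ ρ`. -/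
lemma exists_regular (h : LossGrowth ℓ c₁ ρ) : ∃ u₁, 0 < u₁ ∧ ∀ u, u₁ ≤ u →
    DifferentiableAt ℝ ℓ u ∧ 0 < deriv ℓ u ∧ deriv ℓ u ≤ 2 * c₁ * u ^ ρ := by
  have hc := h.c₁_pos
  obtain ⟨u₁, hu₁⟩ := eventually_atTop.1 (h.eventually_differentiableAt.and
    ((h.tendsto_deriv_div.eventually_const_lt hc).and
      (h.tendsto_deriv_div.eventually_lt_const (show c₁ < 2 * c₁ by linarith))))
  refine ⟨max u₁ 1, by positivity, fun u hu => ?_⟩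
  obtain ⟨h1, h2, h3⟩ := hu₁ u ((le_max_left _ _).trans hu)
  have hu0 : 0 < u := lt_of_lt_of_le one_pos ((le_max_right _ _).trans hu)
  have hur : 0 < u ^ ρ := by positivity
  refine ⟨h1, ?_, ((div_lt_iff₀ hur).1 h3).le⟩
  have := mul_pos h2 hur
  rwa [div_mul_cancel₀ _ hur.ne'] at this

lemma rho_add_one_pos (h : LossGrowth ℓ c₁ ρ) : 0 < ρ + 1 := by linarith [h.ρ_nonneg]

/-- The relation for `ℓ'` is integrated by monotonicity. Beyond some point `ℓ u - b * u ^ (ρ + 1)`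
is monotone if `b * (ρ + 1) < c₁` and antitone if `b * (ρ + 1) > c₁`; the additive constants vanish
after division. -/
lemma tendsto_div_rpow (h : LossGrowth ℓ c₁ ρ) :
    Tendsto (fun u => ℓ u / u ^ (ρ + 1)) atTop (𝓝 (c₁ / (ρ + 1))) := by
  have hq := h.rho_add_one_pos
  have hρ := h.ρ_nonneg
  have hder : ∀ (b : ℝ) {u : ℝ}, 0 < u → DifferentiableAt ℝ ℓ u →
      HasDerivAt (fun u => ℓ u - b / (ρ + 1) * u ^ (ρ + 1)) (deriv ℓ u - b * u ^ ρ) u := by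
    intro b u hu hd
    have h1 := (Real.hasDerivAt_rpow_const (x := u) (p := ρ + 1) (Or.inl hu.ne')).const_mul
      (b / (ρ + 1))
    have e : b / (ρ + 1) * ((ρ + 1) * u ^ (ρ + 1 - 1)) = b * u ^ ρ := by
      rw [add_sub_cancel_right]
      field_simp
    rw [e] at h1
    exact hd.hasDerivAt.sub h1
  have hconst : ∀ C b : ℝ, Tendsto (fun u : ℝ => C / u ^ (ρ + 1) + b / (ρ + 1)) atTop
      (𝓝 (b / (ρ + 1))) := fun C b => by
    have h1 : Tendsto (fun u : ℝ => C / u ^ (ρ + 1)) atTop (𝓝 0) :=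
      (tendsto_rpow_atTop hq).const_div_atTop C
    simpa using h1.add_const (b / (ρ + 1))
  refine tendsto_order.2 ⟨fun m hm => ?_, fun m hm => ?_⟩
  · obtain ⟨b', hb1, hb2⟩ := exists_between hm
    have hb : b' * (ρ + 1) < c₁ := (lt_div_iff₀ hq).1 hb2
    obtain ⟨u₂, hu₂⟩ := eventually_atTop.1 (h.eventually_differentiableAt.and
      ((h.tendsto_deriv_div.eventually_const_lt hb).and (eventually_gt_atTop 0)))
    have hmono : MonotoneOn (fun u => ℓ u - b' * (ρ + 1) / (ρ + 1) * u ^ (ρ + 1)) (Set.Ici u₂) := by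
      refine monotoneOn_of_deriv_nonneg (convex_Ici u₂) ?_ ?_ ?_
      · exact fun u hu => (hder _ (hu₂ u hu).2.2 (hu₂ u hu).1).continuousAt.continuousWithinAt
      · intro u hu
        rw [interior_Ici] at hu
        have hu' := hu₂ u (le_of_lt hu)
        exact (hder _ hu'.2.2 hu'.1).differentiableAt.differentiableWithinAt
      · intro u hu
        rw [interior_Ici] at hu
        have hu' := hu₂ u (le_of_lt hu)
        rw [(hder _ hu'.2.2 hu'.1).deriv]
        have := (lt_div_iff₀ (Real.rpow_pos_of_pos hu'.2.2 ρ)).1 hu'.2.1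
        linarith
    have hlim := hconst (ℓ u₂ - b' * (ρ + 1) / (ρ + 1) * u₂ ^ (ρ + 1)) (b' * (ρ + 1))
    rw [mul_div_cancel_right₀ _ hq.ne'] at hlim hmono
    filter_upwards [hlim.eventually_const_lt hb1, eventually_ge_atTop u₂, eventually_gt_atTop 0]
      with u h1 h2 h3
    have h4 := hmono (Set.mem_Ici.2 le_rfl) h2 h2
    simp only at h4
    have hpw : 0 < u ^ (ρ + 1) := by positivity
    refine h1.trans_le ?_
    rw [le_div_iff₀ hpw, add_mul, div_mul_cancel₀ _ hpw.ne']
    linarith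
  · obtain ⟨b', hb1, hb2⟩ := exists_between hm
    have hb : c₁ < b' * (ρ + 1) := (div_lt_iff₀ hq).1 hb1
    obtain ⟨u₂, hu₂⟩ := eventually_atTop.1 (h.eventually_differentiableAt.and
      ((h.tendsto_deriv_div.eventually_lt_const hb).and (eventually_gt_atTop 0)))
    have hmono : AntitoneOn (fun u => ℓ u - b' * (ρ + 1) / (ρ + 1) * u ^ (ρ + 1)) (Set.Ici u₂) := by
      refine antitoneOn_of_deriv_nonpos (convex_Ici u₂) ?_ ?_ ?_
      · exact fun u hu => (hder _ (hu₂ u hu).2.2 (hu₂ u hu).1).continuousAt.continuousWithinAt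
      · intro u hu
        rw [interior_Ici] at hu
        have hu' := hu₂ u (le_of_lt hu)
        exact (hder _ hu'.2.2 hu'.1).differentiableAt.differentiableWithinAt
      · intro u hu
        rw [interior_Ici] at hu
        have hu' := hu₂ u (le_of_lt hu)
        rw [(hder _ hu'.2.2 hu'.1).deriv]
        have := (div_lt_iff₀ (Real.rpow_pos_of_pos hu'.2.2 ρ)).1 hu'.2.1
        linarith
    have hlim := hconst (ℓ u₂ - b' * (ρ + 1) / (ρ + 1) * u₂ ^ (ρ + 1)) (b' * (ρ + 1))
    rw [mul_div_cancel_right₀ _ hq.ne'] at hlim hmono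
    filter_upwards [hlim.eventually_lt_const hb2, eventually_ge_atTop u₂, eventually_gt_atTop 0]
      with u h1 h2 h3
    have h4 := hmono (Set.mem_Ici.2 le_rfl) h2 h2
    simp only at h4
    have hpw : 0 < u ^ (ρ + 1) := by positivity
    refine lt_of_le_of_lt ?_ h1
    rw [div_le_iff₀ hpw, add_mul, div_mul_cancel₀ _ hpw.ne']
    linarith

lemma tendsto_atTop (h : LossGrowth ℓ c₁ ρ) : Tendsto ℓ atTop atTop := by
  have h1 := h.tendsto_div_rpow.pos_mul_atTop (div_pos h.c₁_pos h.rho_add_one_pos)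
    (tendsto_rpow_atTop h.rho_add_one_pos)
  refine h1.congr' ?_
  filter_upwards [eventually_gt_atTop 0] with u hu
  rw [div_mul_cancel₀ _ (by positivity)]

/-- High level sets of `ℓ` in `[0, ∞)` are half-lines. -/
lemma exists_inverse (h : LossGrowth ℓ c₁ ρ) (u₂ : ℝ) : ∃ M, ∀ v, M < v → ∃ s, u₂ < s ∧ ℓ s = v ∧
    ∀ u, 0 ≤ u → ((v < ℓ u ↔ s < u) ∧ (v ≤ ℓ u ↔ s ≤ u)) := by
  obtain ⟨u₁, hu₁, hreg⟩ := h.exists_regular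
  set m := max u₁ u₂ with hm
  -- Values above `M` are not attained on `[0, m]`, and beyond `m` the loss is strictly increasing
  -- and continuous, so each such value has one preimage.
  obtain ⟨M, hM⟩ := h.bddAbove m
  have hm0 : 0 < m := hu₁.trans_le (le_max_left _ _)
  have hle : ∀ u, 0 ≤ u → u ≤ m → ℓ u ≤ M := fun u h0 h1 => hM ⟨u, ⟨h0, h1⟩, rfl⟩
  have hmono : StrictMonoOn ℓ (Set.Ici m) := by
    refine strictMonoOn_of_deriv_pos (convex_Ici m) ?_ ?_
    · exact fun u hu => (hreg u ((le_max_left _ _).trans hu)).1.continuousAt.continuousWithinAt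
    · intro u hu
      rw [interior_Ici] at hu
      exact (hreg u ((le_max_left _ _).trans (le_of_lt hu))).2.1
  refine ⟨M, fun v hv => ?_⟩
  obtain ⟨t, ht1, ht2⟩ := ((h.tendsto_atTop.eventually_gt_atTop v).and
    (eventually_ge_atTop m)).exists
  have hcont : ContinuousOn ℓ (Set.Icc m t) := fun u hu =>
    (hreg u ((le_max_left _ _).trans hu.1)).1.continuousAt.continuousWithinAt
  obtain ⟨s, hs, hsv⟩ := intermediate_value_Icc ht2 hcont
    ⟨(hle m hm0.le le_rfl).trans hv.le, ht1.le⟩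
  have hms : m < s := by
    refine lt_of_le_of_ne hs.1 fun h0 => ?_
    have := hle m hm0.le le_rfl
    rw [h0, hsv] at this
    linarith
  refine ⟨s, (le_max_right _ _).trans_lt hms, hsv, fun u hu => ?_⟩
  rcases le_total u m with h1 | h1
  · have h2 := hle u hu h1
    exact ⟨⟨fun h => by linarith, fun h => by linarith⟩, ⟨fun h => by linarith, fun h => by linarith⟩⟩
  · rw [← hsv]
    exact ⟨hmono.lt_iff_lt hms.le h1, hmono.le_iff_le hms.le h1⟩

/-- This transfers the second moment of the loss to `S ^ (ρ + 1)`. -/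
lemma exists_rpow_le (h : LossGrowth ℓ c₁ ρ) :
    ∃ A B : ℝ, 0 ≤ A ∧ ∀ u, 0 ≤ u → u ^ (ρ + 1) ≤ A * ℓ u + B := by
  have hq := h.rho_add_one_pos
  have hc : 0 < c₁ / (ρ + 1) := div_pos h.c₁_pos hq
  obtain ⟨u₃, hu₃⟩ := eventually_atTop.1
    (h.tendsto_div_rpow.eventually_const_lt (half_lt_self hc))
  set b := c₁ / (ρ + 1) / 2 with hb
  have hb0 : 0 < b := half_pos hc
  refine ⟨b⁻¹, (max u₃ 1) ^ (ρ + 1), by positivity, fun u hu => ?_⟩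
  rcases le_total u (max u₃ 1) with h1 | h1
  · have := Real.rpow_le_rpow hu h1 hq.le
    have := mul_nonneg (inv_pos.2 hb0).le (h.nonneg u hu)
    linarith
  · have hu0 : 0 < u := lt_of_lt_of_le one_pos ((le_max_right _ _).trans h1)
    have h2 := (lt_div_iff₀ (by positivity)).1 (hu₃ u ((le_max_left _ _).trans h1))
    have h3 : u ^ (ρ + 1) ≤ b⁻¹ * ℓ u := by
      rw [inv_mul_eq_div, le_div_iff₀ hb0]; linarith
    have : 0 ≤ (max u₃ 1) ^ (ρ + 1) := by positivity
    linarith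

end LossGrowth

lemma CVaR_eq_of_ae {Ω : Type*} [MeasurableSpace Ω] {P : Measure Ω} {L : Ω → ℝ} {β : ℝ}
    {A : Set Ω} (hA : {ω | VaR P L β ≤ L ω} =ᵐ[P] A) :
    CVaR P L β = (P.real A)⁻¹ * ∫ ω in A, L ω ∂P := by
  rw [CVaR, ProbabilityTheory.cond, integral_smul_measure, Measure.restrict_congr_set hA,
    measure_congr hA, ENNReal.toReal_inv, smul_eq_mul]
  rfl

section Quantile

variable {Ω : Type*} [MeasurableSpace Ω] {P : Measure Ω} [IsProbabilityMeasure P]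

/-- Right continuity of the distribution function puts the infimum into the set, and continuity from
above of `P` gives the bound for the closed tail. The last clause forces the quantile above any
level that is exceeded with probability more than `β`. -/
lemma VaR_spec {L : Ω → ℝ} (hL : Measurable L) {β : ℝ} (hβ0 : 0 < β) (hβ1 : β < 1) :
    P.real {ω | VaR P L β < L ω} ≤ β ∧ β ≤ P.real {ω | VaR P L β ≤ L ω} ∧
      ∀ v, β < P.real {ω | v < L ω} → v < VaR P L β := by
  have : IsProbabilityMeasure (P.map L) := Measure.isProbabilityMeasure_map hL.aemeasurable
  have hcdf : ∀ x, cdf (P.map L) x = P.real {ω | L ω ≤ x} := fun x => by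
    rw [cdf_eq_real, measureReal_def, Measure.map_apply hL measurableSet_Iic]
    rfl
  have htail : ∀ x, P.real {ω | x < L ω} = 1 - cdf (P.map L) x := fun x => by
    rw [hcdf]; exact tail_eq_one_sub hL x
  set A := {u : ℝ | 1 - β ≤ P.real {ω | L ω ≤ u}} with hA
  have hmemA : ∀ u, u ∈ A ↔ 1 - β ≤ cdf (P.map L) u := fun u => by rw [hcdf]; rfl
  have hne : A.Nonempty := by
    obtain ⟨x, hx⟩ := ((tendsto_cdf_atTop (P.map L)).eventually_const_lt
      (show 1 - β < 1 by linarith)).exists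
    exact ⟨x, (hmemA x).2 hx.le⟩
  have hbdd : BddBelow A := by
    obtain ⟨x, hx⟩ := ((tendsto_cdf_atBot (P.map L)).eventually_lt_const
      (show 0 < 1 - β by linarith)).exists
    refine ⟨x, fun y hy => ?_⟩
    by_contra! hlt
    have := monotone_cdf (P.map L) hlt.le
    have := (hmemA y).1 hy
    linarith
  have hVA : 1 - β ≤ cdf (P.map L) (VaR P L β) := by
    have h1 : ContinuousWithinAt (cdf (P.map L)) (Set.Ioi (sInf A)) (sInf A) :=
      ((cdf (P.map L)).right_continuous (sInf A)).mono Set.Ioi_subset_Ici_self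
    refine ge_of_tendsto h1 ?_
    filter_upwards [self_mem_nhdsWithin] with x hx
    obtain ⟨y, hy, hyx⟩ := exists_lt_of_csInf_lt hne hx
    exact ((hmemA y).1 hy).trans (monotone_cdf _ hyx.le)
  have hlt : ∀ u, u < VaR P L β → β < P.real {ω | u < L ω} := fun u hu => by
    have h1 := notMem_of_lt_csInf hu hbdd
    rw [hmemA, not_le] at h1
    rw [htail]; linarith
  refine ⟨by rw [htail]; linarith, ?_, fun v hv => ?_⟩
  · have h1 : Tendsto (fun n : ℕ => P {ω | VaR P L β - 1 / ((n : ℝ) + 1) < L ω}) atTop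
        (𝓝 (P (⋂ n : ℕ, {ω | VaR P L β - 1 / ((n : ℝ) + 1) < L ω}))) := by
      refine tendsto_measure_iInter_atTop
        (fun i => (measurableSet_lt measurable_const hL).nullMeasurableSet) ?_
        ⟨0, measure_ne_top _ _⟩
      intro m n hmn ω (hω : VaR P L β - 1 / ((n : ℝ) + 1) < L ω)
      refine lt_of_le_of_lt ?_ hω
      have : 1 / ((n : ℝ) + 1) ≤ 1 / ((m : ℝ) + 1) := Nat.one_div_le_one_div hmn
      linarith
    have h2 : (⋂ n : ℕ, {ω | VaR P L β - 1 / ((n : ℝ) + 1) < L ω}) = {ω | VaR P L β ≤ L ω} := by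
      ext ω
      simp only [Set.mem_iInter, Set.mem_ofPred_eq]
      constructor
      · intro h
        refine le_of_forall_pos_lt_add fun ε hε => ?_
        obtain ⟨n, hn⟩ := exists_nat_one_div_lt hε
        linarith [h n]
      · intro h n
        have : 0 < 1 / ((n : ℝ) + 1) := Nat.one_div_pos_of_nat
        linarith
    rw [h2] at h1
    have h3 := (ENNReal.tendsto_toReal (measure_ne_top _ _)).comp h1
    refine ge_of_tendsto' h3 fun n => ?_
    exact (hlt _ (sub_lt_self _ Nat.one_div_pos_of_nat)).le
  · by_contra! hcon
    have := monotone_cdf (P.map L) hcon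
    rw [htail] at hv
    linarith

/-- For small `β` the conditional value at risk of `ℓ(S)` is a conditional expectation given
`S ≥ w` for a high threshold `w`. -/
lemma LossGrowth.exists_threshold {ℓ : ℝ → ℝ} {c₁ ρ : ℝ} (h : LossGrowth ℓ c₁ ρ) (u₂ : ℝ) :
    ∃ s₁, ∀ S : Ω → ℝ, Measurable S → (∀ᵐ ω ∂P, 0 ≤ S ω) → ∀ β, 0 < β → β < tail P S s₁ →
      ∃ w, u₂ < w ∧ tail P S w ≤ β ∧ β ≤ P.real {ω | w ≤ S ω} ∧
        (∀ u, 0 ≤ u → (ℓ w ≤ ℓ u ↔ w ≤ u)) ∧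
        CVaR P (fun ω => ℓ (S ω)) β =
          (P.real {ω | w ≤ S ω})⁻¹ * ∫ ω in {ω | w ≤ S ω}, ℓ (S ω) ∂P := by
  obtain ⟨M, hM⟩ := h.exists_inverse u₂
  -- For `β` below the tail at `s₁` the quantile of the loss exceeds `M + 1`, hence lies where `ℓ`
  -- can be inverted. The choice of `s₁` precedes that of `S`, so it serves all `θ'` near `θ` at
  -- once.
  obtain ⟨s₁, _, _, hs₁⟩ := hM (M + 1) (by linarith)
  refine ⟨s₁, fun S hS hS0 β hβ hβs => ?_⟩
  have hβ1 : β < 1 := hβs.trans_le measureReal_le_one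
  obtain ⟨h1, h2, h3⟩ := VaR_spec (P := P) (h.measurable.comp hS) hβ hβ1
  have hcomp : (ℓ ∘ S) = fun ω => ℓ (S ω) := rfl
  rw [hcomp] at h1 h2 h3
  have hVM : M + 1 < VaR P (fun ω => ℓ (S ω)) β := by
    refine h3 _ (hβs.trans_eq ?_)
    refine measureReal_congr ?_
    filter_upwards [hS0] with ω hω
    exact propext (hs₁ (S ω) hω).1.symm
  obtain ⟨w, hw1, hw2, hw3⟩ := hM (VaR P (fun ω => ℓ (S ω)) β) (by linarith)
  have hge : {ω | VaR P (fun ω => ℓ (S ω)) β ≤ ℓ (S ω)} =ᵐ[P] {ω | w ≤ S ω} := by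
    filter_upwards [hS0] with ω hω
    exact propext (hw3 (S ω) hω).2
  have hgt : {ω | VaR P (fun ω => ℓ (S ω)) β < ℓ (S ω)} =ᵐ[P] {ω | w < S ω} := by
    filter_upwards [hS0] with ω hω
    exact propext (hw3 (S ω) hω).1
  refine ⟨w, hw1, ?_, ?_, fun u hu => ?_, CVaR_eq_of_ae hge⟩
  · rwa [tail, ← measureReal_congr hgt]
  · rwa [← measureReal_congr hge]
  · rw [hw2]; exact (hw3 u hu).2

end Quantile

end TailRisk

/-! ### Moments, extrapolation in the level, asymptotics of the conditional expectation -/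

namespace TailRisk

section Moments

variable {Ω : Type*} [MeasurableSpace Ω] {P : Measure Ω} [IsProbabilityMeasure P]
  {S : Ω → ℝ} {ℓ : ℝ → ℝ} {c₁ ρ α : ℝ}

lemma LossGrowth.memLp_rpow (h : LossGrowth ℓ c₁ ρ) (hS : Measurable S)
    (hS0 : ∀ᵐ ω ∂P, 0 ≤ S ω) (hvar : MemLp (fun ω => ℓ (S ω)) 2 P) :
    MemLp (fun ω => S ω ^ (ρ + 1)) 2 P := by
  obtain ⟨A, B, hA, hAB⟩ := h.exists_rpow_le
  have h1 : MemLp (fun ω => A * ℓ (S ω) + B) 2 P := (hvar.const_mul A).add (memLp_const B)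
  refine h1.mono (hS.pow_const _).aestronglyMeasurable ?_
  filter_upwards [hS0] with ω hω
  rw [Real.norm_eq_abs, Real.norm_eq_abs, abs_of_nonneg (Real.rpow_nonneg hω _)]
  exact (hAB _ hω).trans (le_abs_self _)

/-- Finite variance forces a large tail index. -/
lemma LossGrowth.lt_index (h : LossGrowth ℓ c₁ ρ) (hS : Measurable S)
    (hS0 : ∀ᵐ ω ∂P, 0 ≤ S ω) (hvar : MemLp (fun ω => ℓ (S ω)) 2 P)
    (hT : IsRVTail (tail P S) α) : ρ + 1 < α := by
  have hq := h.rho_add_one_pos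
  have hI := (h.memLp_rpow hS hS0 hvar).integrable_sq
  -- Markov's inequality for the square of `S ^ (ρ + 1)` bounds `u ^ (2 * (ρ + 1)) * P(S > u)`.
  have hle : 2 * (ρ + 1) ≤ α := by
    refine hT.le_of_moment (M := ∫ ω, (S ω ^ (ρ + 1)) ^ 2 ∂P) ?_
    filter_upwards [eventually_gt_atTop 0] with u hu
    have h1 := mul_meas_ge_le_integral_of_nonneg (μ := P) (f := fun ω => (S ω ^ (ρ + 1)) ^ 2)
      (Eventually.of_forall fun ω => sq_nonneg _) hI (u ^ (2 * (ρ + 1)))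
    refine le_trans ?_ h1
    gcongr
    refine measureReal_mono fun ω (hω : u < S ω) => ?_
    change u ^ (2 * (ρ + 1)) ≤ (S ω ^ (ρ + 1)) ^ 2
    rw [mul_comm, Real.rpow_mul hu.le, Real.rpow_two]
    gcongr
  linarith

end Moments

/-- Quantities of exact order `w b ^ q`, for thresholds `w b` with exceedance probability
asymptotic to `b`, extrapolate as a power of the ratio of the levels. -/
lemma isEquivalent_of_threshold {V : Type*} [NormedAddCommGroup V] [NormedSpace ℝ V]
    {T : ℝ → ℝ} {α q : ℝ} (hT : IsRVTail T α) {w : ℝ → ℝ} {f : ℝ → V} {A : V}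
    (hw : Tendsto w (𝓝[>] 0) atTop) (hTw : Tendsto (fun b => T (w b) / b) (𝓝[>] 0) (𝓝 1))
    (hf : Tendsto (fun b => (w b ^ q)⁻¹ • f b) (𝓝[>] 0) (𝓝 A)) (hA : A ≠ 0)
    {ι : Type*} {l : Filter ι} {β β₀ : ι → ℝ} {c : ℝ} (hc : 1 < c) (hβ : Tendsto β l (𝓝[>] 0))
    (hβ₀ : Tendsto (fun i => β₀ i / β i) l (𝓝 c)) :
    (fun i => f (β i)) ~[l] fun i => (β₀ i / β i) ^ (1 / α * q) • f (β₀ i) := by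
  have hα := hT.index_pos
  have hc0 : 0 < c := by linarith
  have hβpos : ∀ᶠ i in l, 0 < β i := (tendsto_nhdsWithin_iff.1 hβ).2
  have hβ₀lim : Tendsto β₀ l (𝓝[>] 0) := by
    refine tendsto_nhdsWithin_iff.2 ⟨?_, ?_⟩
    · have h1 := hβ₀.mul (tendsto_nhdsWithin_iff.1 hβ).1
      rw [mul_zero] at h1
      refine h1.congr' ?_
      filter_upwards [hβpos] with i hi
      rw [div_mul_cancel₀ _ hi.ne']
    · filter_upwards [hβpos, hβ₀.eventually_const_lt hc0] with i h1 h2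
      have := mul_pos h2 h1
      rwa [div_mul_cancel₀ _ h1.ne'] at this
  have hβ₀pos : ∀ᶠ i in l, 0 < β₀ i := (tendsto_nhdsWithin_iff.1 hβ₀lim).2
  -- The exceedance probabilities are asymptotic to the levels, so their ratio tends to `c⁻¹`;
  -- inversion of `T` then gives `w (β i) / w (β₀ i) → c ^ (1 / α)`.
  have hratT : Tendsto (fun i => T (w (β i)) / T (w (β₀ i))) l (𝓝 c⁻¹) := by
    have h1 := ((hTw.comp hβ).div (hTw.comp hβ₀lim) one_ne_zero).mul (hβ₀.inv₀ hc0.ne')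
    rw [div_one, one_mul] at h1
    refine h1.congr' ?_
    filter_upwards [hβpos, hβ₀pos] with i h1 h2
    have := (hT.pos (w (β₀ i))).ne'
    simp only [Pi.div_apply, Function.comp]
    field_simp
  have hratw := hT.tendsto_arg_div (hw.comp hβ₀lim) (inv_pos.2 hc0) hratT
  have hwpos : ∀ᶠ i in l, 0 < w (β i) := (hw.comp hβ).eventually_gt_atTop 0
  have hw₀pos : ∀ᶠ i in l, 0 < w (β₀ i) := (hw.comp hβ₀lim).eventually_gt_atTop 0
  -- The factor `r` compares the extrapolation factor with the ratio of thresholds and tends to `1`.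
  -- The two sides, both divided by `w (β i) ^ q`, therefore have the same limit `A`, and `A ≠ 0`
  -- turns the vanishing difference into a relative error.
  set r : ι → ℝ := fun i => (β₀ i / β i) ^ (1 / α * q) * (w (β₀ i) ^ q / w (β i) ^ q) with hr
  have hr1 : Tendsto r l (𝓝 1) := by
    have h1 : Tendsto (fun i => (β₀ i / β i) ^ (1 / α * q)) l (𝓝 (c ^ (1 / α * q))) :=
      hβ₀.rpow_const (Or.inl hc0.ne')
    have hne : (c⁻¹) ^ (-α⁻¹) ≠ 0 := by positivity
    have h2 := (hratw.rpow_const (p := q) (Or.inl hne)).inv₀ (by positivity)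
    have e : c ^ (1 / α * q) * (((c⁻¹) ^ (-α⁻¹)) ^ q)⁻¹ = 1 := by
      rw [← Real.rpow_mul (by positivity), Real.inv_rpow hc0.le, inv_inv, ← Real.rpow_add hc0]
      rw [show 1 / α * q + -α⁻¹ * q = 0 by ring, Real.rpow_zero]
    have h3 := h1.mul h2
    rw [e] at h3
    refine h3.congr' ?_
    filter_upwards [hwpos, hw₀pos] with i h4 h5
    simp only [hr, Function.comp]
    rw [Real.div_rpow h4.le h5.le, inv_div]
  have hg := hf.comp hβ
  have hh := hr1.smul (hf.comp hβ₀lim)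
  rw [one_smul] at hh
  have hdiff := (hg.sub hh).norm
  rw [sub_self, norm_zero] at hdiff
  have hA0 : 0 < ‖A‖ := norm_pos_iff.2 hA
  refine isLittleO_iff.2 fun ε hε => ?_
  filter_upwards [hdiff.eventually_lt_const (show 0 < ε * (‖A‖ / 2) by positivity),
    hh.norm.eventually_const_lt (half_lt_self hA0), hwpos, hw₀pos] with i h1 h2 h3 h4
  have hwq : 0 < w (β i) ^ q := by positivity
  have hwq₀ : 0 < w (β₀ i) ^ q := by positivity
  have e1 : r i • (w (β₀ i) ^ q)⁻¹ • f (β₀ i) =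
      (w (β i) ^ q)⁻¹ • (β₀ i / β i) ^ (1 / α * q) • f (β₀ i) := by
    simp only [hr, smul_smul]
    congr 1
    field_simp
  simp only [Function.comp] at h1 h2
  rw [e1] at h1 h2
  rw [← smul_sub, norm_smul, norm_inv, Real.norm_eq_abs, abs_of_pos hwq, inv_mul_eq_div] at h1
  rw [norm_smul, norm_inv, Real.norm_eq_abs, abs_of_pos hwq, inv_mul_eq_div] at h2
  have h5 : ε * (‖A‖ / 2) ≤ ε * (‖(β₀ i / β i) ^ (1 / α * q) • f (β₀ i)‖ / w (β i) ^ q) := by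
    gcongr
  have h6 := h1.le.trans h5
  rw [← mul_div_assoc, div_le_div_iff_of_pos_right hwq] at h6
  exact h6

section PartOne

variable {Ω : Type*} [MeasurableSpace Ω] {P : Measure Ω} [IsProbabilityMeasure P]
  {S : Ω → ℝ} {ℓ : ℝ → ℝ} {c₁ ρ α : ℝ}

/-- Thresholds with exceedance probability of order `b` tend to infinity, and the exceedance
probability is asymptotic to `b`. -/
lemma tendsto_threshold (hT : IsRVTail (tail P S) α) {w : ℝ → ℝ}
    (hw : ∀ᶠ b in 𝓝[>] (0 : ℝ), tail P S (w b) ≤ b ∧ b ≤ P.real {ω | w b ≤ S ω}) :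
    Tendsto w (𝓝[>] 0) atTop ∧ Tendsto (fun b => tail P S (w b) / b) (𝓝[>] 0) (𝓝 1) := by
  have hid : Tendsto (fun b : ℝ => b) (𝓝[>] 0) (𝓝 0) := tendsto_id.mono_left nhdsWithin_le_nhds
  have hwlim : Tendsto w (𝓝[>] 0) atTop := by
    refine tendsto_atTop.2 fun t => ?_
    filter_upwards [hw, hid.eventually_lt_const (hT.pos t)] with b h1 h2
    by_contra! hcon
    linarith [hT.anti hcon.le, h1.1]
  refine ⟨hwlim, ?_⟩
  have h1 := ((tendsto_closedTail_div hT).comp hwlim).inv₀ one_ne_zero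
  rw [inv_one] at h1
  refine tendsto_of_tendsto_of_tendsto_of_le_of_le' h1 tendsto_const_nhds ?_ ?_
  · filter_upwards [hw, self_mem_nhdsWithin] with b hb hb0
    have hb0' : (0 : ℝ) < b := hb0
    simp only [Function.comp, inv_div]
    exact div_le_div_of_nonneg_left (hT.nonneg _) hb0' hb.2
  · filter_upwards [hw, self_mem_nhdsWithin] with b hb hb0
    exact (div_le_one hb0).2 hb.1

/-- Karamata's theorem treats the open event `S > w`. The atom at `w` adds `ℓ w * P(S = w)`, which
is negligible since the open and closed tails are equivalent. -/
lemma LossGrowth.tendsto_conditional (h : LossGrowth ℓ c₁ ρ) (hS : Measurable S)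
    (hS0 : ∀ᵐ ω ∂P, 0 ≤ S ω) (hvar : MemLp (fun ω => ℓ (S ω)) 2 P)
    (hT : IsRVTail (tail P S) α) :
    Tendsto (fun w => (w ^ (ρ + 1))⁻¹ *
      ((P.real {ω | w ≤ S ω})⁻¹ * ∫ ω in {ω | w ≤ S ω}, ℓ (S ω) ∂P)) atTop
      (𝓝 (c₁ / (ρ + 1) * karamataConst (ρ + 1) α)) := by
  have hq := h.rho_add_one_pos
  have hqα := h.lt_index hS hS0 hvar hT
  have hI : Integrable (fun ω => S ω ^ (ρ + 1)) P :=
    (h.memLp_rpow hS hS0 hvar).integrable (by norm_num)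
  have hℓI : Integrable (fun ω => ℓ (S ω)) P := hvar.integrable (by norm_num)
  have h1 := tendsto_truncated_expectation (P := P) (U := fun _ => 1) (M := 1) (p := 1) hS
    measurable_const (by simp) (by simp) hT hq hqα (by
      refine tendsto_const_nhds.congr fun t => ?_
      rw [weightedTail_one, div_self (hT.pos t).ne']) hI h.measurable h.tendsto_div_rpow
  simp only [one_mul] at h1
  have h2 := tendsto_closedTail_div hT
  have h3 := h.tendsto_div_rpow.mul (h2.sub_const 1)
  rw [sub_self, mul_zero] at h3
  have h4 := (h1.add h3).div h2 one_ne_zero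
  rw [add_zero, div_one] at h4
  refine h4.congr' ?_
  filter_upwards [eventually_gt_atTop 0] with w hw
  have hTw := hT.pos w
  have hge : 0 < P.real {ω | w ≤ S ω} :=
    hTw.trans_le (measureReal_mono fun ω (hω : w < S ω) => le_of_lt hω)
  have hwq : 0 < w ^ (ρ + 1) := by positivity
  have hm : MeasurableSet {ω | w < S ω} := measurableSet_lt measurable_const hS
  have hm' : MeasurableSet {ω | S ω = w} := measurableSet_eq_fun hS measurable_const
  have hun : {ω | w ≤ S ω} = {ω | w < S ω} ∪ {ω | S ω = w} := by
    ext ω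
    simp only [Set.mem_ofPred_eq, Set.mem_union]
    rw [le_iff_lt_or_eq, eq_comm (a := w)]
  have hdis : Disjoint {ω | w < S ω} {ω | S ω = w} :=
    Set.disjoint_left.2 fun ω (h1 : w < S ω) (h2 : S ω = w) => h1.ne' h2
  have hP : P.real {ω | w ≤ S ω} = tail P S w + P.real {ω | S ω = w} := by
    rw [hun, measureReal_union hdis hm']; rfl
  have hgrad : ∫ ω in {ω | w ≤ S ω}, ℓ (S ω) ∂P =
      (∫ ω in {ω | w < S ω}, ℓ (S ω) ∂P) + ℓ w * P.real {ω | S ω = w} := by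
    rw [hun, setIntegral_union hdis hm' hℓI.integrableOn hℓI.integrableOn]
    congr 1
    rw [setIntegral_congr_fun (g := fun _ => ℓ w) hm' fun ω (hω : S ω = w) => by
      simp only [hω], setIntegral_const, smul_eq_mul, mul_comm]
  have hP' : P.real {ω | S ω = w} = P.real {ω | w ≤ S ω} - tail P S w := by linarith
  rw [hgrad, hP']
  simp only [Pi.div_apply]
  field_simp

end PartOne

end TailRisk

/-! ### An envelope theorem for integrals over upper level sets -/

namespace TailRisk

section Envelope

variable {Ω : Type*} [MeasurableSpace Ω] {P : Measure Ω}

/-- A random vector with a density charges no hyperplane. -/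
lemma measure_inner_eq_zero {d : ℕ} {X : Ω → EuclideanSpace ℝ (Fin d)} (hpdf : HasPDF X P)
    (hX : Measurable X) {θ : EuclideanSpace ℝ (Fin d)} (hθ : θ ≠ 0) (w : ℝ) :
    P {ω | inner ℝ θ (X ω) = w} = 0 := by
  have hm : MeasurableSet {x : EuclideanSpace ℝ (Fin d) | inner ℝ θ x = w} :=
    measurableSet_eq_fun (by fun_prop) measurable_const
  have hac : P.map X ≪ volume := HasPDF.absolutelyContinuous
  have hvol : volume {x : EuclideanSpace ℝ (Fin d) | inner ℝ θ x = w} = 0 := by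
    by_cases hne : ∃ x₀ : EuclideanSpace ℝ (Fin d), inner ℝ θ x₀ = w
    · obtain ⟨x₀, hx₀⟩ := hne
      have hker : volume ((LinearMap.ker (innerSL ℝ θ).toLinearMap :
          Submodule ℝ (EuclideanSpace ℝ (Fin d))) : Set (EuclideanSpace ℝ (Fin d))) = 0 := by
        refine Measure.addHaar_submodule _ _ fun htop => hθ ?_
        have : θ ∈ LinearMap.ker (innerSL ℝ θ).toLinearMap := htop ▸ Submodule.mem_top
        simpa using this
      rw [← measure_preimage_add_right volume (-x₀)] at hker
      refine measure_mono_null (fun x (hx : inner ℝ θ x = w) => ?_) hker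
      simp [inner_sub_right, hx, hx₀, ← sub_eq_add_neg]
    · have : {x : EuclideanSpace ℝ (Fin d) | inner ℝ θ x = w} = ∅ :=
        Set.eq_empty_of_forall_notMem fun x hx => hne ⟨x, hx⟩
      rw [this, measure_empty]
  have := hac hvol
  rwa [Measure.map_apply hX hm] at this

/-- Among the events of a given probability, upper level sets maximise the integral. -/
lemma setIntegral_le_of_levelSet [IsFiniteMeasure P] {L : Ω → ℝ} (hL : Integrable L P)
    {A B : Set Ω} (hA : MeasurableSet A) (hB : MeasurableSet B) (hAB : P.real A = P.real B) {v : ℝ}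
    (hv : ∀ᵐ ω ∂P, (ω ∈ B → v ≤ L ω) ∧ (ω ∉ B → L ω ≤ v)) :
    ∫ ω in A, L ω ∂P ≤ ∫ ω in B, L ω ∂P := by
  have hI : Integrable (fun ω => L ω - v) P := hL.sub (integrable_const v)
  have key : ∫ ω in A, (L ω - v) ∂P ≤ ∫ ω in B, (L ω - v) ∂P := by
    rw [← integral_indicator hA, ← integral_indicator hB]
    refine integral_mono_ae (hI.indicator hA) (hI.indicator hB) ?_
    filter_upwards [hv] with ω hω
    by_cases h1 : ω ∈ A <;> by_cases h2 : ω ∈ B <;> simp [h1, h2, hω]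
  rw [integral_sub hL.integrableOn (integrable_const v).integrableOn,
    integral_sub hL.integrableOn (integrable_const v).integrableOn, setIntegral_const,
    setIntegral_const, hAB] at key
  linarith

lemma setIntegral_sub_setIntegral {f : Ω → ℝ} (hf : Integrable f P) {A B : Set Ω}
    (hA : MeasurableSet A) (hB : MeasurableSet B) :
    ∫ ω in A, f ω ∂P - ∫ ω in B, f ω ∂P = ∫ ω in A \ B, f ω ∂P - ∫ ω in B \ A, f ω ∂P := by
  rw [← integral_inter_add_sdiff hB (hf.integrableOn (s := A)),
    ← integral_inter_add_sdiff hA (hf.integrableOn (s := B)), Set.inter_comm B A]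
  ring

lemma measure_sdiff_comm_of_measureReal_eq [IsFiniteMeasure P] {A B : Set Ω}
    (hA : MeasurableSet A) (hB : MeasurableSet B) (h : P.real A = P.real B) :
    P (A \ B) = P (B \ A) := by
  refine measure_sdiff_symm hA.nullMeasurableSet hB.nullMeasurableSet ?_ (measure_ne_top _ _)
  exact (ENNReal.toReal_eq_toReal_iff' (measure_ne_top _ _) (measure_ne_top _ _)).1 h

/-- An envelope theorem: when the events `A θ'` are upper level sets of `L θ'` of the same
probability, the variation of the event does not contribute to the derivative of
`θ' ↦ ∫ ω in A θ', L θ' ω`. -/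
lemma hasFDerivAt_setIntegral_levelSet [IsFiniteMeasure P] {E : Type*} [NormedAddCommGroup E]
    [NormedSpace ℝ E] {L : E → Ω → ℝ} {A : E → Set Ω} {N : Set E} {θ : E} {v : E → ℝ} {G : Ω → ℝ}
    {D : E →L[ℝ] ℝ} (hN : N ∈ 𝓝 θ) (hL : ∀ θ' ∈ N, Integrable (L θ') P)
    (hA : ∀ θ' ∈ N, MeasurableSet (A θ')) (hAP : ∀ θ' ∈ N, P.real (A θ') = P.real (A θ))
    (hv : ∀ θ' ∈ N, ∀ᵐ ω ∂P, (ω ∈ A θ' → v θ' ≤ L θ' ω) ∧ (ω ∉ A θ' → L θ' ω ≤ v θ'))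
    (hG : Integrable G P)
    (hLG : ∀ θ' ∈ N, ∀ᵐ ω ∂P, ω ∈ A θ ∪ A θ' → |L θ' ω - L θ ω| ≤ ‖θ' - θ‖ * G ω)
    (hlim : Tendsto (fun θ' => P (A θ \ A θ')) (𝓝 θ) (𝓝 0))
    (hD : HasFDerivAt (fun θ' => ∫ ω in A θ, L θ' ω ∂P) D θ) :
    HasFDerivAt (fun θ' => ∫ ω in A θ', L θ' ω ∂P) D θ := by
  have hθ : θ ∈ N := mem_of_mem_nhds hN
  have hlim' : Tendsto (fun θ' => P (A θ' \ A θ)) (𝓝 θ) (𝓝 0) := by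
    refine hlim.congr' ?_
    filter_upwards [hN] with θ' hθ'
    exact measure_sdiff_comm_of_measureReal_eq (hA θ hθ) (hA θ' hθ') (hAP θ' hθ').symm
  have hR : HasFDerivAt (fun θ' => ∫ ω in A θ', L θ' ω ∂P - ∫ ω in A θ, L θ' ω ∂P)
      (0 : E →L[ℝ] ℝ) θ := by
    rw [hasFDerivAt_iff_isLittleO]
    have hε := (hG.tendsto_setIntegral_nhds_zero hlim').add (hG.tendsto_setIntegral_nhds_zero hlim)
    rw [add_zero] at hε
    have hε' := (isLittleO_one_iff ℝ).2 hε
    have h1 := hε'.mul_isBigO (isBigO_refl (fun θ' => ‖θ' - θ‖) (𝓝 θ))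
    simp only [one_mul] at h1
    refine (IsBigO.of_bound 1 ?_).trans_isLittleO h1.of_norm_right
    filter_upwards [hN] with θ' hθ'
    have hA' := hA θ' hθ'
    -- Optimality of `A θ'` for `L θ'` makes the remainder nonnegative. Optimality of `A θ` for `L
    -- θ` bounds it by the integral of `L θ' - L θ` over `A θ' \ A θ` minus that over `A θ \ A θ'`,
    -- which is `o(‖θ' - θ‖)`.
    have hopt := setIntegral_le_of_levelSet (hL θ' hθ') (hA θ hθ) hA' (hAP θ' hθ').symm (hv θ' hθ')
    have hopt' := setIntegral_le_of_levelSet (hL θ hθ) hA' (hA θ hθ) (hAP θ' hθ') (hv θ hθ)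
    have hsub : Integrable (fun ω => L θ' ω - L θ ω) P := (hL θ' hθ').sub (hL θ hθ)
    have hdiff := setIntegral_sub_setIntegral hsub hA' (hA θ hθ)
    rw [integral_sub (hL θ' hθ').integrableOn (hL θ hθ).integrableOn,
      integral_sub (hL θ' hθ').integrableOn (hL θ hθ).integrableOn] at hdiff
    have hbound : ∀ C : Set Ω, MeasurableSet C → C ⊆ A θ ∪ A θ' →
        |∫ ω in C, (L θ' ω - L θ ω) ∂P| ≤ ‖θ' - θ‖ * ∫ ω in C, G ω ∂P := by
      intro C hC hCA
      rw [← integral_const_mul]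
      refine (abs_integral_le_integral_abs).trans
        (integral_mono_ae hsub.abs.integrableOn (hG.const_mul _).integrableOn ?_)
      filter_upwards [ae_restrict_of_ae (hLG θ' hθ'), ae_restrict_mem hC] with ω h2 h3
      exact h2 (hCA h3)
    have hb1 := hbound (A θ' \ A θ) (MeasurableSet.diff hA' (hA θ hθ)) fun ω hω => Or.inr hω.1
    have hb2 := hbound (A θ \ A θ') (MeasurableSet.diff (hA θ hθ) hA') fun ω hω => Or.inl hω.1
    have hb1' := abs_le.1 hb1
    have hb2' := abs_le.1 hb2
    simp only [sub_self, sub_zero, _root_.zero_apply, Real.norm_eq_abs, one_mul]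
    rw [abs_of_nonneg (by linarith)]
    refine le_trans ?_ (le_abs_self _)
    linarith
  have hsum := hR.add hD
  rw [zero_add] at hsum
  refine hsum.congr_of_eventuallyEq (Eventually.of_forall fun θ' => ?_)
  simp

/-- Upper level sets of equal probability of two random variables `S`, `S'` differ by no more than
the level sets at the same level. -/
lemma measure_sdiff_levelSet_le [IsFiniteMeasure P] {S S' : Ω → ℝ} (hS : Measurable S)
    (hS' : Measurable S') {w w' : ℝ} (h : P.real {ω | w ≤ S ω} = P.real {ω | w' ≤ S' ω}) :
    P ({ω | w ≤ S ω} \ {ω | w' ≤ S' ω}) ≤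
      P {ω | w ≤ S ω ∧ S' ω < w} + P {ω | S ω < w ∧ w ≤ S' ω} := by
  have hm : MeasurableSet {ω | w ≤ S ω} := measurableSet_le measurable_const hS
  have hm' : MeasurableSet {ω | w' ≤ S' ω} := measurableSet_le measurable_const hS'
  rcases le_or_gt w' w with hw | hw
  · refine le_add_right (measure_mono ?_)
    rintro ω ⟨h1, h2⟩
    exact ⟨h1, (not_le.1 h2).trans_le hw⟩
  · have heq : P ({ω | w ≤ S ω} \ {ω | w' ≤ S' ω}) = P ({ω | w' ≤ S' ω} \ {ω | w ≤ S ω}) :=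
      measure_sdiff_comm_of_measureReal_eq hm hm' h
    rw [heq]
    refine le_add_left (measure_mono ?_)
    rintro ω ⟨h1, h2⟩
    exact ⟨not_le.1 h2, hw.le.trans h1⟩

/-- Equality of the probabilities reduces to level sets at the fixed level `w θ`, so no continuity
of `w` is needed. Almost surely `S θ ω ≠ w θ`, so `ω` eventually does not change sides. -/
lemma tendsto_measure_sdiff_levelSet [IsFiniteMeasure P] {E : Type*} [TopologicalSpace E]
    [FirstCountableTopology E]
    {S : E → Ω → ℝ} {θ : E} (hS : ∀ θ', Measurable (S θ')) {w : E → ℝ}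
    (hcont : ∀ ω, ContinuousAt (fun θ' => S θ' ω) θ) (hnull : P {ω | S θ ω = w θ} = 0)
    (hw : ∀ᶠ θ' in 𝓝 θ, P.real {ω | w θ' ≤ S θ' ω} = P.real {ω | w θ ≤ S θ ω}) :
    Tendsto (fun θ' => P ({ω | w θ ≤ S θ ω} \ {ω | w θ' ≤ S θ' ω})) (𝓝 θ) (𝓝 0) := by
  have hne : ∀ᵐ ω ∂P, S θ ω ≠ w θ := by
    rw [ae_iff]; simpa using hnull
  have h1 : Tendsto (fun θ' => P {ω | w θ ≤ S θ ω ∧ S θ' ω < w θ}) (𝓝 θ) (𝓝 (P ∅)) := by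
    refine tendsto_measure_of_ae_tendsto_indicator_of_isFiniteMeasure _ MeasurableSet.empty
      (fun θ' => (measurableSet_le measurable_const (hS θ)).inter
        (measurableSet_lt (hS θ') measurable_const)) ?_
    filter_upwards [hne] with ω hω
    rcases lt_or_gt_of_ne hω with h | h
    · exact Eventually.of_forall fun θ' =>
        iff_of_false (fun (h' : _ ∧ _) => absurd h'.1 (not_le.2 h)) (Set.notMem_empty _)
    · filter_upwards [(hcont ω).eventually (lt_mem_nhds h)] with θ' h2
      exact iff_of_false (fun (h' : _ ∧ _) => lt_asymm h2 h'.2) (Set.notMem_empty _)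
  have h2 : Tendsto (fun θ' => P {ω | S θ ω < w θ ∧ w θ ≤ S θ' ω}) (𝓝 θ) (𝓝 (P ∅)) := by
    refine tendsto_measure_of_ae_tendsto_indicator_of_isFiniteMeasure _ MeasurableSet.empty
      (fun θ' => (measurableSet_lt (hS θ) measurable_const).inter
        (measurableSet_le measurable_const (hS θ'))) ?_
    filter_upwards [hne] with ω hω
    rcases lt_or_gt_of_ne hω with h | h
    · filter_upwards [(hcont ω).eventually (gt_mem_nhds h)] with θ' h2
      exact iff_of_false (fun (h' : _ ∧ _) => absurd h'.2 (not_le.2 h2)) (Set.notMem_empty _)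
    · exact Eventually.of_forall fun θ' =>
        iff_of_false (fun (h' : _ ∧ _) => lt_asymm h h'.1) (Set.notMem_empty _)
  have h3 := h1.add h2
  rw [measure_empty, add_zero] at h3
  refine tendsto_of_tendsto_of_tendsto_of_le_of_le' tendsto_const_nhds h3
    (Eventually.of_forall fun _ => zero_le) ?_
  filter_upwards [hw] with θ' h
  exact measure_sdiff_levelSet_le (hS θ) (hS θ') h.symm

end Envelope

end TailRisk

/-! ### The gradient of the conditional value at risk -/

namespace TailRisk

section Gradient

variable {d : ℕ} {θ θ' x : EuclideanSpace ℝ (Fin d)} {ℓ : ℝ → ℝ} {c₁ ρ : ℝ}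

/-- A multiplicative neighbourhood of a vector with positive coordinates. -/
def coordBox (θ : EuclideanSpace ℝ (Fin d)) : Set (EuclideanSpace ℝ (Fin d)) :=
  {θ' | ∀ k, θ k / 2 < θ' k ∧ θ' k < 2 * θ k}

lemma coordBox_mem_nhds (hθ : ∀ k, 0 < θ k) : coordBox θ ∈ 𝓝 θ := by
  refine eventually_all.2 fun k => ?_
  have hc : ContinuousAt (fun θ' : EuclideanSpace ℝ (Fin d) => θ' k) θ := by fun_prop
  exact (hc.eventually (lt_mem_nhds (by linarith [hθ k]))).and
    (hc.eventually (gt_mem_nhds (by linarith [hθ k])))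

lemma convex_coordBox (θ : EuclideanSpace ℝ (Fin d)) : Convex ℝ (coordBox θ) := by
  intro y hy z hz a b ha hb hab k
  have h := (convex_Ioo (θ k / 2) (2 * θ k)) (hy k) (hz k) ha hb hab
  simpa using h

lemma pos_of_mem_coordBox (hθ : ∀ k, 0 < θ k) (hθ' : θ' ∈ coordBox θ) (k : Fin d) : 0 < θ' k :=
  (half_pos (hθ k)).trans (hθ' k).1

lemma inner_le_of_mem_coordBox (hx : ∀ k, 0 ≤ x k) (hθ' : θ' ∈ coordBox θ) :
    inner ℝ θ' x ≤ 2 * inner ℝ θ x := by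
  rw [inner_eq_sum, inner_eq_sum, Finset.mul_sum]
  refine Finset.sum_le_sum fun k _ => ?_
  rw [← mul_assoc]
  exact mul_le_mul_of_nonneg_right (hθ' k).2.le (hx k)

lemma le_inner_of_mem_coordBox (hx : ∀ k, 0 ≤ x k) (hθ' : θ' ∈ coordBox θ) :
    inner ℝ θ x ≤ 2 * inner ℝ θ' x := by
  rw [inner_eq_sum, inner_eq_sum, Finset.mul_sum]
  refine Finset.sum_le_sum fun k _ => ?_
  rw [← mul_assoc]
  exact mul_le_mul_of_nonneg_right (by linarith [(hθ' k).1]) (hx k)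

lemma norm_le_mul_inner (hθ : ∀ k, 0 < θ k) (hx : ∀ k, 0 ≤ x k) :
    ‖x‖ ≤ (∑ k, (θ k)⁻¹) * inner ℝ θ x := by
  have h1 : ‖x‖ ≤ ∑ k, x k := by
    rw [EuclideanSpace.norm_eq]
    refine Real.sqrt_le_iff.2 ⟨Finset.sum_nonneg fun k _ => hx k, ?_⟩
    simp only [Real.norm_eq_abs, sq_abs]
    exact Finset.sum_sq_le_sq_sum_of_nonneg fun k _ => hx k
  refine h1.trans ?_
  rw [Finset.sum_mul]
  refine Finset.sum_le_sum fun k _ => ?_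
  rw [inv_mul_eq_div, le_div_iff₀ (hθ k), mul_comm]
  exact mul_le_inner hθ hx k

lemma LossGrowth.exists_le_rpow (h : LossGrowth ℓ c₁ ρ) :
    ∃ A B : ℝ, ∀ u, 0 ≤ u → ℓ u ≤ A * u ^ (ρ + 1) + B := by
  obtain ⟨M, hM⟩ := eventually_atTop.1
    ((h.tendsto_div_rpow.eventually (gt_mem_nhds (lt_add_one _))).and (eventually_gt_atTop 0))
  obtain ⟨B, hB⟩ := h.bddAbove M
  have hA : 0 ≤ c₁ / (ρ + 1) + 1 := by
    have := h.rho_add_one_pos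
    have := h.c₁_pos
    positivity
  refine ⟨c₁ / (ρ + 1) + 1, max B 0, fun u hu => ?_⟩
  rcases le_total u M with huM | huM
  · have h1 : ℓ u ≤ B := hB ⟨u, ⟨hu, huM⟩, rfl⟩
    have h2 : 0 ≤ (c₁ / (ρ + 1) + 1) * u ^ (ρ + 1) := by positivity
    linarith [le_max_left B 0]
  · obtain ⟨h1, h2⟩ := hM u huM
    rw [div_lt_iff₀ (by positivity)] at h1
    linarith [le_max_right B 0]

lemma LossGrowth.hasFDerivAt_inner {u₁ : ℝ}
    (hreg : ∀ u, u₁ ≤ u → DifferentiableAt ℝ ℓ u) (hx : ∀ k, 0 ≤ x k)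
    (hu : 2 * u₁ ≤ inner ℝ θ x) (hθ' : θ' ∈ coordBox θ) :
    HasFDerivAt (fun θ'' => ℓ (inner ℝ θ'' x)) (deriv ℓ (inner ℝ θ' x) • innerSL ℝ x) θ' := by
  have h1 := le_inner_of_mem_coordBox hx hθ'
  have h2 : HasFDerivAt (fun θ'' : EuclideanSpace ℝ (Fin d) => inner ℝ θ'' x)
      (innerSL ℝ x) θ' := by
    have := (innerSL ℝ x).hasFDerivAt (x := θ')
    refine this.congr_of_eventuallyEq (Eventually.of_forall fun θ'' => ?_)
    simp [real_inner_comm]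
  exact (hreg _ (by linarith)).hasDerivAt.comp_hasFDerivAt θ' h2

/-- A majorant uniform over the box: there `⟪θ', x⟫` and `⟪θ, x⟫` are comparable up to a factor `2`,
and `‖x‖` is at most a multiple of `⟪θ, x⟫`. -/
lemma LossGrowth.norm_deriv_smul_le (h : LossGrowth ℓ c₁ ρ) {u₁ : ℝ} (hu₁ : 0 < u₁)
    (hreg : ∀ u, u₁ ≤ u → 0 < deriv ℓ u ∧ deriv ℓ u ≤ 2 * c₁ * u ^ ρ)
    (hθ : ∀ k, 0 < θ k) (hx : ∀ k, 0 ≤ x k)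
    (hu : 2 * u₁ ≤ inner ℝ θ x) (hθ' : θ' ∈ coordBox θ) :
    ‖deriv ℓ (inner ℝ θ' x) • innerSL ℝ x‖ ≤
      2 * c₁ * 2 ^ ρ * (∑ k, (θ k)⁻¹) * inner ℝ θ x ^ (ρ + 1) := by
  have h1 := le_inner_of_mem_coordBox hx hθ'
  have h2 := inner_le_of_mem_coordBox hx hθ'
  obtain ⟨h3, h4⟩ := hreg (inner ℝ θ' x) (by linarith)
  have hs : 0 < inner ℝ θ x := by linarith
  have hs' : 0 < inner ℝ θ' x := by linarith
  have hc := h.c₁_pos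
  rw [norm_smul, innerSL_apply_norm, Real.norm_eq_abs, abs_of_pos h3]
  have h5 : deriv ℓ (inner ℝ θ' x) ≤ 2 * c₁ * (2 ^ ρ * inner ℝ θ x ^ ρ) := by
    refine h4.trans ?_
    rw [← Real.mul_rpow (by norm_num) hs.le]
    have := Real.rpow_le_rpow hs'.le h2 h.ρ_nonneg
    gcongr
  calc _ ≤ 2 * c₁ * (2 ^ ρ * inner ℝ θ x ^ ρ) * ((∑ k, (θ k)⁻¹) * inner ℝ θ x) :=
        mul_le_mul h5 (norm_le_mul_inner hθ hx) (norm_nonneg _) (by positivity)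
    _ = _ := by rw [Real.rpow_add_one hs.ne']; ring

variable {Ω : Type*} [MeasurableSpace Ω] {P : Measure Ω} [IsProbabilityMeasure P]
  {X : Ω → EuclideanSpace ℝ (Fin d)}

lemma LossGrowth.integrable_of_mem_coordBox (h : LossGrowth ℓ c₁ ρ) (hX : Measurable X)
    (hXnonneg : ∀ᵐ ω ∂P, ∀ k, 0 ≤ X ω k) (hθ : ∀ k, 0 < θ k)
    (hI : Integrable (fun ω => inner ℝ θ (X ω) ^ (ρ + 1)) P) (hθ' : θ' ∈ coordBox θ) :
    Integrable (fun ω => ℓ (inner ℝ θ' (X ω))) P := by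
  obtain ⟨A, B, hAB⟩ := h.exists_le_rpow
  have hm : Measurable fun ω => (inner ℝ θ' (X ω) : ℝ) := by fun_prop
  have hq := h.rho_add_one_pos
  refine Integrable.mono' (g := fun ω => |A| * (2 ^ (ρ + 1) * inner ℝ θ (X ω) ^ (ρ + 1)) + B)
    (((hI.const_mul _).const_mul _).add (integrable_const B))
    (h.measurable.comp hm).aestronglyMeasurable ?_
  filter_upwards [hXnonneg] with ω hω
  have h0 : 0 ≤ inner ℝ θ' (X ω) :=
    inner_nonneg_of_nonneg (pos_of_mem_coordBox hθ hθ') hω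
  have h0' : 0 ≤ inner ℝ θ (X ω) := inner_nonneg_of_nonneg hθ hω
  rw [Real.norm_eq_abs, abs_of_nonneg (h.nonneg _ h0)]
  refine (hAB _ h0).trans ?_
  have h1 := Real.rpow_le_rpow h0 (inner_le_of_mem_coordBox hω hθ') hq.le
  rw [Real.mul_rpow (by norm_num) h0'] at h1
  have h2 : A * inner ℝ θ' (X ω) ^ (ρ + 1) ≤ |A| * inner ℝ θ' (X ω) ^ (ρ + 1) :=
    mul_le_mul_of_nonneg_right (le_abs_self A) (by positivity)
  have h3 := mul_le_mul_of_nonneg_left h1 (abs_nonneg A)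
  linarith

/-- Differentiation under the integral over a fixed event. The margin `2 * u₁` keeps `⟪θ', X⟫` at
least `u₁` for all `θ'` in the box. -/
lemma LossGrowth.hasGradientAt_setIntegral (h : LossGrowth ℓ c₁ ρ) (hX : Measurable X)
    (hXnonneg : ∀ᵐ ω ∂P, ∀ k, 0 ≤ X ω k) (hθ : ∀ k, 0 < θ k)
    (hI : Integrable (fun ω => inner ℝ θ (X ω) ^ (ρ + 1)) P) {u₁ : ℝ} (hu₁ : 0 < u₁)
    (hreg : ∀ u, u₁ ≤ u → DifferentiableAt ℝ ℓ u ∧ 0 < deriv ℓ u ∧ deriv ℓ u ≤ 2 * c₁ * u ^ ρ)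
    {A : Set Ω} (hA : MeasurableSet A) (hAu : ∀ ω ∈ A, 2 * u₁ ≤ inner ℝ θ (X ω)) :
    IntegrableOn (fun ω => deriv ℓ (inner ℝ θ (X ω)) • X ω) A P ∧
    HasGradientAt (fun θ' => ∫ ω in A, ℓ (inner ℝ θ' (X ω)) ∂P)
      (∫ ω in A, deriv ℓ (inner ℝ θ (X ω)) • X ω ∂P) θ := by
  have hm : ∀ θ' : EuclideanSpace ℝ (Fin d), Measurable fun ω => (inner ℝ θ' (X ω) : ℝ) :=
    fun θ' => by fun_prop
  have hm' : Measurable fun ω => deriv ℓ (inner ℝ θ (X ω)) • X ω :=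
    ((measurable_deriv ℓ).comp (hm θ)).smul hX
  have hmem : θ ∈ coordBox θ := mem_of_mem_nhds (coordBox_mem_nhds hθ)
  have hbound : ∀ᵐ ω ∂P.restrict A, ∀ θ' ∈ coordBox θ,
      ‖deriv ℓ (inner ℝ θ' (X ω)) • innerSL ℝ (X ω)‖ ≤
        2 * c₁ * 2 ^ ρ * (∑ k, (θ k)⁻¹) * inner ℝ θ (X ω) ^ (ρ + 1) := by
    filter_upwards [ae_restrict_of_ae hXnonneg, ae_restrict_mem hA] with ω h1 h2 θ' hθ'
    exact h.norm_deriv_smul_le hu₁ (fun u hu => (hreg u hu).2) hθ h1 (hAu ω h2) hθ'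
  have hgrad : IntegrableOn (fun ω => deriv ℓ (inner ℝ θ (X ω)) • X ω) A P := by
    refine Integrable.mono' (hI.const_mul (2 * c₁ * 2 ^ ρ * ∑ k, (θ k)⁻¹)).integrableOn
      hm'.aestronglyMeasurable ?_
    filter_upwards [hbound] with ω hω
    have := hω θ hmem
    rwa [norm_smul, innerSL_apply_norm, ← norm_smul] at this
  refine ⟨hgrad, ?_⟩
  rw [hasGradientAt_iff_hasFDerivAt]
  have hD := hasFDerivAt_integral_of_dominated_of_fderiv_le (𝕜 := ℝ) (μ := P.restrict A)
    (F := fun θ' ω => ℓ (inner ℝ θ' (X ω)))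
    (F' := fun θ' ω => deriv ℓ (inner ℝ θ' (X ω)) • innerSL ℝ (X ω))
    (coordBox_mem_nhds hθ)
    (Eventually.of_forall fun θ' => (h.measurable.comp (hm θ')).aestronglyMeasurable)
    (h.integrable_of_mem_coordBox hX hXnonneg hθ hI hmem).integrableOn
    (by
      have := (innerSL ℝ (E := EuclideanSpace ℝ (Fin d))).continuous.comp_aestronglyMeasurable
        (hm'.aestronglyMeasurable (μ := P.restrict A))
      refine this.congr (Eventually.of_forall fun ω => ?_)
      simp)
    hbound (hI.const_mul _).integrableOn (by
      filter_upwards [ae_restrict_of_ae hXnonneg, ae_restrict_mem hA] with ω h1 h2 θ' hθ'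
      exact LossGrowth.hasFDerivAt_inner (fun u hu => (hreg u hu).1) h1 (hAu ω h2) hθ')
  have := (innerSL ℝ (E := EuclideanSpace ℝ (Fin d))).integral_comp_comm hgrad
  simp only [map_smul] at this
  rw [this] at hD
  exact hD

/-- Mean value inequality on the convex box; it provides the integrable Lipschitz constant for the
envelope theorem. -/
lemma LossGrowth.abs_sub_le (h : LossGrowth ℓ c₁ ρ) {u₁ : ℝ} (hu₁ : 0 < u₁)
    (hreg : ∀ u, u₁ ≤ u → DifferentiableAt ℝ ℓ u ∧ 0 < deriv ℓ u ∧ deriv ℓ u ≤ 2 * c₁ * u ^ ρ)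
    (hθ : ∀ k, 0 < θ k) (hx : ∀ k, 0 ≤ x k)
    (hu : 2 * u₁ ≤ inner ℝ θ x) (hθ' : θ' ∈ coordBox θ) :
    |ℓ (inner ℝ θ' x) - ℓ (inner ℝ θ x)| ≤
      ‖θ' - θ‖ * (2 * c₁ * 2 ^ ρ * (∑ k, (θ k)⁻¹) * inner ℝ θ x ^ (ρ + 1)) := by
  rw [mul_comm]
  exact (convex_coordBox θ).norm_image_sub_le_of_norm_hasFDerivWithin_le
    (fun θ'' hθ'' => (LossGrowth.hasFDerivAt_inner (fun u hu => (hreg u hu).1) hx hu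
      hθ'').hasFDerivWithinAt)
    (fun θ'' hθ'' => h.norm_deriv_smul_le hu₁ (fun u hu => (hreg u hu).2) hθ hx hu hθ'')
    (mem_of_mem_nhds (coordBox_mem_nhds hθ)) hθ'

/-- The gradient of the conditional value at risk at a small level, for a vector with a density. -/
theorem LossGrowth.hasGradientAt_lossCVaR (h : LossGrowth ℓ c₁ ρ) (hX : Measurable X)
    (hXnonneg : ∀ᵐ ω ∂P, ∀ k, 0 ≤ X ω k) (hpdf : HasPDF X P) (hd : 0 < d) (hθ : ∀ k, 0 < θ k)
    (hI : Integrable (fun ω => inner ℝ θ (X ω) ^ (ρ + 1)) P)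
    (hpos : ∀ t, 0 < tail P (fun ω => inner ℝ θ (X ω)) t) :
    ∀ᶠ b in 𝓝[>] (0 : ℝ), ∃ w, 0 < w ∧ tail P (fun ω => inner ℝ θ (X ω)) w = b ∧
      b = P.real {ω | w ≤ inner ℝ θ (X ω)} ∧
      IntegrableOn (fun ω => deriv ℓ (inner ℝ θ (X ω)) • X ω) {ω | w < inner ℝ θ (X ω)} P ∧
      HasGradientAt (lossCVaR P X ℓ b)
        (b⁻¹ • ∫ ω in {ω | w < inner ℝ θ (X ω)}, deriv ℓ (inner ℝ θ (X ω)) • X ω ∂P) θ := by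
  obtain ⟨u₁, hu₁, hreg⟩ := h.exists_regular
  -- Two factors `2` are spent: `⟪θ', X⟫ ≥ 4 * u₁` gives `⟪θ, X⟫ ≥ 2 * u₁`, and this gives at least
  -- `u₁` throughout the box.
  obtain ⟨s₁, hs₁⟩ := h.exists_threshold (P := P) (4 * u₁)
  have hm : ∀ θ' : EuclideanSpace ℝ (Fin d), Measurable fun ω => (inner ℝ θ' (X ω) : ℝ) :=
    fun θ' => by fun_prop
  have hN := coordBox_mem_nhds hθ
  have hmem : θ ∈ coordBox θ := mem_of_mem_nhds hN
  have hnull : ∀ θ' ∈ coordBox θ, ∀ w : ℝ, P {ω | inner ℝ θ' (X ω) = w} = 0 := by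
    intro θ' hθ' w
    refine measure_inner_eq_zero hpdf hX (fun h0 => ?_) w
    have := pos_of_mem_coordBox hθ hθ' ⟨0, hd⟩
    simp [h0] at this
  -- Without atoms the exceedance probability equals the level `b` exactly, the same for all `θ'`,
  -- as the envelope theorem requires.
  have hae : ∀ θ' ∈ coordBox θ, ∀ w : ℝ,
      ({ω | w < inner ℝ θ' (X ω)} : Set Ω) =ᵐ[P] {ω | w ≤ inner ℝ θ' (X ω)} := by
    intro θ' hθ' w
    have hne : ∀ᵐ ω ∂P, inner ℝ θ' (X ω) ≠ w := by
      rw [ae_iff]; simpa using hnull θ' hθ' w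
    filter_upwards [hne] with ω hω
    exact propext ⟨fun (h1 : w < inner ℝ θ' (X ω)) => h1.le,
      fun (h1 : w ≤ inner ℝ θ' (X ω)) => lt_of_le_of_ne h1 (Ne.symm hω)⟩
  have hreal : ∀ θ' ∈ coordBox θ, ∀ w : ℝ,
      tail P (fun ω => inner ℝ θ' (X ω)) w = P.real {ω | w ≤ inner ℝ θ' (X ω)} :=
    fun θ' hθ' w => measureReal_congr (hae θ' hθ' w)
  -- As `⟪θ, X⟫ > 2 * s₁` implies `⟪θ', X⟫ > s₁`, one range of levels `b` works for the whole box.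
  filter_upwards [self_mem_nhdsWithin, nhdsWithin_le_nhds (gt_mem_nhds (hpos (2 * s₁)))]
    with b hb hbs
  have hb0 : (0 : ℝ) < b := hb
  have hex : ∀ θ' ∈ coordBox θ, ∃ w, 4 * u₁ < w ∧
      b = P.real {ω | w ≤ inner ℝ θ' (X ω)} ∧
      (∀ u, 0 ≤ u → (ℓ w ≤ ℓ u ↔ w ≤ u)) ∧
      lossCVaR P X ℓ b θ' = b⁻¹ * ∫ ω in {ω | w ≤ inner ℝ θ' (X ω)}, ℓ (inner ℝ θ' (X ω)) ∂P := by
    intro θ' hθ'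
    have hlt : b < tail P (fun ω => inner ℝ θ' (X ω)) s₁ := by
      refine hbs.trans_le (ENNReal.toReal_mono (measure_ne_top _ _) (measure_mono_ae ?_))
      filter_upwards [hXnonneg] with ω hω
      intro (h1 : 2 * s₁ < inner ℝ θ (X ω))
      have := le_inner_of_mem_coordBox hω hθ'
      show s₁ < inner ℝ θ' (X ω)
      linarith
    obtain ⟨w, h1, h2, h3, h4, h5⟩ := hs₁ (fun ω => inner ℝ θ' (X ω)) (hm θ') (by
      filter_upwards [hXnonneg] with ω hω
      exact inner_nonneg_of_nonneg (pos_of_mem_coordBox hθ hθ') hω) b hb0 hlt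
    have h6 : b = P.real {ω | w ≤ inner ℝ θ' (X ω)} :=
      le_antisymm h3 ((hreal θ' hθ' w).symm.le.trans h2)
    refine ⟨w, h1, h6, h4, ?_⟩
    rw [lossCVaR, h5, ← h6]
  choose! w hw1 hw2 hw3 hw4 using hex
  have hAm : ∀ θ', MeasurableSet {ω | w θ' ≤ inner ℝ θ' (X ω)} :=
    fun θ' => measurableSet_le measurable_const (hm θ')
  obtain ⟨hgi, hg⟩ := h.hasGradientAt_setIntegral hX hXnonneg hθ hI hu₁ hreg (hAm θ)
    fun ω (hω : w θ ≤ inner ℝ θ (X ω)) => by linarith [hw1 θ hmem]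
  have hderiv := hasFDerivAt_setIntegral_levelSet (P := P) (v := fun θ' => ℓ (w θ'))
    (A := fun θ' => {ω | w θ' ≤ inner ℝ θ' (X ω)}) (L := fun θ' ω => ℓ (inner ℝ θ' (X ω)))
    (G := fun ω => 2 * c₁ * 2 ^ ρ * (∑ k, (θ k)⁻¹) * inner ℝ θ (X ω) ^ (ρ + 1)) hN
    (fun θ' hθ' => h.integrable_of_mem_coordBox hX hXnonneg hθ hI hθ')
    (fun θ' _ => hAm θ') (fun θ' hθ' => (hw2 θ' hθ').symm.trans (hw2 θ hmem))
    (fun θ' hθ' => by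
      filter_upwards [hXnonneg] with ω hω
      have h0 : 0 ≤ inner ℝ θ' (X ω) :=
        inner_nonneg_of_nonneg (pos_of_mem_coordBox hθ hθ') hω
      have h1 := hw3 θ' hθ' _ h0
      exact ⟨fun h2 => h1.2 h2, fun h2 => (not_le.1 fun h3 => h2 (h1.1 h3)).le⟩)
    (hI.const_mul _)
    (fun θ' hθ' => by
      filter_upwards [hXnonneg] with ω hω
      intro hmemA
      refine h.abs_sub_le hu₁ hreg hθ hω ?_ hθ'
      rcases hmemA with h1 | h1
      · have h1' : w θ ≤ inner ℝ θ (X ω) := h1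
        linarith [hw1 θ hmem]
      · have h1' : w θ' ≤ inner ℝ θ' (X ω) := h1
        linarith [hw1 θ' hθ', inner_le_of_mem_coordBox hω hθ'])
    (tendsto_measure_sdiff_levelSet (S := fun θ' ω => inner ℝ θ' (X ω)) hm
      (fun ω => by fun_prop) (hnull θ hmem _)
      (by filter_upwards [hN] with θ' hθ' using (hw2 θ' hθ').symm.trans (hw2 θ hmem)))
    (hasGradientAt_iff_hasFDerivAt.1 hg)
  refine ⟨w θ, by linarith [hw1 θ hmem], (hreal θ hmem _).trans (hw2 θ hmem).symm, hw2 θ hmem,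
    hgi.congr_set_ae (hae θ hmem _), ?_⟩
  rw [setIntegral_congr_set (hae θ hmem _), hasGradientAt_iff_hasFDerivAt, map_smul]
  refine (hderiv.const_smul b⁻¹).congr_of_eventuallyEq ?_
  filter_upwards [hN] with θ' hθ'
  rw [hw4 θ' hθ']
  rfl

end Gradient

end TailRisk

/-! ### Exact order of the risk and of its gradient; conclusion -/

namespace TailRisk

section Scaling

variable {d : ℕ} {θ : EuclideanSpace ℝ (Fin d)} {ℓ : ℝ → ℝ} {c₁ ρ α : ℝ}
  {Ω : Type*} [MeasurableSpace Ω] {P : Measure Ω} [IsProbabilityMeasure P]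
  {X : Ω → EuclideanSpace ℝ (Fin d)}

lemma LossGrowth.exists_tendsto_CVaR {S : Ω → ℝ} (h : LossGrowth ℓ c₁ ρ) (hS : Measurable S)
    (hS0 : ∀ᵐ ω ∂P, 0 ≤ S ω) (hvar : MemLp (fun ω => ℓ (S ω)) 2 P)
    (hT : IsRVTail (tail P S) α) :
    ∃ w : ℝ → ℝ, Tendsto w (𝓝[>] 0) atTop ∧
      Tendsto (fun b => tail P S (w b) / b) (𝓝[>] 0) (𝓝 1) ∧
      Tendsto (fun b => (w b ^ (ρ + 1))⁻¹ • CVaR P (fun ω => ℓ (S ω)) b) (𝓝[>] 0)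
        (𝓝 (c₁ / (ρ + 1) * karamataConst (ρ + 1) α)) := by
  obtain ⟨s₁, hs₁⟩ := h.exists_threshold (P := P) 0
  choose! w hw using hs₁ S hS hS0
  have hev : ∀ᶠ b in 𝓝[>] (0 : ℝ), 0 < b ∧ b < tail P S s₁ :=
    (eventually_mem_nhdsWithin).and (nhdsWithin_le_nhds (gt_mem_nhds (hT.pos s₁)))
  obtain ⟨h1, h2⟩ := tendsto_threshold (w := w) hT (by
    filter_upwards [hev] with b hb
    exact ⟨(hw b hb.1 hb.2).2.1, (hw b hb.1 hb.2).2.2.1⟩)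
  refine ⟨w, h1, h2, ((h.tendsto_conditional hS hS0 hvar hT).comp h1).congr' ?_⟩
  filter_upwards [hev] with b hb
  rw [(hw b hb.1 hb.2).2.2.2.2]
  rfl

/-- The integrand `ℓ'(S) X_k` is the weight `X_k / S`, bounded by `(θ k)⁻¹`, times `S ℓ'(S)`, which
grows like `c₁ S ^ (ρ + 1)`. -/
lemma LossGrowth.exists_tendsto_gradient (h : LossGrowth ℓ c₁ ρ) (hd : 0 < d) (hX : Measurable X)
    (hXnonneg : ∀ᵐ ω ∂P, ∀ k, 0 ≤ X ω k) (hpdf : HasPDF X P) (hθ : ∀ k, 0 < θ k)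
    (hvar : MemLp (fun ω => ℓ (inner ℝ θ (X ω))) 2 P)
    (hT : IsRVTail (tail P fun ω => inner ℝ θ (X ω)) α) {p : Fin d → ℝ}
    (hp : ∀ k, Tendsto (fun t => weightedTail P (fun ω => X ω k / inner ℝ θ (X ω))
        (fun ω => inner ℝ θ (X ω)) t / tail P (fun ω => inner ℝ θ (X ω)) t) atTop (𝓝 (p k))) :
    (∀ᶠ b in 𝓝[>] (0 : ℝ), DifferentiableAt ℝ (lossCVaR P X ℓ b) θ) ∧
    ∃ w : ℝ → ℝ, Tendsto w (𝓝[>] 0) atTop ∧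
      Tendsto (fun b => tail P (fun ω => inner ℝ θ (X ω)) (w b) / b) (𝓝[>] 0) (𝓝 1) ∧
      ∀ k, Tendsto (fun b => (w b ^ (ρ + 1))⁻¹ • gradient (lossCVaR P X ℓ b) θ k) (𝓝[>] 0)
        (𝓝 (c₁ * (p k * karamataConst (ρ + 1) α))) := by
  have hS : Measurable fun ω => (inner ℝ θ (X ω) : ℝ) := by fun_prop
  have hS0 : ∀ᵐ ω ∂P, 0 ≤ inner ℝ θ (X ω) := by
    filter_upwards [hXnonneg] with ω hω using inner_nonneg_of_nonneg hθ hω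
  have hI : Integrable (fun ω => inner ℝ θ (X ω) ^ (ρ + 1)) P :=
    (h.memLp_rpow hS hS0 hvar).integrable (by norm_num)
  have hev := h.hasGradientAt_lossCVaR hX hXnonneg hpdf hd hθ hI hT.pos
  refine ⟨by filter_upwards [hev] with b ⟨w, hw⟩ using hw.2.2.2.2.differentiableAt, ?_⟩
  obtain ⟨w, hw⟩ := hev.choice
  obtain ⟨h1, h2⟩ := tendsto_threshold (w := w) hT (by
    filter_upwards [hw] with b hb
    exact ⟨hb.2.1.le, hb.2.2.1.le⟩)
  refine ⟨w, h1, h2, fun k => ?_⟩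
  have hφ : Tendsto (fun u => u * deriv ℓ u / u ^ (ρ + 1)) atTop (𝓝 c₁) := by
    refine h.tendsto_deriv_div.congr' ?_
    filter_upwards [eventually_gt_atTop 0] with u hu
    rw [Real.rpow_add_one hu.ne']
    field_simp
  have hlim := (tendsto_truncated_expectation (P := P) (M := (θ k)⁻¹) hS (by fun_prop)
    (by filter_upwards [hXnonneg] with ω hω using (div_inner_mem hθ hω k).1)
    (by filter_upwards [hXnonneg] with ω hω using (div_inner_mem hθ hω k).2) hT
    h.rho_add_one_pos (h.lt_index hS hS0 hvar hT) (hp k) hI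
    (measurable_id.mul (measurable_deriv ℓ)) hφ).comp h1
  refine hlim.congr' ?_
  filter_upwards [hw] with b hb
  obtain ⟨hw0, hb1, _, hb3, hb4⟩ := hb
  have hproj := (EuclideanSpace.proj k : EuclideanSpace ℝ (Fin d) →L[ℝ] ℝ).integral_comp_comm hb3
  simp only [PiLp.proj_apply, PiLp.smul_apply, smul_eq_mul] at hproj
  rw [hb4.gradient, PiLp.smul_apply, ← hproj, Function.comp, hb1, smul_eq_mul, smul_eq_mul,
    ← mul_assoc, ← mul_inv, ← div_eq_inv_mul]
  congr 1
  refine setIntegral_congr_fun (measurableSet_lt measurable_const hS)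
    fun ω (hω : w b < inner ℝ θ (X ω)) => ?_
  have hne : inner ℝ θ (X ω) ≠ 0 := (hw0.trans hω).ne'
  simp only [Pi.mul_apply, id]
  field_simp

end Scaling

end TailRisk

theorem theorem2 {d : ℕ} (hd : 0 < d) {Ω : Type*} [MeasurableSpace Ω]
    (P : Measure Ω) [IsProbabilityMeasure P]
    (X : Ω → EuclideanSpace ℝ (Fin d)) (hX : Measurable X)
    (hXnonneg : ∀ᵐ ω ∂P, ∀ k, 0 ≤ X ω k)
    (a : ℕ → Fin d → ℝ) (ahat : Fin d → ℝ) (hheavy : TailRisk.HeavyTailed P X a ahat)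
    (ℓ : ℝ → ℝ) (c₁ ρ : ℝ) (hℓ : TailRisk.LossGrowth ℓ c₁ ρ)
    (Θ : Set (EuclideanSpace ℝ (Fin d))) (hΘ : ∀ θ ∈ Θ, ∀ k, 0 < θ k)
    (hvar : ∀ θ ∈ Θ, MemLp (fun ω => ℓ (inner ℝ θ (X ω))) 2 P) :
    ∃ α : Fin d → ℝ, (∀ k, TailRisk.HasTailIndex P (fun ω => X ω k) (α k)) ∧
      ∀ ξ : ℝ, ξ = 1 / (⨅ k, α k) → ∀ θ ∈ Θ,
        -- the relation for the conditional value at risk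
        (∀ {ι : Type*} (l : Filter ι) (β β₀ : ι → ℝ) (c : ℝ), 1 < c →
          Tendsto β l (𝓝[>] 0) → Tendsto (fun i => β₀ i / β i) l (𝓝 c) →
          (fun i => TailRisk.lossCVaR P X ℓ (β i) θ) ~[l]
            fun i => (β₀ i / β i) ^ (ξ * (ρ + 1)) * TailRisk.lossCVaR P X ℓ (β₀ i) θ) ∧
        -- the relation for the gradients, which exist when `X` has a density
        (HasPDF X P →
          (∀ᶠ b in 𝓝[>] (0 : ℝ), DifferentiableAt ℝ (TailRisk.lossCVaR P X ℓ b) θ) ∧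
          (∀ {ι : Type*} (l : Filter ι) (β β₀ : ι → ℝ) (c : ℝ), 1 < c →
            Tendsto β l (𝓝[>] 0) → Tendsto (fun i => β₀ i / β i) l (𝓝 c) →
            ((fun i => gradient (TailRisk.lossCVaR P X ℓ (β i)) θ) ~[l]
              fun i => (β₀ i / β i) ^ (ξ * (ρ + 1)) •
                gradient (TailRisk.lossCVaR P X ℓ (β₀ i)) θ) ∧
            ∀ k, 0 < ahat k →
              (fun i => gradient (TailRisk.lossCVaR P X ℓ (β i)) θ k) ~[l]
                fun i => (β₀ i / β i) ^ (ξ * (ρ + 1)) *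
                  gradient (TailRisk.lossCVaR P X ℓ (β₀ i)) θ k)) := by
  obtain ⟨α, hα, k₀, hmarg, hbox⟩ := hheavy.exists_regular_variation hd hX hXnonneg
  refine ⟨α, fun k => ⟨(hα k).index_pos, (hα k).tendsto⟩, ?_⟩
  -- Every marginal tail is `O` of the one at `k₀`, so no index is below `α k₀`.
  have hmin : ⨅ k, α k = α k₀ := by
    have : Nonempty (Fin d) := ⟨k₀⟩
    refine le_antisymm (ciInf_le (Set.finite_range α).bddBelow k₀) (le_ciInf fun k => ?_)
    obtain ⟨c, -, hc⟩ := hmarg k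
    exact (hα k).index_le_of_bounded (hα k₀) (M := c + 1)
      ((hc.eventually (gt_mem_nhds (lt_add_one c))).mono fun _ h => le_of_lt h)
  rintro ξ rfl θ hθΘ
  rw [hmin]
  have hθ := hΘ θ hθΘ
  have hv := hvar θ hθΘ
  obtain ⟨hT, p, hp, hp0, hplim⟩ :=
    TailRisk.isRVTail_inner hX hXnonneg (hα k₀) rfl hmarg hbox hθ
  have hS : Measurable fun ω => (inner ℝ θ (X ω) : ℝ) := by fun_prop
  have hS0 : ∀ᵐ ω ∂P, 0 ≤ inner ℝ θ (X ω) := by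
    filter_upwards [hXnonneg] with ω hω using TailRisk.inner_nonneg_of_nonneg hθ hω
  have hκ : 0 < TailRisk.karamataConst (ρ + 1) (α k₀) :=
    one_pos.trans_le (TailRisk.one_le_karamataConst hS hT hℓ.rho_add_one_pos
      (hℓ.lt_index hS hS0 hv hT) ((hℓ.memLp_rpow hS hS0 hv).integrable (by norm_num)))
  have hc₁ := hℓ.c₁_pos
  have hq := hℓ.rho_add_one_pos
  refine ⟨fun l β β₀ c hc hβ hβ₀ => ?_, fun hpdf => ?_⟩
  · obtain ⟨w, hw, hTw, hlim⟩ := hℓ.exists_tendsto_CVaR hS hS0 hv hT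
    exact TailRisk.isEquivalent_of_threshold hT
      (f := fun b => TailRisk.lossCVaR P X ℓ b θ) hw hTw hlim (by positivity) hc hβ hβ₀
  · obtain ⟨hdiff, w, hw, hTw, hlim⟩ :=
      hℓ.exists_tendsto_gradient hd hX hXnonneg hpdf hθ hv hT hplim
    refine ⟨hdiff, fun l β β₀ c hc hβ hβ₀ => ⟨?_, fun k hk => ?_⟩⟩
    -- The coordinatewise limits assemble into one vector, nonzero because `p` is. Coordinates with
    -- `p k = 0` are only controlled relative to the norm of the whole gradient.
    · refine TailRisk.isEquivalent_of_threshold hT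
        (f := fun b => gradient (TailRisk.lossCVaR P X ℓ b) θ)
        (A := WithLp.toLp 2 fun k => c₁ * (p k * TailRisk.karamataConst (ρ + 1) (α k₀)))
        hw hTw ?_ (fun h0 => hp0 (funext fun k => ?_)) hc hβ hβ₀
      · exact ((PiLp.continuous_toLp 2 fun _ : Fin d => ℝ).tendsto _).comp
          (tendsto_pi_nhds.2 hlim)
      · have h1 := congrArg (fun v : EuclideanSpace ℝ (Fin d) => v k) h0
        simpa [hc₁.ne', hκ.ne'] using h1
    · have hpk := hp k hk
      exact TailRisk.isEquivalent_of_threshold hT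
        (f := fun b => gradient (TailRisk.lossCVaR P X ℓ b) θ k) hw hTw (hlim k)
        (by positivity) hc hβ hβ₀
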